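/- Let $d\ge 2$ and let $\Omega\subset\mathbb R^d$ be a bounded, connected, open set with boundary of class $C^{1,1}$. Let $\Gamma_{\mathrm D},\Gamma_{\mathrm N}\subset\partial\Omega$ be non-empty, disjoint and relatively open in $\partial\Omega$, with $\partial\Omega=\overline{\Gamma_{\mathrm N}}\cup\overline{\Gamma_{\mathrm D}}$. Put $$\mathcal V=\{v\in H^1(\Omega)^d:\ v|_{\Gamma_{\mathrm D}}=0\},\qquad H^{1/2}(\Gamma_{\mathrm N})=\{v|_{\Gamma_{\mathrm N}}:\ v\in\mathcal V\},$$ where boundary values are taken in the sense of traces. Let $L^\infty_+(\Omega)$ be the set of $a\in L^\infty(\Omega)$ with $\operatorname{ess\,inf}_\Omega a>0$. For $(\lambda,\mu)\in L^\infty(\Omega)^2$ let $$\mathbb C(\lambda,\mu)_{ijkl}=\lambda\,\delta_{ij}\delta_{kl}+\mu\,(\delta_{ik}\delta_{jl}+\delta_{il}\delta_{jk}),\qquad (\mathbb C A)_{ij}=\sum_{k,l}\mathbb C_{ijkl}A_{kl},$$ and write $A:B=\sum_{i,j}A_{ij}B_{ij}$ and $\hat\nabla u=\tfrac12(\nabla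 u+(\nabla u)^T)$. Fix $g\in L^2(\Gamma_{\mathrm N})^d$ and $f\in H^{1/2}(\Gamma_{\mathrm N})$. For every $(\lambda,\mu)\in L^\infty_+(\Omega)\times L^\infty_+(\Omega)$ there are a unique $u_{\mathrm N}\in\mathcal V$ with $$\int_\Omega\mathbb C(\lambda,\mu)\hat\nabla u_{\mathrm N}:\hat\nabla v\,dx=\int_{\Gamma_{\mathrm N}}g\cdot v\,ds\qquad\text{for all } v\in\mathcal V$$ (the weak solution of $-\operatorname{div}(\mathbb C\hat\nabla u_{\mathrm N})=0$ in $\Omega$, $(\mathbb C\hat\nabla u_{\mathrm N})\nu=g$ on $\Gamma_{\mathrm N}$, $u_{\mathrm N}=0$ on $\Gamma_{\mathrm D}$), and a unique $u_{\mathrm D}\in\mathcal V$ with $u_{\mathrm D}|_{\Gamma_{\mathrm N}}=f$ and $$\int_\Omega\mathbb C(\lambda,\mu)\hat\nabla u_{\mathrm D}:\hat\nabla v\,dx=0\qquad\text{for all } v\in\mathcal V\text{ with } v|_{\Gamma_{\mathrm N}}=0$$ (the weak solution of $-\operatorname{div}(\mathbb C\hat\nabla u_{\mathrm D})=0$ in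 $\Omega$, $u_{\mathrm D}=f$ on $\Gamma_{\mathrm N}$, $u_{\mathrm D}=0$ on $\Gamma_{\mathrm D}$). The Kohn–Vogelius functional $J:L^\infty_+(\Omega)\times L^\infty_+(\Omega)\to\mathbb R$, $$J(\lambda,\mu)=\int_\Omega\mathbb C(\lambda,\mu)\hat\nabla(u_{\mathrm N}-u_{\mathrm D}):\hat\nabla(u_{\mathrm N}-u_{\mathrm D})\,dx,$$ is Fréchet differentiable at every point (with respect to the norm of $L^\infty(\Omega)\times L^\infty(\Omega)$), and for all $(\lambda,\mu)\in L^\infty_+(\Omega)\times L^\infty_+(\Omega)$ and every direction $(\tilde\lambda,\tilde\mu)\in L^\infty(\Omega)\times L^\infty(\Omega)$ (in particular in $L^\infty_+(\Omega)\times L^\infty_+(\Omega)$), $$J'(\lambda,\mu)(\tilde\lambda,\tilde\mu)=\int_\Omega\mathbb C(\tilde\lambda,\tilde\mu)\hat\nabla u_{\mathrm D}:\hat\nabla u_{\mathrm D}\,dx-\int_\Omega\mathbb C(\tilde\lambda,\tilde\mu)\hat\nabla u_{\mathrm N}:\hat\nabla u_{\mathrm N}\,dx,$$ where $u_{\mathrm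 N},u_{\mathrm D}$ are the solutions for $(\lambda,\mu)$. -/

import Mathlib

open MeasureTheory Filter Topology
open scoped ContDiff ENNReal InnerProductSpace

namespace Elasticity

noncomputable section

/-- `ℝ^d` with the Euclidean norm. -/
abbrev Vec (d : ℕ) : Type := EuclideanSpace ℝ (Fin d)

/-- `ℝ^{d × d}` with the Euclidean (Frobenius) norm. -/
abbrev Mat (d : ℕ) : Type := EuclideanSpace ℝ (Fin d × Fin d)

/-! ### Domains of class `C^{1,1}` and their boundary -/

/-- The boundary of `Ω` is of class `C^{1,1}`: near each boundary point, in suitable orthonormal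
coordinates with last axis `n`, the set `Ω` is the strict epigraph of a function `γ` of the other
coordinates `x - ⟪n, x⟫ n`, where `γ` is differentiable with Lipschitz derivative. -/
def HasC11Boundary {d : ℕ} (Ω : Set (Vec d)) : Prop :=
  ∀ x₀ ∈ frontier Ω, ∃ r > (0 : ℝ), ∃ n : Vec d, ‖n‖ = 1 ∧ ∃ γ : Vec d → ℝ,
    Differentiable ℝ γ ∧ (∃ K, LipschitzWith K (fderiv ℝ γ)) ∧
      ∀ x ∈ Metric.ball x₀ r, x ∈ Ω ↔ γ (x - ⟪n, x⟫_ℝ • n) < ⟪n, x⟫_ℝ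

/-- `Γ` is a relatively open subset of the boundary of `Ω`. -/
def IsOpenInBoundary {d : ℕ} (Ω Γ : Set (Vec d)) : Prop :=
  ∃ U : Set (Vec d), IsOpen U ∧ Γ = U ∩ frontier Ω

/-- The space `L²(Γ)^d`, for `Γ` a part of the boundary of a domain in `ℝ^d`, with respect to the
surface measure (the `(d - 1)`-dimensional Hausdorff measure, normalized as usual). -/
abbrev L2Surface {d : ℕ} (Γ : Set (Vec d)) : Type :=
  Lp (Vec d) 2 ((Measure.euclideanHausdorffMeasure (d - 1) : Measure (Vec d)).restrict Γ)

/-! ### The Sobolev space `H¹(Ω)^d` -/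

/-- `G = ∇u` on `Ω` in the weak sense, where `(∇u)_{ij} = ∂u_i / ∂x_j`. -/
def IsWeakGradient {d : ℕ} (Ω : Set (Vec d)) (u : Vec d → Vec d) (G : Vec d → Mat d) : Prop :=
  ∀ φ : Vec d → ℝ, ContDiff ℝ ∞ φ → HasCompactSupport φ → tsupport φ ⊆ Ω → ∀ i j : Fin d,
    ∫ x in Ω, u x i * fderiv ℝ φ x (EuclideanSpace.single j 1) = -∫ x in Ω, G x (i, j) * φ x

theorem integrable_coord_mul {d : ℕ} {ι : Type*} [Fintype ι] {Ω : Set (Vec d)}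
    (u : Lp (EuclideanSpace ℝ ι) 2 (volume.restrict Ω)) (i : ι) {ψ : Vec d → ℝ}
    (hψ : Continuous ψ) (hs : HasCompactSupport ψ) :
    Integrable (fun x => u x i * ψ x) (volume.restrict Ω) := by
  have h1 : MemLp (fun x => u x i) 2 (volume.restrict Ω) :=
    (EuclideanSpace.proj (𝕜 := ℝ) i).comp_memLp' (Lp.memLp u)
  have h2 : MemLp ψ 2 (volume.restrict Ω) := (hψ.memLp_of_hasCompactSupport hs).restrict Ω
  exact h1.integrable_mul h2

/-- The space `H¹(Ω)^d`, as the space of all pairs `(u, ∇u)` of an `L²` vector field and its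
weak gradient, when this is in `L²`; it carries the usual `H¹` norm. -/
def H1 {d : ℕ} (Ω : Set (Vec d)) : Submodule ℝ
    (WithLp 2 (Lp (Vec d) 2 (volume.restrict Ω) × Lp (Mat d) 2 (volume.restrict Ω))) where
  carrier := {w | IsWeakGradient Ω w.fst w.snd}
  zero_mem' := by
    intro φ _ _ _ i j
    have h1 : ∫ x in Ω, (0 : Lp (Vec d) 2 (volume.restrict Ω)) x i
        * fderiv ℝ φ x (EuclideanSpace.single j 1) = 0 := by
      refine integral_eq_zero_of_ae ?_
      filter_upwards [Lp.coeFn_zero (Vec d) 2 (volume.restrict Ω)] with x hx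
      rw [hx]
      simp
    have h2 : ∫ x in Ω, (0 : Lp (Mat d) 2 (volume.restrict Ω)) x (i, j) * φ x = 0 := by
      refine integral_eq_zero_of_ae ?_
      filter_upwards [Lp.coeFn_zero (Mat d) 2 (volume.restrict Ω)] with x hx
      rw [hx]
      simp
    simp only [WithLp.zero_fst, WithLp.zero_snd]
    rw [h1, h2, neg_zero]
  add_mem' := by
    intro v w hv hw φ hφ hc hs i j
    have hD : Continuous fun x => fderiv ℝ φ x (EuclideanSpace.single j 1) :=
      (hφ.continuous_fderiv (by simp)).clm_apply continuous_const
    have hDc : HasCompactSupport fun x => fderiv ℝ φ x (EuclideanSpace.single j 1) :=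
      hc.fderiv_apply ℝ _
    have h1 : ∫ x in Ω, (v.fst + w.fst) x i * fderiv ℝ φ x (EuclideanSpace.single j 1)
        = (∫ x in Ω, v.fst x i * fderiv ℝ φ x (EuclideanSpace.single j 1))
          + ∫ x in Ω, w.fst x i * fderiv ℝ φ x (EuclideanSpace.single j 1) := by
      rw [← integral_add (integrable_coord_mul _ i hD hDc) (integrable_coord_mul _ i hD hDc)]
      refine integral_congr_ae ?_
      filter_upwards [Lp.coeFn_add v.fst w.fst] with x hx
      rw [hx]
      simp [add_mul]
    have h2 : ∫ x in Ω, (v.snd + w.snd) x (i, j) * φ x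
        = (∫ x in Ω, v.snd x (i, j) * φ x) + ∫ x in Ω, w.snd x (i, j) * φ x := by
      rw [← integral_add (integrable_coord_mul _ _ hφ.continuous hc)
        (integrable_coord_mul _ _ hφ.continuous hc)]
      refine integral_congr_ae ?_
      filter_upwards [Lp.coeFn_add v.snd w.snd] with x hx
      rw [hx]
      simp [add_mul]
    simp only [WithLp.add_fst, WithLp.add_snd]
    rw [h1, h2, hv φ hφ hc hs i j, hw φ hφ hc hs i j]
    ring
  smul_mem' := by
    intro c w hw φ hφ hc hs i j
    have h1 : ∫ x in Ω, (c • w.fst) x i * fderiv ℝ φ x (EuclideanSpace.single j 1)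
        = c * ∫ x in Ω, w.fst x i * fderiv ℝ φ x (EuclideanSpace.single j 1) := by
      rw [← integral_const_mul]
      refine integral_congr_ae ?_
      filter_upwards [Lp.coeFn_smul c w.fst] with x hx
      rw [hx]
      simp [mul_assoc]
    have h2 : ∫ x in Ω, (c • w.snd) x (i, j) * φ x
        = c * ∫ x in Ω, w.snd x (i, j) * φ x := by
      rw [← integral_const_mul]
      refine integral_congr_ae ?_
      filter_upwards [Lp.coeFn_smul c w.snd] with x hx
      rw [hx]
      simp [mul_assoc]
    simp only [WithLp.smul_fst, WithLp.smul_snd]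
    rw [h1, h2, hw φ hφ hc hs i j]
    ring

/-- The vector field `u ∈ L²(Ω)^d` underlying an element of `H¹(Ω)^d`. -/
def fieldOf {d : ℕ} {Ω : Set (Vec d)} (u : H1 Ω) : Lp (Vec d) 2 (volume.restrict Ω) := u.1.fst

/-- The weak gradient `∇u ∈ L²(Ω)^{d × d}` of `u ∈ H¹(Ω)^d`. -/
def gradOf {d : ℕ} {Ω : Set (Vec d)} (u : H1 Ω) : Lp (Mat d) 2 (volume.restrict Ω) := u.1.snd

/-- The classical gradient `(∇φ)_{ij} = ∂φ_i / ∂x_j` of a smooth vector field. -/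
def classicalGradient {d : ℕ} (φ : Vec d → Vec d) (x : Vec d) : Mat d :=
  WithLp.toLp 2 fun ij => fderiv ℝ φ x (EuclideanSpace.single ij.2 1) ij.1

/-- `t ∈ L²(∂Ω)^d` is the boundary trace of `u ∈ H¹(Ω)^d`. The trace operator is the continuous
extension of the restriction `φ ↦ φ|_{∂Ω}` from smooth fields to `H¹(Ω)^d`; thus `t` is the trace
of `u` if there are fields `φ_n`, smooth up to the boundary, with `φ_n → u` in `H¹(Ω)^d` and
`φ_n|_{∂Ω} → t` in `L²(∂Ω)^d`. -/
def IsTrace {d : ℕ} {Ω : Set (Vec d)} (u : H1 Ω) (t : L2Surface (frontier Ω)) : Prop :=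
  ∃ φ : ℕ → Vec d → Vec d, (∀ n, ContDiff ℝ ∞ (φ n)) ∧
    Tendsto (fun n => eLpNorm (fun x => φ n x - fieldOf u x) 2 (volume.restrict Ω)) atTop (𝓝 0) ∧
    Tendsto (fun n => eLpNorm (fun x => classicalGradient (φ n) x - gradOf u x) 2
      (volume.restrict Ω)) atTop (𝓝 0) ∧
    Tendsto (fun n => eLpNorm (fun x => φ n x - t x) 2
      ((Measure.euclideanHausdorffMeasure (d - 1) : Measure (Vec d)).restrict (frontier Ω)))
      atTop (𝓝 0)

/-- `u|_Γ = f` in the sense of traces, for a part `Γ` of the boundary and a function `f`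
on it. -/
def TraceEqOn {d : ℕ} {Ω : Set (Vec d)} (u : H1 Ω) (Γ : Set (Vec d)) (f : Vec d → Vec d) : Prop :=
  ∃ t : L2Surface (frontier Ω), IsTrace u t ∧
    ∀ᵐ x ∂(Measure.euclideanHausdorffMeasure (d - 1) : Measure (Vec d)).restrict Γ, t x = f x

/-- The space `𝒱 = {v ∈ H¹(Ω)^d : v|_{Γ_D} = 0}`. -/
def spaceV {d : ℕ} (Ω ΓD : Set (Vec d)) : Set (H1 Ω) := {v | TraceEqOn v ΓD 0}

/-- The space `H^{1/2}(Γ_N) = {u|_{Γ_N} : u ∈ 𝒱}`. -/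
def HHalf {d : ℕ} (Ω ΓD ΓN : Set (Vec d)) : Set (L2Surface ΓN) :=
  {f | ∃ u ∈ spaceV Ω ΓD, TraceEqOn u ΓN f}

/-! ### Linear isotropic elasticity -/

/-- `L^∞(Ω)`. -/
abbrev LInf {d : ℕ} (Ω : Set (Vec d)) : Type := Lp ℝ ∞ (volume.restrict Ω)

/-- `L^∞_+(Ω)`: the functions in `L^∞(Ω)` with positive essential infimum. -/
def LInfPos {d : ℕ} (Ω : Set (Vec d)) : Set (LInf Ω) :=
  {a | ∃ c : ℝ, 0 < c ∧ ∀ᵐ x ∂(volume.restrict Ω), c ≤ a x}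

/-- The isotropic elastic tensor
`ℂ_{ijkl} = λ δ_{ij} δ_{kl} + μ (δ_{ik} δ_{jl} + δ_{il} δ_{jk})` with Lamé parameters
`lam`, `mu`. -/
def elasticTensor {d : ℕ} (lam mu : ℝ) (i j k l : Fin d) : ℝ :=
  lam * ((if i = j then 1 else 0) * (if k = l then 1 else 0))
    + mu * ((if i = k then 1 else 0) * (if j = l then 1 else 0)
      + (if i = l then 1 else 0) * (if j = k then 1 else 0))

/-- The matrix `ℂ A = (∑_{k,l} ℂ_{ijkl} A_{kl})_{ij}`. -/
def applyTensor {d : ℕ} (lam mu : ℝ) (A : Matrix (Fin d) (Fin d) ℝ) : Matrix (Fin d) (Fin d) ℝ :=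
  Matrix.of fun i j => ∑ k, ∑ l, elasticTensor lam mu i j k l * A k l

/-- `A : B = ∑_{i,j} a_{ij} b_{ij}`. -/
def doubleDot {d : ℕ} (A B : Matrix (Fin d) (Fin d) ℝ) : ℝ := ∑ i, ∑ j, A i j * B i j

/-- The linearized strain tensor `∇̂u = (∇u + (∇u)ᵀ) / 2`. -/
def strain {d : ℕ} {Ω : Set (Vec d)} (u : H1 Ω) (x : Vec d) : Matrix (Fin d) (Fin d) ℝ :=
  Matrix.of fun i j => (gradOf u x (i, j) + gradOf u x (j, i)) / 2

/-- `∫_Ω ℂ(λ, μ) ∇̂u : ∇̂v dx`, with `p = (λ, μ)`. -/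
def elasticForm {d : ℕ} {Ω : Set (Vec d)} (p : LInf Ω × LInf Ω) (u v : H1 Ω) : ℝ :=
  ∫ x in Ω, doubleDot (applyTensor (p.1 x) (p.2 x) (strain u x)) (strain v x)

/-- `u` is the weak solution of `-div(ℂ ∇̂u) = 0` in `Ω`, `(ℂ ∇̂u) ν = g` on `Γ_N`,
`u = 0` on `Γ_D`. -/
def IsNeumannSolution {d : ℕ} {Ω : Set (Vec d)} (ΓD ΓN : Set (Vec d)) (g : L2Surface ΓN)
    (p : LInf Ω × LInf Ω) (u : H1 Ω) : Prop :=
  u ∈ spaceV Ω ΓD ∧ ∀ v ∈ spaceV Ω ΓD, ∀ t : L2Surface (frontier Ω), IsTrace v t →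
    elasticForm p u v
      = ∫ x in ΓN, ⟪g x, t x⟫_ℝ ∂(Measure.euclideanHausdorffMeasure (d - 1) : Measure (Vec d))

/-- `u` is the weak solution of `-div(ℂ ∇̂u) = 0` in `Ω`, `u = f` on `Γ_N`, `u = 0` on `Γ_D`;
the test fields are those that vanish on `Γ_N` and on `Γ_D`. -/
def IsDirichletSolution {d : ℕ} {Ω : Set (Vec d)} (ΓD ΓN : Set (Vec d)) (f : L2Surface ΓN)
    (p : LInf Ω × LInf Ω) (u : H1 Ω) : Prop :=
  TraceEqOn u ΓN f ∧ TraceEqOn u ΓD 0 ∧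
    ∀ v : H1 Ω, TraceEqOn v ΓN 0 → TraceEqOn v ΓD 0 → elasticForm p u v = 0

open scoped Classical in
/-- `u_N`: the solution of the Neumann problem (zero if there is none). -/
def neumannSolution {d : ℕ} {Ω : Set (Vec d)} (ΓD ΓN : Set (Vec d)) (g : L2Surface ΓN)
    (p : LInf Ω × LInf Ω) : H1 Ω :=
  if h : ∃ u, IsNeumannSolution ΓD ΓN g p u then h.choose else 0

open scoped Classical in
/-- `u_D`: the solution of the Dirichlet problem (zero if there is none). -/
def dirichletSolution {d : ℕ} {Ω : Set (Vec d)} (ΓD ΓN : Set (Vec d)) (f : L2Surface ΓN)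
    (p : LInf Ω × LInf Ω) : H1 Ω :=
  if h : ∃ u, IsDirichletSolution ΓD ΓN f p u then h.choose else 0

/-- The Kohn–Vogelius functional
`J(λ, μ) = ∫_Ω ℂ(λ, μ) ∇̂(u_N - u_D) : ∇̂(u_N - u_D) dx`. -/
def kohnVogelius {d : ℕ} {Ω : Set (Vec d)} (ΓD ΓN : Set (Vec d)) (f g : L2Surface ΓN)
    (p : LInf Ω × LInf Ω) : ℝ :=
  elasticForm p (neumannSolution ΓD ΓN g p - dirichletSolution ΓD ΓN f p)
    (neumannSolution ΓD ΓN g p - dirichletSolution ΓD ΓN f p)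

end

end Elasticity

/-!
The proof has two parts. The first is Korn's inequality `c ‖v‖² ≤ ‖∇v + (∇v)ᵀ‖²` in the `H¹` norm,
for the fields `v` whose trace vanishes on a non-empty relatively open part of the boundary
(`exists_korn`). It makes the bilinear form `B(λ, μ)` of elasticity coercive. The second is an
argument with coercive forms in a Hilbert space.

*Korn's inequality.* For compactly supported Lipschitz fields, two integrations by parts show
`∫ ∑ ∂_j v_i ∂_i v_j = ∫ (div v)² ≥ 0`, so that the full gradient is controlled by the symmetrized
one (`lintegral_enorm_fderiv_le`). Near the boundary, a field is first cut off and then extended by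
Nitsche's reflection: a combination of pullbacks of the field, as a one-form, under maps that shift
points from outside `Ω` into `Ω`. Pulling back one-forms respects symmetrized gradients up to terms
of order zero, and those involve the second derivatives of the boundary function: this is where the
boundary has to be of class `C^{1,1}` (`IsDepth.exists_extension`). A finite cover of the closure
of `Ω` gives Korn's second inequality, `‖∇v‖² ≤ C (‖∇v + (∇v)ᵀ‖² + ‖v‖²)` in `L²`, for smooth
fields (`exists_korn_smooth`), and it passes to their closure in `H¹`, which contains every field
that has a trace.

The term `‖v‖²` is removed by compactness, in the form that the `L²` norm is controlled by a small
multiple of the `H¹` norm and finitely many functionals (`finitelyControlled`). Up to these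
functionals the strain is then bounded below, hence it is bounded below on each closed subspace on
which it is injective (`exists_le_of_korn`). A field without strain is an infinitesimal rigid
motion `x ↦ A x + b` with `A` antisymmetric (`exists_rigid`). If its trace vanishes on a non-empty
relatively open part of the boundary, then it vanishes at every point of this part, as open parts
have positive surface measure; and the zero set of a non-zero rigid motion contains no piece of a
hypersurface (`rigid_eq_zero`).

The trace operator is handled through its graph, the closure of the pairs of a smooth field and its
restriction to the boundary. The trace inequality `exists_trace_le` makes it a bounded operator
with a closed domain, so that the fields with a vanishing trace form a closed subspace and the
boundary load is a bounded functional.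

*The derivative.* Existence and uniqueness follow from the Lax–Milgram theorem. Let `L` be the
load. As `L` vanishes on the fields that are zero on `Γ_N`, `B(u_N, u_D) = L(u_D)` does not depend
on the parameters, and `J` is a constant plus the Dirichlet energy `B(u_D, u_D)` plus the Neumann
energy `B(u_N, u_N)`. The increment of the first energy from `p` to `q` is
`B(q - p)(u_D(q), u_D(p))`, that of the second is `-B(q - p)(u_N(q), u_N(p))`. By coercivity the
solutions depend on the parameters in a Lipschitz way, and both expressions are linear in `q - p`
up to `O(‖q - p‖²)` (`hasFDerivAt_energy`, `hasFDerivAt_gap`).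
-/

namespace Elasticity

noncomputable section

set_option maxSynthPendingDepth 3

/-! ### Coercive variational problems -/

section Abstract

variable {P H : Type*} [NormedAddCommGroup P] [NormedSpace ℝ P]
  [NormedAddCommGroup H] [InnerProductSpace ℝ H]

/-- Lax–Milgram on a complete subspace: a bounded bilinear form that is coercive on `S` represents
every bounded functional on `S`. -/
theorem exists_solution_of_coercive [CompleteSpace H] {S : Submodule ℝ H}
    (hS : IsClosed (S : Set H))
    (b : H →L[ℝ] H →L[ℝ] ℝ) {c : ℝ} (hc : 0 < c) (hb : ∀ v ∈ S, c * ‖v‖ ^ 2 ≤ b v v)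
    (L : S →L[ℝ] ℝ) : ∃ w ∈ S, ∀ v (hv : v ∈ S), b w v = L ⟨v, hv⟩ := by
  have : CompleteSpace S := hS.completeSpace_coe
  let bS : S →L[ℝ] S →L[ℝ] ℝ := b.bilinearComp S.subtypeL S.subtypeL
  have hcoer : IsCoercive bS := ⟨c, hc, fun v => by
    have := hb v v.2
    simpa [bS, pow_two, mul_assoc] using this⟩
  let e := hcoer.continuousLinearEquivOfBilin
  let y : S := (InnerProductSpace.toDual ℝ S).symm L
  refine ⟨(e.symm y : S), (e.symm y).2, fun v hv => ?_⟩
  have h := hcoer.continuousLinearEquivOfBilin_apply (e.symm y) ⟨v, hv⟩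
  have h2 : hcoer.continuousLinearEquivOfBilin (e.symm y) = y := e.apply_symm_apply y
  rw [h2] at h
  rw [InnerProductSpace.toDual_symm_apply] at h
  exact h.symm

theorem eq_of_coercive {S : Submodule ℝ H}
    (b : H →L[ℝ] H →L[ℝ] ℝ) {c : ℝ} (hc : 0 < c) (hb : ∀ v ∈ S, c * ‖v‖ ^ 2 ≤ b v v)
    {u u' : H} (hu : u - u' ∈ S) (h : ∀ v ∈ S, b u v = b u' v) : u = u' := by
  have h1 := hb _ hu
  have h2 : b (u - u') (u - u') = 0 := by
    rw [map_sub b, sub_apply, h _ hu, sub_self]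
  have h3 : ‖u - u'‖ ^ 2 ≤ 0 := by
    rw [h2] at h1
    by_contra hcon
    push Not at hcon
    have := mul_pos hc hcon
    linarith
  have h4 : ‖u - u'‖ = 0 := by
    have := sq_nonneg ‖u - u'‖
    exact pow_eq_zero_iff (two_ne_zero) |>.1 (le_antisymm h3 this)
  exact sub_eq_zero.1 (norm_eq_zero.1 h4)

/-- The derivative of the energy of a variational problem. If `u q` solves, for `q` near `p`, a
variational problem with test space `S` whose bilinear form `B q` depends linearly on `q`, whose
right hand side does not depend on `q`, and if the increment of `F` is the mixed term
`B (q - p) (u q) (u p)`, then `F' (p) q = B q (u p) (u p)`: replacing `u q` by `u p` in the mixed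
term costs `O(‖q - p‖ ^ 2)`, by coercivity. -/
theorem hasFDerivAt_energy (B : P →L[ℝ] H →L[ℝ] H →L[ℝ] ℝ) {S : Submodule ℝ H} {p : P} {c : ℝ}
    (hc : 0 < c) (hb : ∀ v ∈ S, c * ‖v‖ ^ 2 ≤ B p v v) {u : P → H} {F : P → ℝ}
    (hS : ∀ᶠ q in 𝓝 p, u q - u p ∈ S)
    (hu : ∀ᶠ q in 𝓝 p, ∀ v ∈ S, B q (u q) v = B p (u p) v)
    (hF : ∀ᶠ q in 𝓝 p, F q - F p = B (q - p) (u q) (u p)) :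
    HasFDerivAt F ((B.flip (u p)).flip (u p)) p := by
  have hbd : ∀ (q : P) (v w : H), |B q v w| ≤ ‖B‖ * ‖q‖ * ‖v‖ * ‖w‖ := fun q v w => by
    calc |B q v w| = ‖B q v w‖ := rfl
      _ ≤ ‖B q v‖ * ‖w‖ := (B q v).le_opNorm w
      _ ≤ ‖B q‖ * ‖v‖ * ‖w‖ := by gcongr; exact (B q).le_opNorm v
      _ ≤ ‖B‖ * ‖q‖ * ‖v‖ * ‖w‖ := by gcongr; exact B.le_opNorm q
  have hsmall : ∀ᶠ q in 𝓝 p, ‖B‖ * ‖q - p‖ ≤ c / 2 := by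
    have : Tendsto (fun q => ‖B‖ * ‖q - p‖) (𝓝 p) (𝓝 (‖B‖ * ‖p - p‖)) := by
      apply Continuous.tendsto; fun_prop
    rw [sub_self, norm_zero, mul_zero] at this
    exact (this.eventually (gt_mem_nhds (half_pos hc))).mono fun _ h => h.le
  have hest : ∀ᶠ q in 𝓝 p, ‖u q - u p‖ ≤ 2 / c * (‖B‖ * ‖q - p‖ * ‖u p‖) := by
    filter_upwards [hS, hu, hsmall] with q h1 h2 h3
    have h4 := hb _ h1
    have h5 : B p (u q - u p) (u q - u p) = - B (q - p) (u q) (u q - u p) := by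
      have := h2 _ h1
      simp only [map_sub, sub_apply] at this ⊢
      linarith
    have h6 := (neg_abs_le _).trans' (neg_le_neg (hbd (q - p) (u q) (u q - u p)))
    have h7 : ‖u q‖ ≤ ‖u p‖ + ‖u q - u p‖ := by
      simpa using norm_add_le (u p) (u q - u p)
    rcases eq_or_lt_of_le (norm_nonneg (u q - u p)) with h0 | h0
    · rw [← h0]; positivity
    set w := ‖u q - u p‖
    have h8 : c * w ^ 2 ≤ ‖B‖ * ‖q - p‖ * (‖u p‖ + w) * w := by
      have : ‖B‖ * ‖q - p‖ * ‖u q‖ * w ≤ ‖B‖ * ‖q - p‖ * (‖u p‖ + w) * w := by gcongr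
      linarith
    have h9 : c * w ≤ ‖B‖ * ‖q - p‖ * (‖u p‖ + w) := by
      have : c * w * w ≤ ‖B‖ * ‖q - p‖ * (‖u p‖ + w) * w := by nlinarith
      exact le_of_mul_le_mul_right this h0
    have h10 : c / 2 * w ≤ ‖B‖ * ‖q - p‖ * ‖u p‖ := by nlinarith
    rw [div_mul_eq_mul_div, le_div_iff₀ hc]
    linarith
  rw [hasFDerivAt_iff_isLittleO]
  have hO : (fun q => F q - F p - ((B.flip (u p)).flip (u p)) (q - p)) =O[𝓝 p]
      fun q => ‖q - p‖ ^ 2 := by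
    refine Asymptotics.IsBigO.of_bound (‖B‖ * (2 / c * (‖B‖ * ‖u p‖)) * ‖u p‖) ?_
    filter_upwards [hF, hest] with q h1 h2
    rw [h1]
    have : B (q - p) (u q) (u p) - ((B.flip (u p)).flip (u p)) (q - p)
        = B (q - p) (u q - u p) (u p) := by
      simp only [map_sub, sub_apply, ContinuousLinearMap.flip_apply]
    rw [this, Real.norm_eq_abs, Real.norm_of_nonneg (sq_nonneg _)]
    calc _ ≤ ‖B‖ * ‖q - p‖ * ‖u q - u p‖ * ‖u p‖ := hbd _ _ _
      _ ≤ ‖B‖ * ‖q - p‖ * (2 / c * (‖B‖ * ‖q - p‖ * ‖u p‖)) * ‖u p‖ := by gcongr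
      _ = _ := by ring
  refine hO.trans_isLittleO ?_
  have : (fun q : P => ‖q - p‖ ^ 2) = fun q => ‖q - p‖ * ‖q - p‖ := by ext; ring
  rw [this]
  have h1 : (fun q : P => ‖q - p‖) =o[𝓝 p] fun _ => (1 : ℝ) := by
    rw [Asymptotics.isLittleO_one_iff]
    have : Tendsto (fun q => ‖q - p‖) (𝓝 p) (𝓝 (‖p - p‖)) := by
      apply Continuous.tendsto; fun_prop
    simpa using this
  have h2 := h1.mul_isBigO (Asymptotics.isBigO_refl (fun q : P => ‖q - p‖) (𝓝 p))
  simp only [one_mul] at h2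
  exact h2.trans_isBigO (Asymptotics.isBigO_refl _ _).norm_left

end Abstract

variable {d : ℕ} {Ω : Set (Vec d)}

/-! ### The bilinear form of elasticity as a bounded operator -/

/-! The function spaces get names of their own, with instances that are constants: this keeps the
terms in the types of the operators below small. -/

/-- `L²(Ω)^{d × d}`. -/
def L2Mat (Ω : Set (Vec d)) : Type := Lp (Mat d) 2 (volume.restrict Ω)

instance : NormedAddCommGroup (L2Mat Ω) :=
  inferInstanceAs (NormedAddCommGroup (Lp (Mat d) 2 (volume.restrict Ω)))

instance : InnerProductSpace ℝ (L2Mat Ω) :=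
  inferInstanceAs (InnerProductSpace ℝ (Lp (Mat d) 2 (volume.restrict Ω)))

instance : CompleteSpace (L2Mat Ω) :=
  inferInstanceAs (CompleteSpace (Lp (Mat d) 2 (volume.restrict Ω)))

/-- The underlying element of `Lp`. -/
def L2Mat.asLp (G : L2Mat Ω) : Lp (Mat d) 2 (volume.restrict Ω) := G

/-- `L²(Ω)^d`. -/
def L2Vec (Ω : Set (Vec d)) : Type := Lp (Vec d) 2 (volume.restrict Ω)

instance : NormedAddCommGroup (L2Vec Ω) :=
  inferInstanceAs (NormedAddCommGroup (Lp (Vec d) 2 (volume.restrict Ω)))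

instance : InnerProductSpace ℝ (L2Vec Ω) :=
  inferInstanceAs (InnerProductSpace ℝ (Lp (Vec d) 2 (volume.restrict Ω)))

instance : CompleteSpace (L2Vec Ω) :=
  inferInstanceAs (CompleteSpace (Lp (Vec d) 2 (volume.restrict Ω)))

/-- The space `H¹(Ω)^d` of displacement fields. -/
def Disp (Ω : Set (Vec d)) : Type := H1 Ω

instance : NormedAddCommGroup (Disp Ω) := inferInstanceAs (NormedAddCommGroup (H1 Ω))

instance : InnerProductSpace ℝ (Disp Ω) := inferInstanceAs (InnerProductSpace ℝ (H1 Ω))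

/-- The space of pairs of Lamé parameters, `L^∞(Ω) × L^∞(Ω)`. -/
def Lame (Ω : Set (Vec d)) : Type := LInf Ω × LInf Ω

instance : NormedAddCommGroup (Lame Ω) := inferInstanceAs (NormedAddCommGroup (LInf Ω × LInf Ω))

instance : NormedSpace ℝ (Lame Ω) := inferInstanceAs (NormedSpace ℝ (LInf Ω × LInf Ω))

/-- The inner product of a real inner product space as a bounded bilinear form. -/
def innerForm (E : Type*) [NormedAddCommGroup E] [InnerProductSpace ℝ E] : E →L[ℝ] E →L[ℝ] ℝ :=
  LinearMap.mkContinuous₂ (innerₗ E) 1 fun x y => by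
    simpa using norm_inner_le_norm (𝕜 := ℝ) x y

/-- `A ↦ (tr A) I`. -/
def trMap (d : ℕ) : Mat d →L[ℝ] Mat d := LinearMap.toContinuousLinearMap
  { toFun := fun A => WithLp.toLp 2 fun ij => (∑ k, A (k, k)) * (if ij.1 = ij.2 then 1 else 0)
    map_add' := fun A B => by ext ij; simp only [PiLp.add_apply, Finset.sum_add_distrib, add_mul]
    map_smul' := fun c A => by ext ij; simp [← Finset.mul_sum] }

/-- `A ↦ A + Aᵀ`. -/
def symMap (d : ℕ) : Mat d →L[ℝ] Mat d := LinearMap.toContinuousLinearMap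
  { toFun := fun A => WithLp.toLp 2 fun ij => A ij + A (ij.2, ij.1)
    map_add' := fun A B => by ext ij; simp; ring
    map_smul' := fun c A => by ext ij; simp; ring }

theorem trMap_apply (A : Mat d) (i j : Fin d) :
    trMap d A (i, j) = (∑ k, A (k, k)) * (if i = j then 1 else 0) := rfl

theorem symMap_apply (A : Mat d) (i j : Fin d) : symMap d A (i, j) = A (i, j) + A (j, i) := rfl

theorem inner_mat (A B : Mat d) : ⟪A, B⟫_ℝ = ∑ i, ∑ j, A (i, j) * B (i, j) := by
  rw [PiLp.inner_apply, Fintype.sum_prod_type]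
  simp [mul_comm]

theorem inner_trMap (A B : Mat d) : ⟪trMap d A, B⟫_ℝ = (∑ k, A (k, k)) * ∑ k, B (k, k) := by
  rw [inner_mat]
  simp only [trMap_apply, mul_ite, mul_one, mul_zero, ite_mul, zero_mul, Finset.sum_ite_eq,
    Finset.mem_univ, if_true, Finset.mul_sum]

theorem inner_symMap (A B : Mat d) : ⟪symMap d A, B⟫_ℝ = 2⁻¹ * ⟪symMap d A, symMap d B⟫_ℝ := by
  have h : ∑ i, ∑ j, (A (i, j) + A (j, i)) * B (j, i)
      = ∑ i, ∑ j, (A (i, j) + A (j, i)) * B (i, j) := by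
    rw [Finset.sum_comm]
    refine Finset.sum_congr rfl fun i _ => Finset.sum_congr rfl fun j _ => ?_
    ring
  simp only [inner_mat, symMap_apply, mul_add, Finset.sum_add_distrib]
  rw [h]
  ring

/-- The energy density in terms of the gradients instead of the strains: the tensor maps the strain
of `A` to `λ (tr A) I + μ (A + Aᵀ)`, which is symmetric. -/
theorem doubleDot_applyTensor (l m : ℝ) (A B : Mat d) :
    doubleDot (applyTensor l m (Matrix.of fun i j => (A (i, j) + A (j, i)) / 2))
      (Matrix.of fun i j => (B (i, j) + B (j, i)) / 2)
    = l * ⟪trMap d A, B⟫_ℝ + m * ⟪symMap d A, B⟫_ℝ := by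
  have h1 : ∀ i j, applyTensor l m (Matrix.of fun i j => (A (i, j) + A (j, i)) / 2) i j
      = l * (∑ k, A (k, k)) * (if i = j then 1 else 0) + m * (A (i, j) + A (j, i)) := by
    intro i j
    simp only [applyTensor, elasticTensor, Matrix.of_apply, add_mul, Finset.sum_add_distrib,
      mul_add]
    congr 1
    · by_cases hij : i = j <;> simp [hij, Finset.mul_sum]
    · simp
      ring
  rw [inner_symMap, inner_trMap, inner_mat]
  simp only [doubleDot, h1, symMap_apply, Matrix.of_apply, add_mul, Finset.sum_add_distrib]
  congr 1
  · have : ∀ i : Fin d, (B (i, i) + B (i, i)) / 2 = B (i, i) := fun i => by ring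
    simp [this, Finset.mul_sum, Finset.sum_mul, mul_assoc]
  · simp only [Finset.mul_sum, ← Finset.sum_add_distrib]
    refine Finset.sum_congr rfl fun i _ => Finset.sum_congr rfl fun j _ => ?_
    ring

/-- The map `(a, G) ↦ a T(G)`, for a scalar field `a`, a matrix field `G` and a fixed linear
map `T`. -/
def mulL (Ω : Set (Vec d)) (T : Mat d →L[ℝ] Mat d) : LInf Ω →L[ℝ] L2Mat Ω →L[ℝ] L2Mat Ω :=
  ((1 : ℝ →L[ℝ] ℝ).smulRight T).holderL (volume.restrict Ω) ∞ 2 2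

/-- The map `(λ, μ) ↦ (A ↦ ℂ(λ, μ) A)` on matrix fields. -/
def tensorL (Ω : Set (Vec d)) : Lame Ω →L[ℝ] L2Mat Ω →L[ℝ] L2Mat Ω :=
  (((mulL Ω (trMap d)).comp (ContinuousLinearMap.fst ℝ _ _)
    + (mulL Ω (symMap d)).comp (ContinuousLinearMap.snd ℝ _ _) :
    (LInf Ω × LInf Ω) →L[ℝ] L2Mat Ω →L[ℝ] L2Mat Ω))

/-- The weak gradient as a bounded operator. -/
def gradL (Ω : Set (Vec d)) : Disp Ω →L[ℝ] L2Mat Ω :=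
  ((WithLp.sndL 2 ℝ _ _).comp (H1 Ω).subtypeL : H1 Ω →L[ℝ] Lp (Mat d) 2 (volume.restrict Ω))

/-- The underlying field as a bounded operator. -/
def fieldL (Ω : Set (Vec d)) : Disp Ω →L[ℝ] L2Vec Ω :=
  ((WithLp.fstL 2 ℝ _ _).comp (H1 Ω).subtypeL : H1 Ω →L[ℝ] Lp (Vec d) 2 (volume.restrict Ω))

/-- `G ↦ G + Gᵀ` on matrix fields. -/
def symL (Ω : Set (Vec d)) : L2Mat Ω →L[ℝ] L2Mat Ω :=
  ((symMap d).compLpL 2 (volume.restrict Ω))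

/-- The operator `u ↦ ∇u + (∇u)ᵀ`, twice the strain. -/
def symGradL (Ω : Set (Vec d)) : Disp Ω →L[ℝ] L2Mat Ω := (symL Ω).comp (gradL Ω)

theorem norm_sq_Disp (u : Disp Ω) : ‖u‖ ^ 2 = ‖fieldL Ω u‖ ^ 2 + ‖gradL Ω u‖ ^ 2 :=
  WithLp.prod_norm_sq_eq_of_L2 u.1

theorem coeFn_symGradL (u : Disp Ω) :
    ∀ᵐ x ∂volume.restrict Ω, (symGradL Ω u).asLp x
      = symMap d (gradOf u x) :=
  (symMap d).coeFn_compLpL (gradOf u)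

/-- The bilinear form `(u, v) ↦ ⟪T p (D u), D v⟫`, as a bounded linear function of `p`. -/
def pullForm {P H E : Type*} [NormedAddCommGroup P] [NormedSpace ℝ P] [NormedAddCommGroup H]
    [NormedSpace ℝ H] [NormedAddCommGroup E] [InnerProductSpace ℝ E]
    (T : P →L[ℝ] E →L[ℝ] E) (D : H →L[ℝ] E) : P →L[ℝ] H →L[ℝ] H →L[ℝ] ℝ :=
  ((ContinuousLinearMap.compL ℝ H E (H →L[ℝ] ℝ))
    (((ContinuousLinearMap.compL ℝ H E ℝ).flip D).comp (innerForm E))).comp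
    (((ContinuousLinearMap.compL ℝ H E E).flip D).comp T)

theorem pullForm_apply {P H E : Type*} [NormedAddCommGroup P] [NormedSpace ℝ P]
    [NormedAddCommGroup H] [NormedSpace ℝ H] [NormedAddCommGroup E] [InnerProductSpace ℝ E]
    (T : P →L[ℝ] E →L[ℝ] E) (D : H →L[ℝ] E) (p : P) (u v : H) :
    pullForm T D p u v = ⟪T p (D u), D v⟫_ℝ := rfl

/-- The bilinear form of elasticity, as a bounded linear function of the Lamé parameters. -/
def elasticL (Ω : Set (Vec d)) : Lame Ω →L[ℝ] Disp Ω →L[ℝ] Disp Ω →L[ℝ] ℝ :=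
  pullForm (tensorL Ω) (gradL Ω)

theorem coeFn_mulL (T : Mat d →L[ℝ] Mat d) (a : LInf Ω) (G : L2Mat Ω) :
    ∀ᵐ x ∂volume.restrict Ω, (mulL Ω T a G).asLp x
      = a x • T (G.asLp x) := by
  have := ((1 : ℝ →L[ℝ] ℝ).smulRight T).coeFn_holder (r := 2) a G.asLp
  filter_upwards [this] with x hx
  exact hx

theorem coeFn_tensorL (p : LInf Ω × LInf Ω) (G : Lp (Mat d) 2 (volume.restrict Ω)) :
    ∀ᵐ x ∂volume.restrict Ω, (tensorL Ω p G).asLp x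
      = p.1 x • trMap d (G x) + p.2 x • symMap d (G x) := by
  have h3 := Lp.coeFn_add (mulL Ω (trMap d) p.1 G).asLp (mulL Ω (symMap d) p.2 G).asLp
  filter_upwards [coeFn_mulL (trMap d) p.1 G, coeFn_mulL (symMap d) p.2 G, h3] with x h1 h2 h3
  exact h3.trans (congrArg₂ (· + ·) h1 h2)

theorem inner_tensorL (p : LInf Ω × LInf Ω) (G K : Lp (Mat d) 2 (volume.restrict Ω)) :
    ⟪tensorL Ω p G, (K : L2Mat Ω)⟫_ℝ = ∫ x in Ω, (p.1 x * ⟪trMap d (G x), K x⟫_ℝ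
      + p.2 x * ⟪symMap d (G x), K x⟫_ℝ) := by
  refine (MeasureTheory.L2.inner_def
    (tensorL Ω p G).asLp K).trans ?_
  refine integral_congr_ae ?_
  filter_upwards [coeFn_tensorL p G] with x h
  rw [h, inner_add_left, real_inner_smul_left, real_inner_smul_left]

theorem elasticL_eq_integral (p : LInf Ω × LInf Ω) (u v : H1 Ω) :
    elasticL Ω p u v = ∫ x in Ω, (p.1 x * ⟪trMap d (gradOf u x), gradOf v x⟫_ℝ
      + p.2 x * ⟪symMap d (gradOf u x), gradOf v x⟫_ℝ) :=
  (pullForm_apply (tensorL Ω) (gradL Ω) p u v).trans (inner_tensorL p (gradOf u) (gradOf v))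

theorem elasticForm_eq (p : LInf Ω × LInf Ω) (u v : H1 Ω) :
    elasticForm p u v = elasticL Ω p u v := by
  refine Eq.trans ?_ (elasticL_eq_integral p u v).symm
  exact integral_congr_ae (Eventually.of_forall fun x => doubleDot_applyTensor _ _ _ _)

theorem inner_trMap_comm (A B : Mat d) : ⟪trMap d A, B⟫_ℝ = ⟪trMap d B, A⟫_ℝ := by
  rw [inner_trMap, inner_trMap, mul_comm]

theorem inner_symMap_comm (A B : Mat d) : ⟪symMap d A, B⟫_ℝ = ⟪symMap d B, A⟫_ℝ := by
  rw [inner_symMap, inner_symMap B, real_inner_comm]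

theorem elasticL_symm (p : Lame Ω) (u v : Disp Ω) : elasticL Ω p u v = elasticL Ω p v u := by
  refine (elasticL_eq_integral p u v).trans (Eq.trans ?_ (elasticL_eq_integral p v u).symm)
  congr 1
  funext x
  rw [inner_trMap_comm, inner_symMap_comm]

theorem le_inner_tensor (A : Mat d) {a b c : ℝ} (ha : 0 ≤ a) (hb : c ≤ b) :
    c / 2 * ⟪symMap d A, symMap d A⟫_ℝ ≤ a * ⟪trMap d A, A⟫_ℝ + b * ⟪symMap d A, A⟫_ℝ := by
  rw [inner_trMap, inner_symMap A A]
  have := mul_le_mul_of_nonneg_right hb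
    (real_inner_self_nonneg (x := symMap d A) (F := Mat d))
  have h3 := mul_nonneg ha (mul_self_nonneg (∑ k, A (k, k)))
  linarith

theorem norm_sq_symGradL (v : Disp Ω) :
    ‖symGradL Ω v‖ ^ 2 = ∫ x in Ω, ⟪symMap d (gradOf v x), symMap d (gradOf v x)⟫_ℝ := by
  refine (real_inner_self_eq_norm_sq (symGradL Ω v)).symm.trans ?_
  refine (MeasureTheory.L2.inner_def (symGradL Ω v).asLp _).trans ?_
  refine integral_congr_ae ?_
  filter_upwards [coeFn_symGradL v] with x h
  exact congrArg (fun A : Mat d => ⟪A, A⟫_ℝ) h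

/-- The elastic energy controls the strain. -/
theorem exists_le_elasticL {p : LInf Ω × LInf Ω} (hp : p ∈ LInfPos Ω ×ˢ LInfPos Ω) :
    ∃ c > 0, ∀ v : Disp Ω, c * ‖symGradL Ω v‖ ^ 2 ≤ elasticL Ω p v v := by
  have h1 : ∃ c : ℝ, 0 < c ∧ ∀ᵐ x ∂volume.restrict Ω, c ≤ p.1 x := (Set.mem_prod.1 hp).1
  have h2 : ∃ c : ℝ, 0 < c ∧ ∀ᵐ x ∂volume.restrict Ω, c ≤ p.2 x := (Set.mem_prod.1 hp).2
  obtain ⟨c1, hc1, h1⟩ := h1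
  obtain ⟨c2, hc2, h2⟩ := h2
  refine ⟨c2 / 2, half_pos hc2, fun v => ?_⟩
  have hint : Integrable (fun x => ⟪symMap d (gradOf v x), symMap d (gradOf v x)⟫_ℝ)
      (volume.restrict Ω) := by
    refine (L2.integrable_inner (𝕜 := ℝ) (symGradL Ω v).asLp
      (symGradL Ω v).asLp).congr ?_
    filter_upwards [coeFn_symGradL v] with x h
    exact congrArg (fun A : Mat d => ⟪A, A⟫_ℝ) h
  have hint2 : Integrable (fun x => p.1 x * ⟪trMap d (gradOf v x), gradOf v x⟫_ℝ
      + p.2 x * ⟪symMap d (gradOf v x), gradOf v x⟫_ℝ) (volume.restrict Ω) := by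
    refine (L2.integrable_inner (𝕜 := ℝ)
      (tensorL Ω p (gradOf v)).asLp (gradOf v)).congr ?_
    filter_upwards [coeFn_tensorL p (gradOf v)] with x h
    rw [h, inner_add_left, real_inner_smul_left, real_inner_smul_left]
  calc c2 / 2 * ‖symGradL Ω v‖ ^ 2
      = c2 / 2 * ∫ x in Ω, ⟪symMap d (gradOf v x), symMap d (gradOf v x)⟫_ℝ :=
        congrArg (fun t => c2 / 2 * t) (norm_sq_symGradL v)
    _ = ∫ x in Ω, c2 / 2 * ⟪symMap d (gradOf v x), symMap d (gradOf v x)⟫_ℝ :=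
        (integral_const_mul _ _).symm
    _ ≤ ∫ x in Ω, (p.1 x * ⟪trMap d (gradOf v x), gradOf v x⟫_ℝ
          + p.2 x * ⟪symMap d (gradOf v x), gradOf v x⟫_ℝ) := by
        refine integral_mono_ae (hint.const_mul _) hint2 ?_
        filter_upwards [h1, h2] with x g1 g2
        exact le_inner_tensor _ (hc1.le.trans g1) g2
    _ = _ := (elasticL_eq_integral p v v).symm

theorem isOpen_LInfPos : IsOpen (LInfPos Ω) := by
  rw [Metric.isOpen_iff]
  rintro a ⟨c, hc, ha⟩
  refine ⟨c / 2, half_pos hc, fun b hb => ⟨c / 2, half_pos hc, ?_⟩⟩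
  have h1 : ∀ᵐ x ∂volume.restrict Ω, ‖(b - a) x‖ ≤ ‖b - a‖ := by
    filter_upwards [ae_le_eLpNormEssSup (f := (b - a : LInf Ω)) (μ := volume.restrict Ω)] with x hx
    rw [Lp.norm_def, eLpNorm_exponent_top]
    have hfin : eLpNormEssSup (b - a : LInf Ω) (volume.restrict Ω) ≠ ⊤ := by
      have := Lp.eLpNorm_ne_top (b - a)
      rwa [eLpNorm_exponent_top] at this
    rw [← toReal_enorm]
    exact ENNReal.toReal_mono hfin hx
  rw [mem_ball_iff_norm] at hb
  filter_upwards [ha, h1, Lp.coeFn_sub b a] with x g1 g2 g3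
  rw [g3, Pi.sub_apply, Real.norm_eq_abs] at g2
  have := neg_abs_le (b x - a x)
  linarith

/-! ### Smooth fields and convergence in `H¹` -/

theorem eLpNorm_two_sq {α E : Type*} [MeasurableSpace α] [NormedAddCommGroup E] (f : α → E)
    (μ : Measure α) : eLpNorm f 2 μ ^ 2 = ∫⁻ x, ‖f x‖ₑ ^ 2 ∂μ := by
  have := eLpNorm_nnreal_pow_eq_lintegral (f := f) (μ := μ) (p := 2) two_ne_zero
  simpa using this

/-- The matrix of a linear map. -/
def matL (d : ℕ) : (Vec d →L[ℝ] Vec d) ≃L[ℝ] Mat d := LinearEquiv.toContinuousLinearEquiv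
  { toFun := fun A => WithLp.toLp 2 fun ij => A (EuclideanSpace.single ij.2 1) ij.1
    map_add' := fun A B => by ext ij; simp
    map_smul' := fun c A => by ext ij; simp
    invFun := fun M => LinearMap.toContinuousLinearMap (Matrix.toEuclideanLin
      (Matrix.of fun i j => M (i, j)))
    left_inv := fun A => by
      refine ContinuousLinearMap.coe_injective
        ((EuclideanSpace.basisFun _ ℝ).toBasis.ext fun j => ?_)
      ext i
      simp [Matrix.toLpLin_apply]
    right_inv := fun M => by
      ext ⟨i, j⟩
      simp [Matrix.toLpLin_apply] }

theorem matL_apply (A : Vec d →L[ℝ] Vec d) (i j : Fin d) :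
    matL d A (i, j) = A (EuclideanSpace.single j 1) i := rfl

theorem classicalGradient_eq (φ : Vec d → Vec d) (x : Vec d) :
    classicalGradient φ x = matL d (fderiv ℝ φ x) := rfl

/-- `A + Aᵀ` for a linear map `A`. -/
def symOp (A : Vec d →L[ℝ] Vec d) : Vec d →L[ℝ] Vec d := A + ContinuousLinearMap.adjoint A

theorem symMap_matL (A : Vec d →L[ℝ] Vec d) : symMap d (matL d A) = matL d (symOp A) := by
  ext ⟨i, j⟩
  rw [symMap_apply, matL_apply, matL_apply, matL_apply, symOp, add_apply,
    PiLp.add_apply]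
  congr 1
  have := ContinuousLinearMap.adjoint_inner_right A (EuclideanSpace.single i 1)
    (EuclideanSpace.single j (1 : ℝ))
  rw [EuclideanSpace.inner_single_right, EuclideanSpace.inner_single_left] at this
  simpa using this.symm

theorem continuous_classicalGradient {φ : Vec d → Vec d} (hφ : ContDiff ℝ ∞ φ) :
    Continuous (classicalGradient φ) :=
  (matL d).continuous.comp (hφ.continuous_fderiv (by simp))

theorem memLp_of_continuous {E : Type*} [NormedAddCommGroup E] [SecondCountableTopology E]
    (hΩb : Bornology.IsBounded Ω)
    {f : Vec d → E} (hf : Continuous f) {p : ℝ≥0∞} : MemLp f p (volume.restrict Ω) := by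
  have hK : IsCompact (closure Ω) := hΩb.isCompact_closure
  obtain ⟨C, hC⟩ := hK.exists_bound_of_continuousOn hf.continuousOn
  have hfin : IsFiniteMeasure (volume.restrict Ω) :=
    ⟨by rw [Measure.restrict_apply_univ]; exact hΩb.measure_lt_top⟩
  refine MemLp.of_bound hf.aestronglyMeasurable C ?_
  have : ∀ᵐ x ∂volume.restrict (closure Ω), ‖f x‖ ≤ C :=
    (ae_restrict_iff' isClosed_closure.measurableSet).2 (Eventually.of_forall hC)
  exact ae_mono (Measure.restrict_mono subset_closure le_rfl) this

/-- Classical derivatives are weak derivatives. -/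
theorem isWeakGradient_classicalGradient {φ : Vec d → Vec d} (hφ : ContDiff ℝ ∞ φ) :
    IsWeakGradient Ω φ (classicalGradient φ) := by
  intro χ hχ hc hs i j
  have hcφ : Continuous φ := hφ.continuous
  have hφi : ContDiff ℝ ∞ fun x => φ x i := by fun_prop
  have hfd : ∀ x, fderiv ℝ (fun x => φ x i) x (EuclideanSpace.single j 1)
      = classicalGradient φ x (i, j) := by
    intro x
    have h1 : HasFDerivAt φ (fderiv ℝ φ x) x :=
      (hφ.differentiable (by simp) x).hasFDerivAt
    have h2 := (EuclideanSpace.proj (𝕜 := ℝ) i).hasFDerivAt.comp x h1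
    have h3 : HasFDerivAt (fun x => φ x i)
      ((EuclideanSpace.proj (𝕜 := ℝ) i).comp (fderiv ℝ φ x)) x := h2
    rw [h3.fderiv]
    rfl
  have hD : Continuous fun x => fderiv ℝ χ x (EuclideanSpace.single j 1) :=
    (hχ.continuous_fderiv (by simp)).clm_apply continuous_const
  have hDc : HasCompactSupport fun x => fderiv ℝ χ x (EuclideanSpace.single j 1) :=
    hc.fderiv_apply ℝ _
  have hG : Continuous fun x => fderiv ℝ (fun x => φ x i) x (EuclideanSpace.single j 1) :=
    (hφi.continuous_fderiv (by simp)).clm_apply continuous_const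
  have hz : ∀ x ∉ Ω, χ x = 0 := fun x hx => image_eq_zero_of_notMem_tsupport fun h => hx (hs h)
  have hz' : ∀ x ∉ Ω, fderiv ℝ χ x (EuclideanSpace.single j 1) = 0 := fun x hx => by
    have : fderiv ℝ χ x = 0 :=
      image_eq_zero_of_notMem_tsupport fun h => hx (hs (tsupport_fderiv_subset ℝ h))
    rw [this]; rfl
  rw [setIntegral_eq_integral_of_forall_compl_eq_zero (fun x hx => by rw [hz' x hx, mul_zero]),
    setIntegral_eq_integral_of_forall_compl_eq_zero (fun x hx => by rw [hz x hx, mul_zero])]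
  have := integral_mul_fderiv_eq_neg_fderiv_mul_of_integrable (μ := volume)
    (f := fun x => φ x i) (g := χ) (v := EuclideanSpace.single j 1)
    ((hG.mul hχ.continuous).integrable_of_hasCompactSupport hc.mul_left)
    ((hφi.continuous.mul hD).integrable_of_hasCompactSupport hDc.mul_left)
    ((hφi.continuous.mul hχ.continuous).integrable_of_hasCompactSupport hc.mul_left)
    (fun x _ => hφi.differentiable (by simp) x) (fun x _ => hχ.differentiable (by simp) x)
  rw [this]
  simp only [hfd]

theorem IsWeakGradient.congr_ae {u u' : Vec d → Vec d} {G G' : Vec d → Mat d}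
    (h : IsWeakGradient Ω u G) (hu : u =ᵐ[volume.restrict Ω] u')
    (hG : G =ᵐ[volume.restrict Ω] G') : IsWeakGradient Ω u' G' := by
  intro χ hχ hc hs i j
  have h1 : ∫ x in Ω, u' x i * fderiv ℝ χ x (EuclideanSpace.single j 1)
      = ∫ x in Ω, u x i * fderiv ℝ χ x (EuclideanSpace.single j 1) := by
    refine integral_congr_ae ?_
    filter_upwards [hu] with x hx
    rw [hx]
  have h2 : ∫ x in Ω, G' x (i, j) * χ x = ∫ x in Ω, G x (i, j) * χ x := by
    refine integral_congr_ae ?_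
    filter_upwards [hG] with x hx
    rw [hx]
  rw [h1, h2]
  exact h χ hχ hc hs i j

/-- The element of `H¹(Ω)^d` given by a smooth field on `ℝ^d`. -/
def smoothDisp (hΩb : Bornology.IsBounded Ω) {φ : Vec d → Vec d} (hφ : ContDiff ℝ ∞ φ) : Disp Ω :=
  (⟨WithLp.toLp 2 ((memLp_of_continuous hΩb hφ.continuous).toLp φ,
      (memLp_of_continuous hΩb (continuous_classicalGradient hφ)).toLp (classicalGradient φ)),
    (isWeakGradient_classicalGradient hφ).congr_ae
      (memLp_of_continuous hΩb hφ.continuous).coeFn_toLp.symm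
      (memLp_of_continuous hΩb (continuous_classicalGradient hφ)).coeFn_toLp.symm⟩ : H1 Ω)

theorem fieldOf_smoothDisp (hΩb : Bornology.IsBounded Ω) {φ : Vec d → Vec d}
    (hφ : ContDiff ℝ ∞ φ) : fieldOf (smoothDisp hΩb hφ) =ᵐ[volume.restrict Ω] φ :=
  (memLp_of_continuous hΩb hφ.continuous).coeFn_toLp

theorem gradOf_smoothDisp (hΩb : Bornology.IsBounded Ω) {φ : Vec d → Vec d}
    (hφ : ContDiff ℝ ∞ φ) :
    gradOf (smoothDisp hΩb hφ) =ᵐ[volume.restrict Ω] classicalGradient φ :=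
  (memLp_of_continuous hΩb (continuous_classicalGradient hφ)).coeFn_toLp

theorem enorm_lp_sq {α E : Type*} [MeasurableSpace α] [NormedAddCommGroup E] {μ : Measure α}
    (f : Lp E 2 μ) : ‖f‖ₑ ^ 2 = ∫⁻ x, ‖f x‖ₑ ^ 2 ∂μ := by
  rw [Lp.enorm_def, eLpNorm_two_sq]

theorem enorm_fieldL_sq (u : Disp Ω) : ‖fieldL Ω u‖ₑ ^ 2 = ∫⁻ x in Ω, ‖fieldOf u x‖ₑ ^ 2 :=
  enorm_lp_sq (fieldOf u)

theorem enorm_gradL_sq (u : Disp Ω) : ‖gradL Ω u‖ₑ ^ 2 = ∫⁻ x in Ω, ‖gradOf u x‖ₑ ^ 2 :=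
  enorm_lp_sq (gradOf u)

theorem enorm_fieldL_smoothDisp (hΩb : Bornology.IsBounded Ω) {φ : Vec d → Vec d}
    (hφ : ContDiff ℝ ∞ φ) :
    ‖fieldL Ω (smoothDisp hΩb hφ)‖ₑ ^ 2 = ∫⁻ x in Ω, ‖φ x‖ₑ ^ 2 := by
  rw [enorm_fieldL_sq]
  refine lintegral_congr_ae ?_
  filter_upwards [fieldOf_smoothDisp hΩb hφ] with x hx
  rw [hx]

theorem enorm_gradL_smoothDisp (hΩb : Bornology.IsBounded Ω) {φ : Vec d → Vec d}
    (hφ : ContDiff ℝ ∞ φ) :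
    ‖gradL Ω (smoothDisp hΩb hφ)‖ₑ ^ 2 = ∫⁻ x in Ω, ‖matL d (fderiv ℝ φ x)‖ₑ ^ 2 := by
  rw [enorm_gradL_sq]
  refine lintegral_congr_ae ?_
  filter_upwards [gradOf_smoothDisp hΩb hφ] with x hx
  rw [hx, classicalGradient_eq]

theorem enorm_symGradL_smoothDisp (hΩb : Bornology.IsBounded Ω) {φ : Vec d → Vec d}
    (hφ : ContDiff ℝ ∞ φ) :
    ‖symGradL Ω (smoothDisp hΩb hφ)‖ₑ ^ 2
      = ∫⁻ x in Ω, ‖matL d (symOp (fderiv ℝ φ x))‖ₑ ^ 2 := by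
  refine (enorm_lp_sq (symGradL Ω (smoothDisp hΩb hφ)).asLp).trans ?_
  refine lintegral_congr_ae ?_
  filter_upwards [gradOf_smoothDisp hΩb hφ, coeFn_symGradL (smoothDisp hΩb hφ)] with x hx h2
  rw [h2, hx, classicalGradient_eq, symMap_matL]

/-- `∫_Ω u_i ψ` as an inner product in `L²`. -/
theorem exists_inner_eq_integral_coord {ι : Type*} [Fintype ι] [DecidableEq ι] (i : ι)
    {ψ : Vec d → ℝ}
    (hψ : Continuous ψ) (hs : HasCompactSupport ψ) :
    ∃ Ψ : Lp (EuclideanSpace ℝ ι) 2 (volume.restrict Ω),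
      ∀ u : Lp (EuclideanSpace ℝ ι) 2 (volume.restrict Ω),
        ∫ x in Ω, u x i * ψ x = ⟪Ψ, u⟫_ℝ := by
  have hm : MemLp (fun x => ψ x • (EuclideanSpace.single i (1 : ℝ))) 2 (volume.restrict Ω) :=
    Continuous.memLp_of_hasCompactSupport (by fun_prop) hs.smul_right
  refine ⟨hm.toLp _, fun u => ?_⟩
  rw [MeasureTheory.L2.inner_def]
  refine integral_congr_ae ?_
  filter_upwards [hm.coeFn_toLp] with x hx
  rw [hx, real_inner_smul_left, EuclideanSpace.inner_single_left]
  simp [mul_comm]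

theorem isClosed_H1 : IsClosed (H1 Ω : Set
    (WithLp 2 (Lp (Vec d) 2 (volume.restrict Ω) × Lp (Mat d) 2 (volume.restrict Ω)))) := by
  have : (H1 Ω : Set
    (WithLp 2 (Lp (Vec d) 2 (volume.restrict Ω) × Lp (Mat d) 2 (volume.restrict Ω))))
      = {w | ∀ χ : Vec d → ℝ, ContDiff ℝ ∞ χ → HasCompactSupport χ → tsupport χ ⊆ Ω →
        ∀ i j : Fin d, ∫ x in Ω, w.fst x i * fderiv ℝ χ x (EuclideanSpace.single j 1)
          = -∫ x in Ω, w.snd x (i, j) * χ x} := rfl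
  rw [this]
  simp only [Set.ofPred_forall]
  refine isClosed_iInter fun χ => isClosed_iInter fun hχ => isClosed_iInter fun hc =>
    isClosed_iInter fun _ => isClosed_iInter fun i => isClosed_iInter fun j => ?_
  have hD : Continuous fun x => fderiv ℝ χ x (EuclideanSpace.single j 1) :=
    (hχ.continuous_fderiv (by simp)).clm_apply continuous_const
  have hDc : HasCompactSupport fun x => fderiv ℝ χ x (EuclideanSpace.single j 1) :=
    hc.fderiv_apply ℝ _
  obtain ⟨Ψ, hΨ⟩ := exists_inner_eq_integral_coord (Ω := Ω) i hD hDc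
  obtain ⟨Θ, hΘ⟩ := exists_inner_eq_integral_coord (Ω := Ω) (i, j) hχ.continuous hc
  simp only [hΨ, hΘ]
  refine isClosed_eq ?_ ?_
  · exact ((continuous_const.inner (WithLp.continuous_fst 2 _ _)))
  · exact ((continuous_const.inner (WithLp.continuous_snd 2 _ _))).neg

instance : CompleteSpace (Disp Ω) := (isClosed_H1 (Ω := Ω)).completeSpace_coe

theorem tendsto_disp_iff {ι : Type*} {l : Filter ι} {w : ι → Disp Ω} {u : Disp Ω} :
    Tendsto w l (𝓝 u) ↔
      Tendsto (fun n => eLpNorm (fun x => fieldOf (w n) x - fieldOf u x) 2 (volume.restrict Ω))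
        l (𝓝 0) ∧
      Tendsto (fun n => eLpNorm (fun x => gradOf (w n) x - gradOf u x) 2 (volume.restrict Ω))
        l (𝓝 0) := by
  have h1 : Tendsto w l (𝓝 u) ↔ Tendsto (fun n => fieldL Ω (w n)) l (𝓝 (fieldL Ω u)) ∧
      Tendsto (fun n => gradL Ω (w n)) l (𝓝 (gradL Ω u)) := by
    constructor
    · exact fun h => ⟨((fieldL Ω).continuous.tendsto u).comp h,
        ((gradL Ω).continuous.tendsto u).comp h⟩
    · rintro ⟨h1, h2⟩
      rw [tendsto_iff_norm_sub_tendsto_zero] at h1 h2 ⊢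
      have h3 : Tendsto (fun n => √(‖fieldL Ω (w n) - fieldL Ω u‖ ^ 2
          + ‖gradL Ω (w n) - gradL Ω u‖ ^ 2)) l (𝓝 0) := by
        have := ((h1.pow 2).add (h2.pow 2)).sqrt
        simpa using this
      refine h3.congr fun n => ?_
      rw [← map_sub, ← map_sub, ← norm_sq_Disp, Real.sqrt_sq (norm_nonneg _)]
  rw [h1]
  have key : ∀ {E : Type} [NormedAddCommGroup E] (f : ι → Lp E 2 (volume.restrict Ω))
      (g : Lp E 2 (volume.restrict Ω)), Tendsto f l (𝓝 g) ↔
      Tendsto (fun n => eLpNorm (fun x => f n x - g x) 2 (volume.restrict Ω)) l (𝓝 0) :=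
    fun f g => Lp.tendsto_Lp_iff_tendsto_eLpNorm' f g
  exact and_congr (key (fun n => fieldOf (w n)) (fieldOf u))
    (key (fun n => gradOf (w n)) (gradOf u))

/-- Traces in terms of convergence in `H¹`. -/
theorem isTrace_iff (hΩb : Bornology.IsBounded Ω) {u : H1 Ω} {t : L2Surface (frontier Ω)} :
    IsTrace u t ↔ ∃ (φ : ℕ → Vec d → Vec d) (hφ : ∀ n, ContDiff ℝ ∞ (φ n)),
      Tendsto (fun n => smoothDisp hΩb (hφ n)) atTop (𝓝 (u : Disp Ω)) ∧
      Tendsto (fun n => eLpNorm (fun x => φ n x - t x) 2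
        ((Measure.euclideanHausdorffMeasure (d - 1) : Measure (Vec d)).restrict (frontier Ω)))
        atTop (𝓝 0) := by
  have h1 : ∀ {φ : Vec d → Vec d} (hφ : ContDiff ℝ ∞ φ),
      eLpNorm (fun x => fieldOf (smoothDisp hΩb hφ) x - fieldOf u x) 2 (volume.restrict Ω)
        = eLpNorm (fun x => φ x - fieldOf u x) 2 (volume.restrict Ω) := fun {φ} hφ => by
    refine eLpNorm_congr_ae ?_
    filter_upwards [fieldOf_smoothDisp hΩb hφ] with x hx
    rw [hx]
  have h2 : ∀ {φ : Vec d → Vec d} (hφ : ContDiff ℝ ∞ φ),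
      eLpNorm (fun x => gradOf (smoothDisp hΩb hφ) x - gradOf u x) 2 (volume.restrict Ω)
        = eLpNorm (fun x => classicalGradient φ x - gradOf u x) 2 (volume.restrict Ω) :=
    fun {φ} hφ => by
    refine eLpNorm_congr_ae ?_
    filter_upwards [gradOf_smoothDisp hΩb hφ] with x hx
    rw [hx]
  constructor
  · rintro ⟨φ, hφ, a, b, c⟩
    refine ⟨φ, hφ, tendsto_disp_iff.2 ⟨?_, ?_⟩, c⟩
    · simpa only [h1] using a
    · simpa only [h2] using b
  · rintro ⟨φ, hφ, a, c⟩
    obtain ⟨a, b⟩ := tendsto_disp_iff.1 a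
    refine ⟨φ, hφ, ?_, ?_, c⟩
    · simpa only [h1] using a
    · simpa only [h2] using b

/-! ### Estimates along segments -/

theorem sq_lintegral_le {α : Type*} [MeasurableSpace α] {μ : Measure α} {g : α → ℝ≥0∞}
    (hg : AEMeasurable g μ) : (∫⁻ x, g x ∂μ) ^ 2 ≤ μ Set.univ * ∫⁻ x, g x ^ 2 ∂μ := by
  have h := ENNReal.lintegral_mul_le_Lp_mul_Lq μ Real.HolderConjugate.two_two hg
    (aemeasurable_const (b := (1 : ℝ≥0∞)))
  simp only [Pi.mul_apply, mul_one, ENNReal.rpow_two, one_pow, lintegral_one] at h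
  calc (∫⁻ x, g x ∂μ) ^ 2
      ≤ ((∫⁻ x, g x ^ 2 ∂μ) ^ (1 / 2 : ℝ) * μ Set.univ ^ (1 / 2 : ℝ)) ^ 2 := by gcongr
    _ = _ := by
      rw [mul_pow, ← ENNReal.rpow_natCast, ← ENNReal.rpow_natCast, ← ENNReal.rpow_mul,
        ← ENNReal.rpow_mul, mul_comm]
      norm_num

theorem add_sq_le_two_mul_add (a b : ℝ≥0∞) : (a + b) ^ 2 ≤ 2 * a ^ 2 + 2 * b ^ 2 := by
  have := ENNReal.rpow_add_le_mul_rpow_add_rpow a b (p := 2) (by norm_num)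
  norm_num at this
  rw [← mul_add]
  exact this

/-- The fundamental theorem of calculus along the segment from `x` to `x + z`, with the
Cauchy–Schwarz inequality. -/
theorem enorm_sub_sq_le_lintegral {E F : Type*} [NormedAddCommGroup E] [NormedSpace ℝ E]
    [NormedAddCommGroup F] [NormedSpace ℝ F] [CompleteSpace F] {φ : E → F} (hφ : ContDiff ℝ 1 φ)
    (x z : E) {t : ℝ} (ht : 0 ≤ t) :
    ‖φ (x + t • z) - φ x‖ₑ ^ 2
      ≤ ENNReal.ofReal t * ∫⁻ s in Set.Ioc 0 t, (‖fderiv ℝ φ (x + s • z)‖ₑ * ‖z‖ₑ) ^ 2 := by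
  have hd : ∀ s : ℝ, HasDerivAt (fun s : ℝ => φ (x + s • z)) (fderiv ℝ φ (x + s • z) z) s := by
    intro s
    have h1 : HasDerivAt (fun s : ℝ => x + s • z) z s := by
      simpa using ((hasDerivAt_id s).smul_const z).const_add x
    exact ((hφ.differentiable (by simp)) _).hasFDerivAt.comp_hasDerivAt s h1
  have hc : Continuous fun s : ℝ => fderiv ℝ φ (x + s • z) z :=
    ((hφ.continuous_fderiv (by simp)).comp (by fun_prop)).clm_apply continuous_const
  have h2 : φ (x + t • z) - φ x = ∫ s in (0 : ℝ)..t, fderiv ℝ φ (x + s • z) z := by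
    have := intervalIntegral.integral_eq_sub_of_hasDerivAt (a := 0) (b := t) (fun s _ => hd s)
      (hc.intervalIntegrable 0 t)
    rw [this]; simp
  rw [h2, intervalIntegral.integral_of_le ht]
  calc ‖∫ s in Set.Ioc 0 t, fderiv ℝ φ (x + s • z) z‖ₑ ^ 2
      ≤ (∫⁻ s in Set.Ioc 0 t, ‖fderiv ℝ φ (x + s • z)‖ₑ * ‖z‖ₑ) ^ 2 := by
        gcongr
        refine (enorm_integral_le_lintegral_enorm _).trans (lintegral_mono fun s => ?_)
        exact (fderiv ℝ φ (x + s • z)).le_opENorm z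
    _ ≤ _ := by
        have hm : AEMeasurable (fun s : ℝ => ‖fderiv ℝ φ (x + s • z)‖ₑ * ‖z‖ₑ)
            (volume.restrict (Set.Ioc 0 t)) :=
          (((hφ.continuous_fderiv (by simp)).comp
            (by fun_prop : Continuous fun s : ℝ => x + s • z)).enorm.aemeasurable).mul_const _
        refine (sq_lintegral_le hm).trans_eq ?_
        rw [Measure.restrict_apply_univ, Real.volume_Ioc, sub_zero]

/-- A bound for a value of `φ` by the mean values of `|φ|²` and `|∇φ|²` along a segment. -/
theorem enorm_sq_le_lintegral_segment {E F : Type*} [NormedAddCommGroup E] [NormedSpace ℝ E]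
    [NormedAddCommGroup F] [NormedSpace ℝ F] [CompleteSpace F] {φ : E → F} (hφ : ContDiff ℝ 1 φ)
    (x : E) {n : E} (hn : ‖n‖ = 1) (δ : ℝ) :
    ENNReal.ofReal δ * ‖φ x‖ₑ ^ 2 ≤ ∫⁻ t in Set.Ioc 0 δ, (2 * ‖φ (x + t • n)‖ₑ ^ 2
      + 2 * ENNReal.ofReal δ ^ 2 * ‖fderiv ℝ φ (x + t • n)‖ₑ ^ 2) := by
  set I := ∫⁻ s in Set.Ioc 0 δ, ‖fderiv ℝ φ (x + s • n)‖ₑ ^ 2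
  have hn' : ‖n‖ₑ = 1 := by rw [← ofReal_norm, hn, ENNReal.ofReal_one]
  have h1 : ∀ t ∈ Set.Ioc 0 δ, ‖φ x‖ₑ ^ 2 ≤ 2 * ‖φ (x + t • n)‖ₑ ^ 2
      + 2 * (ENNReal.ofReal δ * I) := by
    intro t ht
    have h2 := enorm_sub_sq_le_lintegral hφ x n ht.1.le
    simp only [hn', mul_one] at h2
    have h3 : ‖φ (x + t • n) - φ x‖ₑ ^ 2 ≤ ENNReal.ofReal δ * I := by
      refine h2.trans ?_
      gcongr
      · exact ht.2
      · exact lintegral_mono_set (Set.Ioc_subset_Ioc_right ht.2)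
    have h4 : ‖φ x‖ₑ ≤ ‖φ (x + t • n)‖ₑ + ‖φ (x + t • n) - φ x‖ₑ := by
      have := enorm_sub_le (a := φ (x + t • n)) (b := φ (x + t • n) - φ x)
      simpa using this
    calc ‖φ x‖ₑ ^ 2 ≤ (‖φ (x + t • n)‖ₑ + ‖φ (x + t • n) - φ x‖ₑ) ^ 2 := by gcongr
      _ ≤ _ := (add_sq_le_two_mul_add _ _).trans (by gcongr)
  have hcφ : Continuous fun t : ℝ => φ (x + t • n) := hφ.continuous.comp (by fun_prop)
  have hcd : Continuous fun t : ℝ => fderiv ℝ φ (x + t • n) :=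
    (hφ.continuous_fderiv (by simp)).comp (by fun_prop)
  calc ENNReal.ofReal δ * ‖φ x‖ₑ ^ 2 = ∫⁻ t in Set.Ioc 0 δ, ‖φ x‖ₑ ^ 2 := by
        rw [setLIntegral_const, Real.volume_Ioc, sub_zero, mul_comm]
    _ ≤ ∫⁻ t in Set.Ioc 0 δ, (2 * ‖φ (x + t • n)‖ₑ ^ 2 + 2 * (ENNReal.ofReal δ * I)) :=
        setLIntegral_mono' measurableSet_Ioc h1
    _ = (∫⁻ t in Set.Ioc 0 δ, 2 * ‖φ (x + t • n)‖ₑ ^ 2)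
        + 2 * ENNReal.ofReal δ ^ 2 * I := by
        rw [lintegral_add_right _ measurable_const, setLIntegral_const, Real.volume_Ioc, sub_zero]
        ring
    _ = _ := by
        rw [← lintegral_const_mul _ (hcd.enorm.measurable.pow_const 2),
          lintegral_add_right _ ((hcd.enorm.measurable.pow_const 2).const_mul _)]

/-- The `L²` modulus of continuity of `φ` on `K`, if the segments from the points `x` of `K` to
`x + z` lie in `Ω`. -/
theorem lintegral_translate_sub_sq_le {F : Type*} [NormedAddCommGroup F] [NormedSpace ℝ F]
    [CompleteSpace F] {φ : Vec d → F} (hφ : ContDiff ℝ 1 φ) {K : Set (Vec d)} (z : Vec d)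
    (hz : ∀ x ∈ K, ∀ s ∈ Set.Ioc (0 : ℝ) 1, x + s • z ∈ Ω) :
    ∫⁻ x in K, ‖φ (x + z) - φ x‖ₑ ^ 2 ≤ ‖z‖ₑ ^ 2 * ∫⁻ x in Ω, ‖fderiv ℝ φ x‖ₑ ^ 2 := by
  have hcd : Continuous fun p : Vec d × ℝ => fderiv ℝ φ (p.1 + p.2 • z) :=
    (hφ.continuous_fderiv (by simp)).comp (by fun_prop)
  have hm : Measurable fun p : Vec d × ℝ => (‖fderiv ℝ φ (p.1 + p.2 • z)‖ₑ * ‖z‖ₑ) ^ 2 :=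
    (hcd.enorm.measurable.mul_const _).pow_const 2
  calc ∫⁻ x in K, ‖φ (x + z) - φ x‖ₑ ^ 2
      ≤ ∫⁻ x in K, ∫⁻ s in Set.Ioc (0 : ℝ) 1, (‖fderiv ℝ φ (x + s • z)‖ₑ * ‖z‖ₑ) ^ 2 := by
        refine lintegral_mono fun x => ?_
        simpa using enorm_sub_sq_le_lintegral hφ x z zero_le_one
    _ = ∫⁻ s in Set.Ioc (0 : ℝ) 1, ∫⁻ x in K, (‖fderiv ℝ φ (x + s • z)‖ₑ * ‖z‖ₑ) ^ 2 :=
        lintegral_lintegral_swap hm.aemeasurable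
    _ ≤ ∫⁻ s in Set.Ioc (0 : ℝ) 1, ‖z‖ₑ ^ 2 * ∫⁻ x in Ω, ‖fderiv ℝ φ x‖ₑ ^ 2 := by
        refine setLIntegral_mono' measurableSet_Ioc fun s hs => ?_
        simp only [mul_pow]
        have hms : Measurable fun x : Vec d => ‖fderiv ℝ φ (x + s • z)‖ₑ ^ 2 :=
          (((hφ.continuous_fderiv (by simp)).comp
            (by fun_prop : Continuous fun x : Vec d => x + s • z)).enorm.measurable.pow_const 2)
        rw [lintegral_mul_const _ hms, mul_comm]
        refine mul_le_mul' le_rfl ?_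
        have hmp : MeasurePreserving (fun x : Vec d => x + s • z) volume volume :=
          measurePreserving_add_right volume (s • z)
        calc ∫⁻ x in K, ‖fderiv ℝ φ (x + s • z)‖ₑ ^ 2
            ≤ ∫⁻ x in (fun x => x + s • z) ⁻¹' Ω, ‖fderiv ℝ φ (x + s • z)‖ₑ ^ 2 :=
              lintegral_mono_set fun x hx => hz x hx s hs
          _ = ∫⁻ x in Ω, ‖fderiv ℝ φ x‖ₑ ^ 2 :=
              hmp.setLIntegral_comp_preimage_emb
                (Homeomorph.addRight (s • z)).measurableEmbedding
                (fun x => ‖fderiv ℝ φ x‖ₑ ^ 2) Ω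
    _ = _ := by rw [setLIntegral_const, Real.volume_Ioc]; simp

/-! ### Boundary charts and the trace inequality -/

/-- The height of `x` over the graph of `γ` in direction `n`. -/
def height (n : Vec d) (γ : Vec d → ℝ) (x : Vec d) : ℝ := ⟪n, x⟫_ℝ - γ (x - ⟪n, x⟫_ℝ • n)

theorem height_add_smul {n : Vec d} (hn : ‖n‖ = 1) (γ : Vec d → ℝ) (x : Vec d) (t : ℝ) :
    height n γ (x + t • n) = height n γ x + t := by
  have h1 : ⟪n, x + t • n⟫_ℝ = ⟪n, x⟫_ℝ + t := by
    rw [inner_add_right, real_inner_smul_right, real_inner_self_eq_norm_sq, hn]; ring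
  have h2 : x + t • n - (⟪n, x⟫_ℝ + t) • n = x - ⟪n, x⟫_ℝ • n := by
    rw [add_smul]; abel
  rw [height, height, h1, h2]; ring

theorem continuous_height (n : Vec d) {γ : Vec d → ℝ} (hγ : Continuous γ) :
    Continuous (height n γ) := by
  unfold height
  fun_prop

/-- In the ball of radius `r` about `x₀`, the set `Ω` is the strict epigraph of a function `γ` of
class `C^{1,1}` over the hyperplane orthogonal to `n`. As in `HasC11Boundary`, `γ` is a function on
the whole space, of which only the values on the hyperplane matter. -/
structure IsChart (Ω : Set (Vec d)) (x₀ : Vec d) (r : ℝ) (n : Vec d) (γ : Vec d → ℝ) : Prop where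
  pos : 0 < r
  norm_eq : ‖n‖ = 1
  diff : Differentiable ℝ γ
  lip : ∃ K, LipschitzWith K (fderiv ℝ γ)
  mem_iff : ∀ x ∈ Metric.ball x₀ r, x ∈ Ω ↔ 0 < height n γ x

theorem HasC11Boundary.exists_isChart (hΩ : HasC11Boundary Ω) {x₀ : Vec d}
    (hx₀ : x₀ ∈ frontier Ω) : ∃ r n γ, IsChart Ω x₀ r n γ := by
  obtain ⟨r, hr, n, hn, γ, hγ, hL, h⟩ := hΩ x₀ hx₀
  exact ⟨r, n, γ, hr, hn, hγ, hL, fun x hx => (h x hx).trans sub_pos.symm⟩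

namespace IsChart

variable {x₀ n : Vec d} {r : ℝ} {γ : Vec d → ℝ}

theorem contDiff (h : IsChart Ω x₀ r n γ) : ContDiff ℝ 1 γ := by
  obtain ⟨K, hK⟩ := h.lip
  exact contDiff_one_iff_fderiv.2 ⟨h.diff, hK.continuous⟩

theorem height_eq_zero (h : IsChart Ω x₀ r n γ) (hΩo : IsOpen Ω) {x : Vec d}
    (hx : x ∈ Metric.ball x₀ r) (hxf : x ∈ frontier Ω) : height n γ x = 0 := by
  have hc := continuous_height n h.diff.continuous
  rw [hΩo.frontier_eq] at hxf
  refine le_antisymm (not_lt.1 fun hp => hxf.2 ((h.mem_iff x hx).2 hp)) ?_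
  by_contra hneg
  push Not at hneg
  have h1 : ∀ᶠ y in 𝓝 x, height n γ y < 0 := hc.continuousAt.eventually (gt_mem_nhds hneg)
  have h2 : ∀ᶠ y in 𝓝 x, y ∈ Metric.ball x₀ r := Metric.isOpen_ball.mem_nhds hx
  obtain ⟨y, ⟨h3, h4⟩, h5⟩ := mem_closure_iff_nhds.1 hxf.1 _ (h1.and h2)
  exact lt_asymm h3 ((h.mem_iff y h4).1 h5)

theorem add_smul_mem (h : IsChart Ω x₀ r n γ) {x : Vec d} {t s : ℝ}
    (hx : x ∈ Metric.ball x₀ s) (hxf : 0 ≤ height n γ x) (ht : 0 < t) (hst : s + t ≤ r) :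
    x + t • n ∈ Ω := by
  have hm : x + t • n ∈ Metric.ball x₀ r := by
    rw [mem_ball_iff_norm] at hx ⊢
    have : ‖x + t • n - x₀‖ ≤ ‖x - x₀‖ + t := by
      calc ‖x + t • n - x₀‖ = ‖(x - x₀) + t • n‖ := by congr 1; abel
        _ ≤ ‖x - x₀‖ + ‖t • n‖ := norm_add_le _ _
        _ = _ := by rw [norm_smul, h.norm_eq, mul_one, Real.norm_of_nonneg ht.le]
    linarith
  rw [h.mem_iff _ hm, height_add_smul h.norm_eq]
  linarith

end IsChart

/-- The hyperplane orthogonal to `n`. -/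
abbrev Hyper (n : Vec d) : Type := (Submodule.span ℝ {n})ᗮ

theorem finrank_hyper (hd : 1 ≤ d) {n : Vec d} (hn : ‖n‖ = 1) :
    Module.finrank ℝ (Hyper n) = d - 1 := by
  have hn0 : n ≠ 0 := fun h => by simp [h] at hn
  have : Fact (Module.finrank ℝ (Vec d) = (d - 1) + 1) := ⟨by simp; omega⟩
  exact Submodule.finrank_orthogonal_span_singleton hn0

theorem inner_hyper {n : Vec d} (w : Hyper n) : ⟪n, (w : Vec d)⟫_ℝ = 0 :=
  Submodule.mem_orthogonal_singleton_iff_inner_right.1 w.2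

theorem sub_inner_smul_mem {n : Vec d} (hn : ‖n‖ = 1) (x : Vec d) :
    x - ⟪n, x⟫_ℝ • n ∈ (Submodule.span ℝ {n})ᗮ := by
  rw [Submodule.mem_orthogonal_singleton_iff_inner_right, inner_sub_right, real_inner_smul_right,
    real_inner_self_eq_norm_sq, hn]
  ring

/-- Coordinates `(w, t) ↦ w + t n`, for `w` in the hyperplane orthogonal to `n`. -/
def hyperEquiv {n : Vec d} (hn : ‖n‖ = 1) : (Hyper n × ℝ) ≃L[ℝ] Vec d :=
  LinearEquiv.toContinuousLinearEquiv
  { toFun := fun p => (p.1 : Vec d) + p.2 • n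
    map_add' := fun p q => by
      simp only [Prod.fst_add, Prod.snd_add, Submodule.coe_add, add_smul]
      abel
    map_smul' := fun c p => by
      simp only [Prod.smul_fst, Prod.smul_snd, Submodule.coe_smul, smul_eq_mul, mul_smul, smul_add,
        RingHom.id_apply]
    invFun := fun x => (⟨x - ⟪n, x⟫_ℝ • n, sub_inner_smul_mem hn x⟩, ⟪n, x⟫_ℝ)
    left_inv := fun p => by
      have h : ⟪n, (p.1 : Vec d) + p.2 • n⟫_ℝ = p.2 := by
        rw [inner_add_right, inner_hyper, real_inner_smul_right, real_inner_self_eq_norm_sq, hn]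
        ring
      ext1
      · ext1
        simp only [h]
        abel
      · exact h
    right_inv := fun x => by simp }

theorem euclideanHausdorffMeasure_image_le {X Y : Type*} [EMetricSpace X] [EMetricSpace Y]
    [MeasurableSpace X] [BorelSpace X] [MeasurableSpace Y] [BorelSpace Y] {K : NNReal} {f : X → Y}
    {s : Set X} (hf : LipschitzOnWith K f s) (k : ℕ) :
    (Measure.euclideanHausdorffMeasure k : Measure Y) (f '' s)
      ≤ (K : ℝ≥0∞) ^ k * (Measure.euclideanHausdorffMeasure k : Measure X) s := by
  rw [Measure.euclideanHausdorffMeasure_def, Measure.euclideanHausdorffMeasure_def,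
    Measure.smul_apply, Measure.smul_apply, ENNReal.smul_def, ENNReal.smul_def, smul_eq_mul,
    smul_eq_mul, mul_left_comm]
  gcongr
  simpa using hf.hausdorffMeasure_image_le (d := (k : ℝ)) (by positivity)

/-- Fubini in the coordinates `(w, t) ↦ w + t n`, up to a constant. -/
theorem exists_lintegral_hyper_le {n : Vec d} (hn : ‖n‖ = 1) :
    ∃ c : ℝ≥0∞, c ≠ ⊤ ∧ ∀ F : Vec d → ℝ≥0∞, Measurable F →
      ∫⁻ w : Hyper n, ∫⁻ t : ℝ, F (w + t • n) ≤ c * ∫⁻ x, F x := by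
  let e := hyperEquiv hn
  have : (volume : Measure (Hyper n × ℝ)).IsAddHaarMeasure :=
    Measure.prod.instIsAddHaarMeasure (volume : Measure (Hyper n)) (volume : Measure ℝ)
  have hHaar : ((volume : Measure (Hyper n × ℝ)).map e).IsAddHaarMeasure :=
    e.isAddHaarMeasure_map _
  refine ⟨Measure.addHaarScalarFactor ((volume : Measure (Hyper n × ℝ)).map e) volume,
    ENNReal.coe_ne_top, fun F hF => ?_⟩
  have h1 := Measure.isAddLeftInvariant_eq_smul ((volume : Measure (Hyper n × ℝ)).map e) volume
  have h2 : ∫⁻ p : Hyper n × ℝ, F (e p) = ∫⁻ w : Hyper n, ∫⁻ t : ℝ, F (w + t • n) :=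
    lintegral_prod _ (hF.comp e.continuous.measurable).aemeasurable
  rw [← h2, ← lintegral_map hF e.continuous.measurable]
  refine (congrArg (fun m : Measure (Vec d) => ∫⁻ x, F x ∂m) h1).trans_le ?_
  rw [lintegral_smul_measure]
  rfl

namespace IsChart

variable {x₀ n : Vec d} {r : ℝ} {γ : Vec d → ℝ}

/-- The surface measure is controlled by the Lebesgue measure of a boundary layer. -/
theorem exists_lintegral_surface_le (h : IsChart Ω x₀ r n γ) (hd : 1 ≤ d) (hΩo : IsOpen Ω)
    {s δ : ℝ} (hδ : 0 < δ) (hs : s + δ ≤ r) :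
    ∃ c : ℝ≥0∞, c ≠ ⊤ ∧ ∀ F : Vec d → ℝ≥0∞, Measurable F →
      ∫⁻ x in frontier Ω ∩ Metric.ball x₀ s, (∫⁻ t in Set.Ioc 0 δ, F (x + t • n))
        ∂(Measure.euclideanHausdorffMeasure (d - 1) : Measure (Vec d))
        ≤ c * ∫⁻ x in Ω, F x := by
  classical
  set S := frontier Ω ∩ Metric.ball x₀ s with hS
  have hSm : MeasurableSet S := isClosed_frontier.measurableSet.inter measurableSet_ball
  let G : Hyper n → Vec d := fun w => w + γ w • n
  have hG : ContDiff ℝ 1 G := by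
    have h1 : ContDiff ℝ 1 fun w : Hyper n => (w : Vec d) :=
      (Submodule.subtypeL (Submodule.span ℝ {n})ᗮ).contDiff
    exact h1.add ((h.contDiff.comp h1).smul contDiff_const)
  -- the projection of `S` to the hyperplane is bounded
  let P : Vec d → Hyper n := fun x => ((hyperEquiv h.norm_eq).symm x).1
  have hPc : Continuous P := continuous_fst.comp (hyperEquiv h.norm_eq).symm.continuous
  have hP : ∀ x, (P x : Vec d) = x - ⟪n, x⟫_ℝ • n := fun x => rfl
  obtain ⟨D, hDc, hSD⟩ : ∃ D : Set (Hyper n), IsCompact D ∧ ∀ x ∈ S, P x ∈ D :=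
    ⟨P '' Metric.closedBall x₀ s, (isCompact_closedBall _ _).image hPc,
      fun x hx => ⟨x, Metric.ball_subset_closedBall hx.2, rfl⟩⟩
  obtain ⟨K, hK⟩ := LocallyLipschitzOn.exists_lipschitzOnWith_of_compact hDc
    (hG.locallyLipschitz.locallyLipschitzOn (s := D))
  have hGP : ∀ x ∈ S, G (P x) = x := by
    intro x hx
    have h0 := h.height_eq_zero hΩo (Metric.ball_subset_ball (by linarith) hx.2) hx.1
    rw [height, sub_eq_zero] at h0
    simp only [G, hP, ← h0]
    abel
  have hvol : (Measure.euclideanHausdorffMeasure (d - 1) : Measure (Hyper n)) = volume := by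
    rw [← finrank_hyper hd h.norm_eq]
    exact InnerProductSpace.euclideanHausdorffMeasure_eq_volume
  -- `S` is a part of the image of `D` under the Lipschitz map `G`
  have hmeas : (Measure.euclideanHausdorffMeasure (d - 1) : Measure (Vec d)).restrict S
      ≤ (K : ℝ≥0∞) ^ (d - 1) • (volume.restrict D).map G := by
    refine Measure.le_iff.2 fun A hA => ?_
    rw [Measure.restrict_apply hA, Measure.smul_apply, smul_eq_mul,
      Measure.map_apply hG.continuous.measurable hA,
      Measure.restrict_apply (hG.continuous.measurable hA), ← hvol]
    refine (measure_mono ?_).trans (euclideanHausdorffMeasure_image_le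
      (hK.mono (Set.inter_subset_right (s := G ⁻¹' A))) (d - 1))
    intro x hx
    refine ⟨P x, ⟨?_, hSD x hx.2⟩, hGP x hx.2⟩
    rw [Set.mem_preimage, hGP x hx.2]
    exact hx.1
  obtain ⟨c, hc, hcF⟩ := exists_lintegral_hyper_le h.norm_eq
  refine ⟨(K : ℝ≥0∞) ^ (d - 1) * c, ENNReal.mul_ne_top (by simp) hc, fun F hF => ?_⟩
  let F' := Ω.indicator F
  have hF' : Measurable F' := hF.indicator hΩo.measurableSet
  have hQ : Measurable fun x => ∫⁻ t in Set.Ioc 0 δ, F' (x + t • n) := by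
    refine Measurable.lintegral_prod_right' (f := fun p : Vec d × ℝ => F' (p.1 + p.2 • n)) ?_
    exact hF'.comp (by fun_prop)
  calc ∫⁻ x in S, (∫⁻ t in Set.Ioc 0 δ, F (x + t • n))
        ∂(Measure.euclideanHausdorffMeasure (d - 1) : Measure (Vec d))
      = ∫⁻ x in S, (∫⁻ t in Set.Ioc 0 δ, F' (x + t • n))
        ∂(Measure.euclideanHausdorffMeasure (d - 1) : Measure (Vec d)) := by
        refine setLIntegral_congr_fun hSm fun x hx =>
          setLIntegral_congr_fun measurableSet_Ioc fun t ht => ?_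
        have h0 := h.height_eq_zero hΩo (Metric.ball_subset_ball (by linarith) hx.2) hx.1
        have : x + t • n ∈ Ω := h.add_smul_mem hx.2 h0.ge ht.1 (by linarith [ht.2])
        exact (Set.indicator_of_mem this F).symm
    _ ≤ ∫⁻ x, (∫⁻ t in Set.Ioc 0 δ, F' (x + t • n))
          ∂((K : ℝ≥0∞) ^ (d - 1) • (volume.restrict D).map G) := lintegral_mono' hmeas le_rfl
    _ = (K : ℝ≥0∞) ^ (d - 1) * ∫⁻ w in D, ∫⁻ t in Set.Ioc 0 δ, F' (G w + t • n) := by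
        rw [lintegral_smul_measure, lintegral_map hQ hG.continuous.measurable]; rfl
    _ ≤ (K : ℝ≥0∞) ^ (d - 1) * ∫⁻ w : Hyper n, ∫⁻ t : ℝ, F' (w + t • n) := by
        refine mul_le_mul' le_rfl ?_
        refine (setLIntegral_le_lintegral _ _).trans (lintegral_mono fun w => ?_)
        refine (setLIntegral_le_lintegral _ _).trans_eq ?_
        have : ∀ t : ℝ, G w + t • n = (w : Vec d) + (t + γ w) • n := fun t => by
          simp only [G, add_smul]; abel
        simp only [this]
        exact lintegral_add_right_eq_self (fun t : ℝ => F' ((w : Vec d) + t • n)) (γ w)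
    _ ≤ (K : ℝ≥0∞) ^ (d - 1) * (c * ∫⁻ x, F' x) := by gcongr; exact hcF F' hF'
    _ = _ := by rw [lintegral_indicator hΩo.measurableSet, mul_assoc]

theorem exists_trace_le (h : IsChart Ω x₀ r n γ) (hd : 1 ≤ d) (hΩo : IsOpen Ω) :
    ∃ c : ℝ≥0∞, c ≠ ⊤ ∧ ∀ φ : Vec d → Vec d, ContDiff ℝ 1 φ →
      ∫⁻ x in frontier Ω ∩ Metric.ball x₀ (r / 2), ‖φ x‖ₑ ^ 2
        ∂(Measure.euclideanHausdorffMeasure (d - 1) : Measure (Vec d))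
        ≤ c * ((∫⁻ x in Ω, ‖φ x‖ₑ ^ 2) + ∫⁻ x in Ω, ‖fderiv ℝ φ x‖ₑ ^ 2) := by
  have hr := h.pos
  obtain ⟨c, hc, hcF⟩ := h.exists_lintegral_surface_le hd hΩo (s := r / 2) (δ := r / 2)
    (by linarith) (by linarith)
  set δ := ENNReal.ofReal (r / 2) with hδ
  have hδ0 : δ ≠ 0 := by simp [hδ, hr]
  have hδt : δ ≠ ⊤ := ENNReal.ofReal_ne_top
  refine ⟨δ⁻¹ * c * (2 + 2 * δ ^ 2), ?_, fun φ hφ => ?_⟩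
  · finiteness
  have hcd := hφ.continuous_fderiv (by simp)
  have m1 : Measurable fun x => 2 * ‖φ x‖ₑ ^ 2 :=
    (hφ.continuous.enorm.measurable.pow_const 2).const_mul _
  have m2 : Measurable fun x => 2 * δ ^ 2 * ‖fderiv ℝ φ x‖ₑ ^ 2 :=
    (hcd.enorm.measurable.pow_const 2).const_mul _
  have hF := hcF _ (m1.add m2)
  calc _ ≤ ∫⁻ x in frontier Ω ∩ Metric.ball x₀ (r / 2), (δ⁻¹ *
        ∫⁻ t in Set.Ioc 0 (r / 2), (2 * ‖φ (x + t • n)‖ₑ ^ 2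
          + 2 * δ ^ 2 * ‖fderiv ℝ φ (x + t • n)‖ₑ ^ 2))
        ∂(Measure.euclideanHausdorffMeasure (d - 1) : Measure (Vec d)) := by
        refine lintegral_mono fun x => ?_
        have h1 := enorm_sq_le_lintegral_segment hφ x h.norm_eq (r / 2)
        rw [← ENNReal.div_eq_inv_mul, ENNReal.le_div_iff_mul_le (Or.inl hδ0) (Or.inl hδt), mul_comm]
        exact h1
    _ = δ⁻¹ * ∫⁻ x in frontier Ω ∩ Metric.ball x₀ (r / 2),
        (∫⁻ t in Set.Ioc 0 (r / 2), (2 * ‖φ (x + t • n)‖ₑ ^ 2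
          + 2 * δ ^ 2 * ‖fderiv ℝ φ (x + t • n)‖ₑ ^ 2))
        ∂(Measure.euclideanHausdorffMeasure (d - 1) : Measure (Vec d)) :=
        lintegral_const_mul' _ _ (by simp [hδ0])
    _ ≤ δ⁻¹ * (c * ∫⁻ x in Ω, (2 * ‖φ x‖ₑ ^ 2 + 2 * δ ^ 2 * ‖fderiv ℝ φ x‖ₑ ^ 2)) := by
        gcongr; exact hF
    _ = δ⁻¹ * c * (2 * (∫⁻ x in Ω, ‖φ x‖ₑ ^ 2) + 2 * δ ^ 2 * ∫⁻ x in Ω, ‖fderiv ℝ φ x‖ₑ ^ 2) := by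
        rw [lintegral_add_left m1,
          lintegral_const_mul _ (hφ.continuous.enorm.measurable.pow_const 2),
          lintegral_const_mul _ (hcd.enorm.measurable.pow_const 2)]
        ring
    _ ≤ _ := by
        rw [mul_assoc _ (2 + 2 * δ ^ 2)]
        gcongr
        rw [add_mul, mul_add, mul_add]
        gcongr
        · exact le_self_add
        · exact le_add_self

end IsChart

/-- The trace inequality. -/
theorem exists_trace_le (hd : 1 ≤ d) (hΩo : IsOpen Ω) (hΩb : Bornology.IsBounded Ω)
    (hΩ : HasC11Boundary Ω) :
    ∃ c : ℝ≥0∞, c ≠ ⊤ ∧ ∀ φ : Vec d → Vec d, ContDiff ℝ 1 φ →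
      ∫⁻ x in frontier Ω, ‖φ x‖ₑ ^ 2
        ∂(Measure.euclideanHausdorffMeasure (d - 1) : Measure (Vec d))
        ≤ c * ((∫⁻ x in Ω, ‖φ x‖ₑ ^ 2) + ∫⁻ x in Ω, ‖fderiv ℝ φ x‖ₑ ^ 2) := by
  have hK : IsCompact (frontier Ω) :=
    hΩb.isCompact_closure.of_isClosed_subset isClosed_frontier frontier_subset_closure
  have := hK.induction_on (p := fun T => ∃ c : ℝ≥0∞, c ≠ ⊤ ∧ ∀ φ : Vec d → Vec d, ContDiff ℝ 1 φ →
      ∫⁻ x in frontier Ω ∩ T, ‖φ x‖ₑ ^ 2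
        ∂(Measure.euclideanHausdorffMeasure (d - 1) : Measure (Vec d))
        ≤ c * ((∫⁻ x in Ω, ‖φ x‖ₑ ^ 2) + ∫⁻ x in Ω, ‖fderiv ℝ φ x‖ₑ ^ 2))
    ⟨0, by simp, fun φ _ => by simp⟩ ?_ ?_ ?_
  · simpa using this
  · rintro s t hst ⟨c, hc, h⟩
    exact ⟨c, hc, fun φ hφ => (lintegral_mono_set (Set.inter_subset_inter_right _ hst)).trans
      (h φ hφ)⟩
  · rintro s t ⟨c, hc, h⟩ ⟨c', hc', h'⟩
    refine ⟨c + c', by finiteness, fun φ hφ => ?_⟩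
    rw [Set.inter_union_distrib_left, add_mul]
    exact (lintegral_union_le _ _ _).trans (add_le_add (h φ hφ) (h' φ hφ))
  · intro x hx
    obtain ⟨r, n, γ, hch⟩ := hΩ.exists_isChart hx
    refine ⟨Metric.ball x (r / 2), mem_nhdsWithin_of_mem_nhds
      (Metric.ball_mem_nhds x (half_pos hch.pos)), hch.exists_trace_le hd hΩo⟩

/-! ### The trace operator -/

section Graph

variable {X Y : Type*} [NormedAddCommGroup X] [NormedSpace ℝ X] [NormedAddCommGroup Y]
  [NormedSpace ℝ Y]

/-- A subspace `G` with `‖y‖ ≤ C ‖x‖` for all `(x, y)` in `G` is the graph of an operator. -/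
theorem eq_of_mem_graph {G : Submodule ℝ (X × Y)} {C : ℝ} (hC : ∀ p ∈ G, ‖p.2‖ ≤ C * ‖p.1‖)
    {x : X} {y y' : Y} (h : (x, y) ∈ G) (h' : (x, y') ∈ G) : y = y' := by
  have := hC _ (G.sub_mem h h')
  simp only [Prod.mk_sub_mk, sub_self, norm_zero, mul_zero] at this
  exact sub_eq_zero.1 (norm_le_zero_iff.1 this)

/-- The preimage of `K` under the operator with graph `G`, as a subspace. -/
def graphPreimage (G : Submodule ℝ (X × Y)) (K : Submodule ℝ Y) : Submodule ℝ X where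
  carrier := {x | ∃ y ∈ K, (x, y) ∈ G}
  zero_mem' := ⟨0, K.zero_mem, G.zero_mem⟩
  add_mem' := by
    rintro _ _ ⟨y, hy, h⟩ ⟨z, hz, h'⟩
    exact ⟨y + z, K.add_mem hy hz, G.add_mem h h'⟩
  smul_mem' := by
    rintro c _ ⟨y, hy, h⟩
    exact ⟨c • y, K.smul_mem c hy, G.smul_mem c h⟩

theorem mem_graphPreimage {G : Submodule ℝ (X × Y)} {K : Submodule ℝ Y} {x : X} :
    x ∈ graphPreimage G K ↔ ∃ y ∈ K, (x, y) ∈ G := Iff.rfl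

/-- Closed subspaces have closed preimages under a bounded operator with a closed graph, although
its domain need not be the whole space. -/
theorem isClosed_graphPreimage [CompleteSpace X] [CompleteSpace Y] {G : Submodule ℝ (X × Y)}
    (hG : IsClosed (G : Set (X × Y))) {K : Submodule ℝ Y} (hK : IsClosed (K : Set Y)) {C : ℝ}
    (hC : ∀ p ∈ G, ‖p.2‖ ≤ C * ‖p.1‖) : IsClosed (graphPreimage G K : Set X) := by
  let G' : Submodule ℝ (X × Y) := G ⊓ K.comap (LinearMap.snd ℝ X Y)
  have hG' : IsClosed (G' : Set (X × Y)) := hG.inter (hK.preimage continuous_snd)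
  have : CompleteSpace G' := hG'.completeSpace_coe
  let f : G' →L[ℝ] X := (ContinuousLinearMap.fst ℝ X Y).comp G'.subtypeL
  have hf : AntilipschitzWith (max 1 C).toNNReal f := by
    refine ContinuousLinearMap.antilipschitz_of_bound f fun p => ?_
    rw [Real.coe_toNNReal _ (by positivity)]
    have h1 : ‖(p : X × Y).2‖ ≤ C * ‖(p : X × Y).1‖ := hC _ p.2.1
    have h2 : ‖p‖ = max ‖(p : X × Y).1‖ ‖(p : X × Y).2‖ := rfl
    have h3 : f p = (p : X × Y).1 := rfl
    rw [h2, h3]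
    refine max_le ?_ (h1.trans ?_)
    · exact le_mul_of_one_le_left (norm_nonneg _) (le_max_left _ _)
    · gcongr
      exact le_max_right _ _
  have h1 := hf.isClosed_range f.uniformContinuous
  have h2 : (graphPreimage G K : Set X) = Set.range f := by
    ext u
    constructor
    · rintro ⟨t, ht, hut⟩
      exact ⟨⟨(u, t), hut, ht⟩, rfl⟩
    · rintro ⟨p, rfl⟩
      exact ⟨(p : X × Y).2, p.2.2, p.2.1⟩
  rw [h2]
  exact h1

/-- A functional composed with the operator with graph `G`. -/
theorem exists_functional_of_graph {G : Submodule ℝ (X × Y)} {C : ℝ}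
    (hC : ∀ p ∈ G, ‖p.2‖ ≤ C * ‖p.1‖) {S : Submodule ℝ X} (hS : ∀ x ∈ S, ∃ y, (x, y) ∈ G)
    (l : Y →L[ℝ] ℝ) : ∃ L : S →L[ℝ] ℝ, ∀ x (hx : x ∈ S) y, (x, y) ∈ G → L ⟨x, hx⟩ = l y := by
  have hex : ∀ v : S, ∃ t, ((v : X), t) ∈ G := fun v => hS v v.2
  choose T hT using hex
  let L0 : S →ₗ[ℝ] ℝ :=
    { toFun := fun v => l (T v)
      map_add' := fun v w => by
        rw [← map_add]
        exact congrArg l (eq_of_mem_graph hC (hT _) (G.add_mem (hT v) (hT w)))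
      map_smul' := fun c v => by
        rw [← map_smul]
        exact congrArg l (eq_of_mem_graph hC (hT _) (G.smul_mem c (hT v))) }
  refine ⟨L0.mkContinuous (‖l‖ * C) fun v => ?_, fun v hv t ht => ?_⟩
  · calc ‖L0 v‖ ≤ ‖l‖ * ‖T v‖ := l.le_opNorm _
      _ ≤ ‖l‖ * (C * ‖(v : X)‖) := by gcongr; exact hC _ (hT v)
      _ = ‖l‖ * C * ‖v‖ := by rw [mul_assoc]; rfl
  · exact congrArg l (eq_of_mem_graph hC (hT _) ht)

end Graph

/-- The surface measure on `∂Ω`. -/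
def surf (Ω : Set (Vec d)) : Measure (Vec d) :=
  (Measure.euclideanHausdorffMeasure (d - 1) : Measure (Vec d)).restrict (frontier Ω)

/-- `L²(∂Ω)^d`. -/
def L2Bdry (Ω : Set (Vec d)) : Type := Lp (Vec d) 2 (surf Ω)

instance : NormedAddCommGroup (L2Bdry Ω) :=
  inferInstanceAs (NormedAddCommGroup (Lp (Vec d) 2 (surf Ω)))

instance : InnerProductSpace ℝ (L2Bdry Ω) :=
  inferInstanceAs (InnerProductSpace ℝ (Lp (Vec d) 2 (surf Ω)))

/-- The underlying element of `Lp`. -/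
def L2Bdry.asLp (t : L2Bdry Ω) : Lp (Vec d) 2 (surf Ω) := t

instance : CompleteSpace (L2Bdry Ω) := inferInstanceAs (CompleteSpace (Lp (Vec d) 2 (surf Ω)))

/-- Equivalence of the operator norm and the Frobenius norm. -/
theorem exists_enorm_matL_le (d : ℕ) : ∃ K : ℝ≥0∞, K ≠ ⊤ ∧
    (∀ A : Vec d →L[ℝ] Vec d, ‖matL d A‖ₑ ^ 2 ≤ K * ‖A‖ₑ ^ 2) ∧
    ∀ A : Vec d →L[ℝ] Vec d, ‖A‖ₑ ^ 2 ≤ K * ‖matL d A‖ₑ ^ 2 := by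
  set f : (Vec d →L[ℝ] Vec d) →L[ℝ] Mat d := (matL d : (Vec d →L[ℝ] Vec d) →L[ℝ] Mat d)
  set g : Mat d →L[ℝ] (Vec d →L[ℝ] Vec d) := ((matL d).symm : Mat d →L[ℝ] (Vec d →L[ℝ] Vec d))
  refine ⟨‖f‖ₑ ^ 2 + ‖g‖ₑ ^ 2, by finiteness, fun A => ?_, fun A => ?_⟩
  · calc ‖matL d A‖ₑ ^ 2 ≤ (‖f‖ₑ * ‖A‖ₑ) ^ 2 := by gcongr; exact f.le_opENorm A
      _ = ‖f‖ₑ ^ 2 * ‖A‖ₑ ^ 2 := mul_pow _ _ _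
      _ ≤ _ := by gcongr; exact le_self_add
  · have h : g (matL d A) = A := (matL d).symm_apply_apply A
    calc ‖A‖ₑ ^ 2 = ‖g (matL d A)‖ₑ ^ 2 := by rw [h]
      _ ≤ (‖g‖ₑ * ‖matL d A‖ₑ) ^ 2 := by gcongr; exact g.le_opENorm _
      _ = ‖g‖ₑ ^ 2 * ‖matL d A‖ₑ ^ 2 := mul_pow _ _ _
      _ ≤ _ := by gcongr; exact le_add_self

theorem enorm_sq_Disp (u : Disp Ω) :
    ‖u‖ₑ ^ 2 = ‖fieldL Ω u‖ₑ ^ 2 + ‖gradL Ω u‖ₑ ^ 2 := by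
  rw [← ofReal_norm u, ← ofReal_norm (fieldL Ω u), ← ofReal_norm (gradL Ω u),
    ← ENNReal.ofReal_pow (norm_nonneg _), ← ENNReal.ofReal_pow (norm_nonneg _),
    ← ENNReal.ofReal_pow (norm_nonneg _), ← ENNReal.ofReal_add (by positivity) (by positivity),
    norm_sq_Disp]

/-- The trace inequality in terms of the norm of `H¹(Ω)^d`. -/
theorem exists_eLpNorm_surf_le (hd : 1 ≤ d) (hΩo : IsOpen Ω) (hΩb : Bornology.IsBounded Ω)
    (hΩ : HasC11Boundary Ω) : ∃ C : NNReal, ∀ (φ : Vec d → Vec d) (hφ : ContDiff ℝ ∞ φ),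
      eLpNorm φ 2 (surf Ω) ≤ C * ‖smoothDisp hΩb hφ‖ₑ := by
  obtain ⟨c, hc, h⟩ := exists_trace_le hd hΩo hΩb hΩ
  obtain ⟨K, hK, -, hK2⟩ := exists_enorm_matL_le d
  have hfin : c * (1 + K) ≠ ⊤ := by finiteness
  refine ⟨NNReal.sqrt (c * (1 + K)).toNNReal, fun φ hφ => ?_⟩
  have h1 : eLpNorm φ 2 (surf Ω) ^ 2 ≤ (c * (1 + K)) * ‖smoothDisp hΩb hφ‖ₑ ^ 2 := by
    rw [eLpNorm_two_sq, enorm_sq_Disp, enorm_fieldL_smoothDisp, enorm_gradL_smoothDisp]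
    refine (h φ (hφ.of_le (by simp))).trans ?_
    rw [mul_assoc]
    gcongr
    rw [add_mul, one_mul]
    gcongr
    · exact le_self_add
    · refine le_trans ?_ (mul_le_mul' le_rfl le_add_self)
      rw [← lintegral_const_mul' _ _ hK]
      exact lintegral_mono fun x => hK2 _
  have h2 : ((NNReal.sqrt (c * (1 + K)).toNNReal : NNReal) : ℝ≥0∞) ^ 2 = c * (1 + K) := by
    rw [← ENNReal.coe_pow, NNReal.sq_sqrt, ENNReal.coe_toNNReal hfin]
  rw [← h2, ← mul_pow] at h1
  exact (ENNReal.pow_le_pow_left_iff two_ne_zero).1 h1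

/-- The class in `L²(∂Ω)` of the restriction of a smooth field. -/
def smoothBdry {φ : Vec d → Vec d} (h : MemLp φ 2 (surf Ω)) : L2Bdry Ω :=
  (h.toLp φ : Lp (Vec d) 2 (surf Ω))

/-- A bounded open set with boundary of class `C^{1,1}`. The dimension is required to be positive,
so that `d - 1` is the true dimension of the boundary. -/
structure IsDomain (Ω : Set (Vec d)) : Prop where
  one_le : 1 ≤ d
  isOpen : IsOpen Ω
  isBounded : Bornology.IsBounded Ω
  bdry : HasC11Boundary Ω

theorem IsDomain.memLp_surf (h : IsDomain Ω) {φ : Vec d → Vec d} (hφ : ContDiff ℝ ∞ φ) :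
    MemLp φ 2 (surf Ω) := by
  obtain ⟨C, hC⟩ := exists_eLpNorm_surf_le h.one_le h.isOpen h.isBounded h.bdry
  exact ⟨hφ.continuous.aestronglyMeasurable, (hC φ hφ).trans_lt (by finiteness)⟩

theorem disp_ext {u v : Disp Ω} (h1 : fieldL Ω u = fieldL Ω v) (h2 : gradL Ω u = gradL Ω v) :
    u = v := by
  have h : ‖u - v‖ ^ 2 = 0 := by
    rw [norm_sq_Disp, map_sub, map_sub, h1, h2, sub_self, sub_self, norm_zero, norm_zero]
    norm_num
  exact sub_eq_zero.1 (norm_eq_zero.1 ((pow_eq_zero_iff two_ne_zero).1 h))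

theorem classicalGradient_add {φ ψ : Vec d → Vec d} (hφ : ContDiff ℝ ∞ φ) (hψ : ContDiff ℝ ∞ ψ) :
    classicalGradient (fun x => φ x + ψ x) = classicalGradient φ + classicalGradient ψ := by
  funext x
  rw [Pi.add_apply, classicalGradient_eq, classicalGradient_eq, classicalGradient_eq, ← map_add]
  exact congrArg _ (fderiv_add (hφ.differentiable (by simp) x) (hψ.differentiable (by simp) x))

theorem classicalGradient_smul (c : ℝ) {φ : Vec d → Vec d} (hφ : ContDiff ℝ ∞ φ) :
    classicalGradient (fun x => c • φ x) = c • classicalGradient φ := by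
  funext x
  rw [Pi.smul_apply, classicalGradient_eq, classicalGradient_eq, ← map_smul]
  exact congrArg _ (fderiv_fun_const_smul (hφ.differentiable (by simp) x) c)

theorem smoothDisp_add (hΩb : Bornology.IsBounded Ω) {φ ψ : Vec d → Vec d}
    (hφ : ContDiff ℝ ∞ φ) (hψ : ContDiff ℝ ∞ ψ) (h : ContDiff ℝ ∞ fun x => φ x + ψ x) :
    smoothDisp hΩb h = smoothDisp hΩb hφ + smoothDisp hΩb hψ := by
  have m1 := memLp_of_continuous (p := 2) hΩb (continuous_classicalGradient hφ)
  have m2 := memLp_of_continuous (p := 2) hΩb (continuous_classicalGradient hψ)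
  have m3 := memLp_of_continuous (p := 2) hΩb (continuous_classicalGradient h)
  refine disp_ext ?_ ?_
  · rw [map_add]
    exact (MemLp.toLp_add (memLp_of_continuous hΩb hφ.continuous)
      (memLp_of_continuous hΩb hψ.continuous))
  · rw [map_add]
    refine Eq.trans (?_ : m3.toLp _ = (m1.add m2).toLp _) (MemLp.toLp_add m1 m2)
    exact MemLp.toLp_congr _ _ (Eventually.of_forall fun x =>
      congrFun (classicalGradient_add hφ hψ) x)

theorem smoothDisp_smul (hΩb : Bornology.IsBounded Ω) (c : ℝ) {φ : Vec d → Vec d}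
    (hφ : ContDiff ℝ ∞ φ) (h : ContDiff ℝ ∞ fun x => c • φ x) :
    smoothDisp hΩb h = c • smoothDisp hΩb hφ := by
  have m1 := memLp_of_continuous (p := 2) hΩb (continuous_classicalGradient hφ)
  have m3 := memLp_of_continuous (p := 2) hΩb (continuous_classicalGradient h)
  refine disp_ext ?_ ?_
  · rw [map_smul]
    exact (MemLp.toLp_const_smul c (memLp_of_continuous hΩb hφ.continuous))
  · rw [map_smul]
    refine Eq.trans (?_ : m3.toLp _ = (m1.const_smul c).toLp _) (MemLp.toLp_const_smul c m1)
    exact MemLp.toLp_congr _ _ (Eventually.of_forall fun x =>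
      congrFun (classicalGradient_smul c hφ) x)

/-- The pairs of a smooth field, as an element of `H¹(Ω)^d`, and its restriction to the boundary. -/
def smoothGraph (h : IsDomain Ω) : Submodule ℝ (Disp Ω × L2Bdry Ω) where
  carrier := {p | ∃ (φ : Vec d → Vec d) (hφ : ContDiff ℝ ∞ φ),
    p = (smoothDisp h.isBounded hφ, smoothBdry (h.memLp_surf hφ))}
  add_mem' := by
    rintro _ _ ⟨φ, hφ, rfl⟩ ⟨ψ, hψ, rfl⟩
    have hadd : ContDiff ℝ ∞ fun x => φ x + ψ x := hφ.add hψ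
    refine ⟨fun x => φ x + ψ x, hadd, Prod.ext (smoothDisp_add h.isBounded hφ hψ hadd).symm ?_⟩
    exact (MemLp.toLp_add (h.memLp_surf hφ) (h.memLp_surf hψ)).symm
  zero_mem' := by
    have h0 : ContDiff ℝ ∞ fun x : Vec d => (0 : ℝ) • (0 : Vec d) := contDiff_const
    refine ⟨fun _ => (0 : ℝ) • (0 : Vec d), h0, Prod.ext ?_ ?_⟩
    · exact (zero_smul ℝ _).symm.trans (smoothDisp_smul h.isBounded 0 contDiff_const h0).symm
    · exact (zero_smul ℝ _).symm.trans
        (MemLp.toLp_const_smul (0 : ℝ) (h.memLp_surf contDiff_const)).symm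
  smul_mem' := by
    rintro c _ ⟨φ, hφ, rfl⟩
    have hsmul : ContDiff ℝ ∞ fun x => c • φ x := hφ.const_smul c
    refine ⟨fun x => c • φ x, hsmul, Prod.ext (smoothDisp_smul h.isBounded c hφ hsmul).symm ?_⟩
    exact (MemLp.toLp_const_smul c (h.memLp_surf hφ)).symm

/-- The graph of the trace operator. The domain of this operator is the closure of the smooth fields
in `H¹(Ω)^d`. -/
def traceGraph (h : IsDomain Ω) : Submodule ℝ (Disp Ω × L2Bdry Ω) :=
  (smoothGraph h).topologicalClosure

/-- `IsTrace` is membership in the graph of the trace operator. -/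
theorem isTrace_iff_mem (h : IsDomain Ω) (u : Disp Ω) (t : L2Bdry Ω) :
    IsTrace (u : H1 Ω) (t : L2Surface (frontier Ω)) ↔ (u, t) ∈ traceGraph h := by
  have key : ∀ (φ : ℕ → Vec d → Vec d) (hφ : ∀ n, ContDiff ℝ ∞ (φ n)),
      Tendsto (fun n => smoothBdry (h.memLp_surf (hφ n))) atTop (𝓝 t) ↔
      Tendsto (fun n => eLpNorm (fun x => φ n x - t.asLp x) 2 (surf Ω))
        atTop (𝓝 0) := by
    intro φ hφ
    refine (Lp.tendsto_Lp_iff_tendsto_eLpNorm'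
      (fun n => ((h.memLp_surf (hφ n)).toLp (φ n) : Lp (Vec d) 2 (surf Ω)))
      t.asLp).trans ?_
    refine tendsto_congr fun n => eLpNorm_congr_ae ?_
    filter_upwards [(h.memLp_surf (hφ n)).coeFn_toLp] with x hx
    rw [Pi.sub_apply, hx]
  refine (isTrace_iff h.isBounded).trans ?_
  rw [traceGraph, ← SetLike.mem_coe, Submodule.topologicalClosure_coe, mem_closure_iff_seq_limit]
  constructor
  · rintro ⟨φ, hφ, h1, h2⟩
    exact ⟨fun n => (smoothDisp h.isBounded (hφ n), smoothBdry (h.memLp_surf (hφ n))),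
      fun n => ⟨φ n, hφ n, rfl⟩, h1.prodMk_nhds ((key φ hφ).2 h2)⟩
  · rintro ⟨p, hp, hlim⟩
    choose φ hφ hp using hp
    obtain rfl : p = fun n => (smoothDisp h.isBounded (hφ n), smoothBdry (h.memLp_surf (hφ n))) :=
      funext hp
    rw [Prod.tendsto_iff] at hlim
    exact ⟨φ, hφ, hlim.1, (key φ hφ).1 hlim.2⟩

/-- The trace operator is bounded. -/
theorem exists_norm_le_of_mem_traceGraph (h : IsDomain Ω) :
    ∃ C : ℝ, 0 ≤ C ∧ ∀ p ∈ traceGraph h, ‖p.2‖ ≤ C * ‖p.1‖ := by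
  obtain ⟨C, hC⟩ := exists_eLpNorm_surf_le h.one_le h.isOpen h.isBounded h.bdry
  refine ⟨C, C.2, fun p hp => ?_⟩
  have hcl : IsClosed {p : Disp Ω × L2Bdry Ω | ‖p.2‖ ≤ C * ‖p.1‖} :=
    isClosed_le (by fun_prop) (by fun_prop)
  refine closure_minimal ?_ hcl hp
  rintro _ ⟨φ, hφ, rfl⟩
  have h1 : ‖smoothBdry (h.memLp_surf hφ)‖ₑ ≤ C * ‖smoothDisp h.isBounded hφ‖ₑ := by
    refine le_trans (le_of_eq ?_) (hC φ hφ)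
    exact Lp.enorm_toLp (h.memLp_surf hφ)
  have h2 : (‖smoothBdry (h.memLp_surf hφ)‖₊ : ℝ≥0∞)
      ≤ (C * ‖smoothDisp h.isBounded hφ‖₊ : NNReal) := by
    rw [ENNReal.coe_mul]; exact h1
  exact_mod_cast h2

/-- The elements of `L²(∂Ω)^d` that vanish on `Γ`. -/
def vanishOn (Ω Γ : Set (Vec d)) : Submodule ℝ (L2Bdry Ω) :=
  (LpToLpRestrictCLM (Vec d) (Vec d) ℝ (surf Ω) 2 Γ).ker

theorem isClosed_vanishOn (Γ : Set (Vec d)) : IsClosed (vanishOn Ω Γ : Set (L2Bdry Ω)) :=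
  (LpToLpRestrictCLM (Vec d) (Vec d) ℝ (surf Ω) 2 Γ).isClosed_ker

theorem IsOpenInBoundary.subset {Γ : Set (Vec d)} (hΓ : IsOpenInBoundary Ω Γ) :
    Γ ⊆ frontier Ω := by
  obtain ⟨U, -, rfl⟩ := hΓ
  exact Set.inter_subset_right

theorem IsOpenInBoundary.measurableSet {Γ : Set (Vec d)} (hΓ : IsOpenInBoundary Ω Γ) :
    MeasurableSet Γ := by
  obtain ⟨U, hU, rfl⟩ := hΓ
  exact hU.measurableSet.inter isClosed_frontier.measurableSet

theorem surf_restrict {Γ : Set (Vec d)} (hΓ : IsOpenInBoundary Ω Γ) :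
    (surf Ω).restrict Γ
      = (Measure.euclideanHausdorffMeasure (d - 1) : Measure (Vec d)).restrict Γ := by
  rw [surf, Measure.restrict_restrict hΓ.measurableSet, Set.inter_eq_left.2 hΓ.subset]

theorem mem_vanishOn {Γ : Set (Vec d)} (hΓ : IsOpenInBoundary Ω Γ) (t : L2Bdry Ω) :
    t ∈ vanishOn Ω Γ ↔
      ∀ᵐ x ∂(Measure.euclideanHausdorffMeasure (d - 1) : Measure (Vec d)).restrict Γ,
        t.asLp x = 0 := by
  have h1 := LpToLpRestrictCLM_coeFn ℝ Γ t.asLp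
  rw [← surf_restrict hΓ]
  have h0 : t ∈ vanishOn Ω Γ ↔ LpToLpRestrictCLM (Vec d) (Vec d) ℝ (surf Ω) 2 Γ t.asLp = 0 :=
    Iff.rfl
  refine h0.trans (Lp.eq_zero_iff_ae_eq_zero.trans ?_)
  constructor
  · intro h2
    filter_upwards [h1, h2] with x h3 h4
    rw [← h3, h4]; rfl
  · intro h2
    filter_upwards [h1, h2] with x h3 h4
    rw [h3, h4]; rfl

/-- The fields with a trace that vanishes on `Γ`. -/
def dispVanish (h : IsDomain Ω) (Γ : Set (Vec d)) : Submodule ℝ (Disp Ω) :=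
  graphPreimage (traceGraph h) (vanishOn Ω Γ)

theorem mem_dispVanish_iff (h : IsDomain Ω) {Γ : Set (Vec d)} (hΓ : IsOpenInBoundary Ω Γ)
    (u : Disp Ω) : u ∈ dispVanish h Γ ↔ TraceEqOn (u : H1 Ω) Γ 0 := by
  refine mem_graphPreimage.trans ?_
  constructor
  · rintro ⟨t, h1, h2⟩
    exact ⟨t, (isTrace_iff_mem h u t).2 h2, (mem_vanishOn hΓ t).1 h1⟩
  · rintro ⟨t, h1, h2⟩
    exact ⟨t, (mem_vanishOn hΓ t).2 h2, (isTrace_iff_mem h u t).1 h1⟩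

theorem isClosed_dispVanish (h : IsDomain Ω) (Γ : Set (Vec d)) :
    IsClosed (dispVanish h Γ : Set (Disp Ω)) := by
  obtain ⟨C, -, hC⟩ := exists_norm_le_of_mem_traceGraph h
  exact isClosed_graphPreimage (smoothGraph h).isClosed_topologicalClosure (isClosed_vanishOn Γ) hC

/-- The boundary load `t ↦ ∫_{Γ_N} g · t`. -/
theorem exists_boundary_load {ΓN : Set (Vec d)} (hΓN : IsOpenInBoundary Ω ΓN)
    {g : Vec d → Vec d} (hg : MemLp g 2
      ((Measure.euclideanHausdorffMeasure (d - 1) : Measure (Vec d)).restrict ΓN)) :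
    ∃ l : L2Bdry Ω →L[ℝ] ℝ, ∀ t : L2Bdry Ω,
      l t = ∫ x in ΓN, ⟪g x, t.asLp x⟫_ℝ
        ∂(Measure.euclideanHausdorffMeasure (d - 1) : Measure (Vec d)) := by
  rw [← surf_restrict hΓN] at hg ⊢
  rw [← memLp_indicator_iff_restrict hΓN.measurableSet] at hg
  refine ⟨innerForm (L2Bdry Ω) (hg.toLp _ : Lp (Vec d) 2 (surf Ω)), fun t => ?_⟩
  rw [← integral_indicator hΓN.measurableSet]
  refine (MeasureTheory.L2.inner_def (hg.toLp _ : Lp (Vec d) 2 (surf Ω)) t.asLp).trans ?_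
  refine integral_congr_ae ?_
  filter_upwards [hg.coeFn_toLp] with x hx
  rw [hx]
  by_cases hxN : x ∈ ΓN
  · simp [hxN]
  · simp [hxN]

/-- The boundary load as a bounded functional of the displacement. -/
theorem exists_load (h : IsDomain Ω) (ΓD : Set (Vec d)) {ΓN : Set (Vec d)}
    (hΓN : IsOpenInBoundary Ω ΓN) (g : L2Surface ΓN) : ∃ L : dispVanish h ΓD →L[ℝ] ℝ,
      ∀ (v : Disp Ω) (hv : v ∈ dispVanish h ΓD) (t : L2Surface (frontier Ω)),
        IsTrace (v : H1 Ω) t → L ⟨v, hv⟩ = ∫ x in ΓN, ⟪g x, t x⟫_ℝ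
          ∂(Measure.euclideanHausdorffMeasure (d - 1) : Measure (Vec d)) := by
  obtain ⟨C, -, hC⟩ := exists_norm_le_of_mem_traceGraph h
  obtain ⟨l, hl⟩ := exists_boundary_load hΓN (Lp.memLp g)
  obtain ⟨L, hL⟩ := exists_functional_of_graph hC (S := dispVanish h ΓD)
    (fun x hx => let ⟨y, _, hy⟩ := mem_graphPreimage.1 hx; ⟨y, hy⟩) l
  exact ⟨L, fun v hv t ht => (hL v hv t ((isTrace_iff_mem h v t).1 ht)).trans (hl t)⟩

/-! ### Korn's first inequality -/

/-- Two integrations by parts exchange the directions of differentiation. One derivative is replaced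
by a difference quotient, as second derivatives need not exist. -/
theorem integral_lineDeriv_mul_lineDeriv_comm {E : Type*} [NormedAddCommGroup E] [NormedSpace ℝ E]
    [FiniteDimensional ℝ E] [MeasurableSpace E] [BorelSpace E] {μ : Measure E}
    [μ.IsAddHaarMeasure] {f g : E → ℝ} {C D : NNReal} (hf : LipschitzWith C f)
    (hfc : HasCompactSupport f) (hg : LipschitzWith D g) (hgc : HasCompactSupport g) (a b : E) :
    ∫ x, lineDeriv ℝ f x a * lineDeriv ℝ g x b ∂μ
      = ∫ x, lineDeriv ℝ f x b * lineDeriv ℝ g x a ∂μ := by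
  have hint : ∀ {h : E → ℝ} {K : NNReal} (_ : LipschitzWith K h) (_ : HasCompactSupport h) (v : E),
      Integrable (fun x => lineDeriv ℝ h x v) μ := by
    intro h K hh hhc v
    have hsupp : HasCompactSupport fun x => lineDeriv ℝ h x v :=
      hhc.mono' (fun x hx => by
        by_contra hx'
        have h0 : h =ᶠ[𝓝 x] fun _ => 0 := notMem_tsupport_iff_eventuallyEq.1 hx'
        apply hx
        exact (h0.lineDeriv_eq (𝕜 := ℝ) (v := v)).trans (by simp [lineDeriv]))
    have h1 : IntegrableOn (fun x => lineDeriv ℝ h x v) (tsupport fun x => lineDeriv ℝ h x v) μ :=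
      (hh.locallyIntegrable_lineDeriv v).integrableOn_isCompact hsupp
    exact (integrableOn_iff_integrable_of_support_subset (subset_tsupport _)).1 h1
  -- the difference quotients of `g` in direction `b`, tested with `∂_a f`
  have h1 := hg.integral_inv_smul_sub_mul_tendsto_integral_lineDeriv_mul (hint hf hfc a) b
  have h2 := hf.integral_inv_smul_sub_mul_tendsto_integral_lineDeriv_mul (hint hg hgc (-a)) (-b)
  have key : ∀ t : ℝ, ∫ x, (t⁻¹ • (g (x + t • b) - g x)) * lineDeriv ℝ f x a ∂μ
      = ∫ x, (t⁻¹ • (f (x + t • -b) - f x)) * lineDeriv ℝ g x (-a) ∂μ := by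
    intro t
    have hgt : LipschitzWith D fun x => g (x + t • b) := by
      refine LipschitzWith.of_dist_le_mul fun x y => ?_
      simpa using hg.dist_le_mul (x + t • b) (y + t • b)
    have hgtc : HasCompactSupport fun x => g (x + t • b) :=
      hgc.comp_homeomorph (Homeomorph.addRight (t • b))
    have e1 := hf.integral_lineDeriv_mul_eq (μ := μ) hgt hgtc a
    have e2 := hf.integral_lineDeriv_mul_eq (μ := μ) hg hgc a
    have i1 : Integrable (fun x => lineDeriv ℝ f x a * g (x + t • b)) μ := by
      have hc : ∃ M, ∀ x, ‖g (x + t • b)‖ ≤ M := hgtc.exists_bound_of_continuous hgt.continuous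
      obtain ⟨M, hM⟩ := hc
      exact (hint hf hfc a).mul_bdd hgt.continuous.aestronglyMeasurable (.of_forall hM)
    have i2 : Integrable (fun x => lineDeriv ℝ f x a * g x) μ := by
      obtain ⟨M, hM⟩ := hgc.exists_bound_of_continuous hg.continuous
      exact (hint hf hfc a).mul_bdd hg.continuous.aestronglyMeasurable (.of_forall hM)
    obtain ⟨M, hM⟩ := hfc.exists_bound_of_continuous hf.continuous
    have i3 : Integrable (fun x => lineDeriv ℝ g x (-a) * f (x + t • -b)) μ :=
      (hint hg hgc (-a)).mul_bdd
        (hf.continuous.comp (continuous_add_const (t • -b))).aestronglyMeasurable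
        (.of_forall fun x => hM _)
    have i4 : Integrable (fun x => lineDeriv ℝ g x (-a) * f x) μ :=
      (hint hg hgc (-a)).mul_bdd hf.continuous.aestronglyMeasurable (.of_forall hM)
    have e3 : ∫ x, lineDeriv ℝ (fun x => g (x + t • b)) x (-a) * f x ∂μ
        = ∫ x, lineDeriv ℝ g x (-a) * f (x + t • -b) ∂μ := by
      rw [← integral_add_right_eq_self (fun x => lineDeriv ℝ g x (-a) * f (x + t • -b)) (t • b)]
      refine integral_congr_ae (.of_forall fun x => ?_)
      have hx : x + t • b + t • -b = x := by rw [smul_neg]; abel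
      have hl : lineDeriv ℝ (fun x => g (x + t • b)) x (-a) = lineDeriv ℝ g (x + t • b) (-a) := by
        refine congrArg (fun F : ℝ → ℝ => deriv F 0) (funext fun s => congrArg g ?_)
        abel
      simp only [hx, hl]
    calc ∫ x, (t⁻¹ • (g (x + t • b) - g x)) * lineDeriv ℝ f x a ∂μ
        = t⁻¹ * ∫ x, (lineDeriv ℝ f x a * g (x + t • b) - lineDeriv ℝ f x a * g x) ∂μ := by
          rw [← integral_const_mul]
          exact integral_congr_ae (.of_forall fun x => by simp only [smul_eq_mul]; ring)
      _ = t⁻¹ * ∫ x, (lineDeriv ℝ g x (-a) * f (x + t • -b) - lineDeriv ℝ g x (-a) * f x) ∂μ := by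
          rw [integral_sub i1 i2, integral_sub i3 i4, e1, e2, e3]
      _ = _ := by
          rw [← integral_const_mul]
          exact integral_congr_ae (.of_forall fun x => by simp only [smul_eq_mul]; ring)
  have h3 := tendsto_nhds_unique h1 (h2.congr fun t => (key t).symm)
  calc ∫ x, lineDeriv ℝ f x a * lineDeriv ℝ g x b ∂μ
      = ∫ x, lineDeriv ℝ g x b * lineDeriv ℝ f x a ∂μ := by simp only [mul_comm]
    _ = ∫ x, lineDeriv ℝ f x (-b) * lineDeriv ℝ g x (-a) ∂μ := h3
    _ = _ := by simp only [lineDeriv_neg, neg_mul_neg]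

/-- Korn's first inequality: for compactly supported fields, the antisymmetric part of the gradient
is controlled by the symmetric one, as `∫ ∑ ∂_j v_i ∂_i v_j = ∫ (div v)² ≥ 0`. -/
theorem lintegral_enorm_fderiv_le {v : Vec d → Vec d} {C : NNReal} (hv : LipschitzWith C v)
    (hvc : HasCompactSupport v) :
    ∫⁻ x, ‖matL d (fderiv ℝ v x)‖ₑ ^ 2 ≤ ∫⁻ x, ‖matL d (symOp (fderiv ℝ v x))‖ₑ ^ 2 := by
  set e : Fin d → Vec d := fun j => EuclideanSpace.single j 1
  have hvi : ∀ i, LipschitzWith C fun x => v x i := fun i => by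
    refine LipschitzWith.of_dist_le_mul fun x y => ?_
    rw [Real.dist_eq, ← PiLp.sub_apply, ← Real.norm_eq_abs]
    exact (PiLp.norm_apply_le _ i).trans
      ((dist_eq_norm (v x) (v y)).symm.le.trans (hv.dist_le_mul x y))
  have hvic : ∀ i, HasCompactSupport fun x => v x i := fun i =>
    hvc.comp_left (g := fun y : Vec d => y i) rfl
  set D : Fin d → Fin d → Vec d → ℝ := fun i j x => lineDeriv ℝ (fun x => v x i) x (e j)
  have hD : ∀ᵐ x, ∀ i j, fderiv ℝ v x (e j) i = D i j x := by
    filter_upwards [hv.ae_differentiableAt] with x hx i j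
    have h1 : HasFDerivAt (fun x => v x i) ((EuclideanSpace.proj i : Vec d →L[ℝ] ℝ).comp
      (fderiv ℝ v x)) x := (EuclideanSpace.proj i : Vec d →L[ℝ] ℝ).hasFDerivAt.comp x hx.hasFDerivAt
    exact (h1.hasLineDerivAt (e j)).lineDeriv.symm
  have hb : ∀ i j x, ‖D i j x‖ ≤ C * ‖e j‖ := fun i j x =>
    norm_lineDeriv_le_of_lipschitz ℝ (hvi i)
  have hm : ∀ i j, AEStronglyMeasurable (D i j) volume := fun i j =>
    (aestronglyMeasurable_lineDeriv (hvi i).continuous _)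
  have hint : ∀ i j, Integrable (D i j) volume := by
    intro i j
    have hsupp : Function.support (D i j) ⊆ tsupport fun x => v x i := fun x hx => by
      by_contra hx'
      have h0 : (fun x => v x i) =ᶠ[𝓝 x] fun _ => 0 := notMem_tsupport_iff_eventuallyEq.1 hx'
      exact hx ((h0.lineDeriv_eq (𝕜 := ℝ) (v := e j)).trans (by simp [lineDeriv]))
    exact (integrableOn_iff_integrable_of_support_subset hsupp).1
      (((hvi i).locallyIntegrable_lineDeriv (e j)).integrableOn_isCompact (hvic i))
  have hint2 : ∀ i j k l, Integrable (fun x => D i j x * D k l x) volume := fun i j k l =>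
    (hint i j).mul_bdd (hm k l) (.of_forall (hb k l))
  have hcomm : ∀ i j, ∫ x, D i j x * D j i x = ∫ x, D i i x * D j j x := fun i j =>
    integral_lineDeriv_mul_lineDeriv_comm (hvi i) (hvic i) (hvi j) (hvic j) _ _
  -- the sum of the mixed terms is the integral of the square of the divergence
  have hdiv : 0 ≤ ∑ i, ∑ j, ∫ x, D i j x * D j i x := by
    refine le_of_le_of_eq ?_
      (Finset.sum_congr rfl fun i _ => Finset.sum_congr rfl fun j _ => (hcomm i j).symm)
    have h1 : ∑ i, ∑ j, ∫ x, D i i x * D j j x = ∫ x, (∑ i, D i i x) ^ 2 := by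
      rw [eq_comm]
      simp only [pow_two, Finset.sum_mul_sum]
      rw [integral_finsetSum _ fun i _ => integrable_finsetSum _ fun j _ => hint2 _ _ _ _]
      exact Finset.sum_congr rfl fun i _ => integral_finsetSum _ fun j _ => hint2 _ _ _ _
    rw [h1]
    exact integral_nonneg fun x => sq_nonneg _
  have hsq : ∀ A : Mat d, ‖A‖ₑ ^ 2 = ENNReal.ofReal (∑ i, ∑ j, A (i, j) ^ 2) := by
    intro A
    rw [← ofReal_norm, ← ENNReal.ofReal_pow (norm_nonneg _), EuclideanSpace.norm_sq_eq,
      Fintype.sum_prod_type]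
    simp
  have hL : ∫⁻ x, ‖matL d (fderiv ℝ v x)‖ₑ ^ 2
      = ENNReal.ofReal (∫ x, ∑ i, ∑ j, D i j x ^ 2) := by
    rw [ofReal_integral_eq_lintegral_ofReal]
    · refine lintegral_congr_ae ?_
      filter_upwards [hD] with x hx
      rw [hsq]
      simp only [matL_apply]
      simp only [e] at hx
      simp only [hx]
    · exact integrable_finsetSum _ fun i _ => integrable_finsetSum _ fun j _ => by
        simpa only [pow_two] using hint2 i j i j
    · exact .of_forall fun x => Finset.sum_nonneg fun i _ =>
        Finset.sum_nonneg fun j _ => sq_nonneg _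
  have hR : ∫⁻ x, ‖matL d (symOp (fderiv ℝ v x))‖ₑ ^ 2
      = ENNReal.ofReal (∫ x, ∑ i, ∑ j, (D i j x + D j i x) ^ 2) := by
    rw [ofReal_integral_eq_lintegral_ofReal]
    · refine lintegral_congr_ae ?_
      filter_upwards [hD] with x hx
      rw [hsq, ← symMap_matL]
      simp only [symMap_apply, matL_apply]
      simp only [e] at hx
      simp only [hx]
    · refine integrable_finsetSum _ fun i _ => integrable_finsetSum _ fun j _ => ?_
      have := ((hint2 i j i j).add ((hint2 i j j i).const_mul 2)).add (hint2 j i j i)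
      refine this.congr (.of_forall fun x => ?_)
      simp only [Pi.add_apply]
      ring
    · exact .of_forall fun x => Finset.sum_nonneg fun i _ =>
        Finset.sum_nonneg fun j _ => sq_nonneg _
  rw [hL, hR]
  refine ENNReal.ofReal_le_ofReal ?_
  have e1 : ∫ x, ∑ i, ∑ j, D i j x ^ 2 = ∑ i, ∑ j, ∫ x, D i j x * D i j x := by
    simp only [pow_two]
    rw [integral_finsetSum _ fun i _ => integrable_finsetSum _ fun j _ => hint2 _ _ _ _]
    exact Finset.sum_congr rfl fun i _ => integral_finsetSum _ fun j _ => hint2 _ _ _ _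
  have e2 : ∫ x, ∑ i, ∑ j, (D i j x + D j i x) ^ 2
      = ∑ i, ∑ j, ((∫ x, D i j x * D i j x) + 2 * (∫ x, D i j x * D j i x)
        + ∫ x, D j i x * D j i x) := by
    have h1 : ∀ i j x, (D i j x + D j i x) ^ 2
        = D i j x * D i j x + 2 * (D i j x * D j i x) + D j i x * D j i x := fun i j x => by ring
    simp only [h1]
    have h2 : ∀ i j, Integrable (fun x => D i j x * D i j x + 2 * (D i j x * D j i x)
        + D j i x * D j i x) volume := fun i j =>
      ((hint2 i j i j).add ((hint2 i j j i).const_mul 2)).add (hint2 j i j i)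
    rw [integral_finsetSum _ fun i _ => integrable_finsetSum _ fun j _ => h2 _ _]
    refine Finset.sum_congr rfl fun i _ => ?_
    rw [integral_finsetSum _ fun j _ => h2 _ _]
    refine Finset.sum_congr rfl fun j _ => ?_
    have h3 := (hint2 i j j i).const_mul 2
    refine (integral_add ((hint2 i j i j).add h3) (hint2 j i j i)).trans ?_
    refine congrArg (· + _) ((integral_add (hint2 i j i j) h3).trans ?_)
    rw [integral_const_mul]
  -- expand the square: twice the full gradient, plus twice the mixed terms, which are nonnegative
  have hp : 0 ≤ ∑ i, ∑ j, ∫ x, D i j x * D i j x := Finset.sum_nonneg fun i _ =>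
    Finset.sum_nonneg fun j _ => integral_nonneg fun x => mul_self_nonneg _
  have hp' : ∑ i, ∑ j, ∫ x, D j i x * D j i x = ∑ i, ∑ j, ∫ x, D i j x * D i j x :=
    Finset.sum_comm
  rw [e1, e2]
  simp only [Finset.sum_add_distrib, ← Finset.mul_sum]
  rw [hp']
  linarith

/-! ### Nitsche's extension across the boundary -/

theorem exists_lipschitzWith_of_hasCompactSupport {E F : Type*} [NormedAddCommGroup E]
    [NormedSpace ℝ E] [ProperSpace E] [NormedAddCommGroup F] {f : E → F}
    (hf : LocallyLipschitz f) (hfc : HasCompactSupport f) : ∃ K, LipschitzWith K f := by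
  obtain ⟨R, hR⟩ := hfc.isCompact.isBounded.subset_closedBall (0 : E)
  obtain ⟨K, hK⟩ := (hf.locallyLipschitzOn (s := Metric.closedBall 0 (R + 1))
    ).exists_lipschitzOnWith_of_compact
    (isCompact_closedBall _ _)
  obtain ⟨M, hM⟩ := hfc.exists_bound_of_continuous hf.continuous
  have hM0 : 0 ≤ M := (norm_nonneg _).trans (hM 0)
  have h0 : ∀ x, x ∉ Metric.closedBall (0 : E) R → f x = 0 := fun x hx =>
    image_eq_zero_of_notMem_tsupport fun h => hx (hR h)
  have hsub : Metric.closedBall (0 : E) R ⊆ Metric.closedBall 0 (R + 1) :=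
    Metric.closedBall_subset_closedBall (by linarith)
  have key : ∀ x y, x ∈ Metric.closedBall (0 : E) R → dist (f x) (f y) ≤ (K + M) * dist x y := by
    intro x y hx
    by_cases hy : y ∈ Metric.closedBall (0 : E) (R + 1)
    · refine (hK.dist_le_mul x (hsub hx) y hy).trans ?_
      gcongr
      linarith
    · rw [h0 y fun h => hy (hsub h), dist_zero_right]
      rw [mem_closedBall_zero_iff] at hx hy
      have h1 : 1 ≤ dist x y := by
        rw [dist_eq_norm, norm_sub_rev]
        have := norm_sub_norm_le y x
        linarith
      calc ‖f x‖ ≤ M * 1 := by rw [mul_one]; exact hM x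
        _ ≤ (K + M) * dist x y := by
          gcongr
          exact le_add_of_nonneg_left K.2
  refine ⟨K + ⟨M, hM0⟩, LipschitzWith.of_dist_le_mul fun x y => ?_⟩
  by_cases hx : x ∈ Metric.closedBall (0 : E) R
  · exact key x y hx
  by_cases hy : y ∈ Metric.closedBall (0 : E) R
  · rw [dist_comm, dist_comm x]
    exact key y x hy
  · rw [h0 x hx, h0 y hy, dist_self]
    positivity

theorem symOp_add (A B : Vec d →L[ℝ] Vec d) : symOp (A + B) = symOp A + symOp B := by
  rw [symOp, symOp, symOp, map_add]; abel

theorem symOp_sub (A B : Vec d →L[ℝ] Vec d) : symOp (A - B) = symOp A - symOp B := by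
  rw [symOp, symOp, symOp, map_sub]; abel

theorem symOp_smul (c : ℝ) (A : Vec d →L[ℝ] Vec d) : symOp (c • A) = c • symOp A := by
  rw [symOp, symOp, map_smulₛₗ, smul_add]; rfl

theorem symOp_zero : symOp (0 : Vec d →L[ℝ] Vec d) = 0 := by simp [symOp]

theorem norm_symOp_le (A : Vec d →L[ℝ] Vec d) : ‖symOp A‖ ≤ 2 * ‖A‖ := by
  refine (norm_add_le _ _).trans ?_
  rw [LinearIsometryEquiv.norm_map]
  linarith

/-- The symmetric part of the gradient of a one-form transforms as a bilinear form. -/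
theorem symOp_conj (A B : Vec d →L[ℝ] Vec d) :
    symOp ((ContinuousLinearMap.adjoint A).comp (B.comp A))
      = (ContinuousLinearMap.adjoint A).comp ((symOp B).comp A) := by
  simp only [symOp, ContinuousLinearMap.adjoint_comp, ContinuousLinearMap.adjoint_adjoint]
  ext x : 1
  simp

/-- `ρ` is a function with Lipschitz gradient `G` that decreases at unit speed in
direction `n`; near a boundary point, the depth below the boundary is of this kind. -/
structure IsDepth (n : Vec d) (ρ : Vec d → ℝ) (G : Vec d → Vec d) : Prop where
  hasFDerivAt : ∀ x, HasFDerivAt ρ (innerSL ℝ (G x)) x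
  lip : ∃ K, LipschitzWith K G
  add_smul : ∀ x (t : ℝ), ρ (x + t • n) = ρ x - t

/-- The shift by `a` times the depth, where this is positive. For `a > 1` it maps points of positive
depth to points of negative depth. -/
def shift (n : Vec d) (ρ : Vec d → ℝ) (a : ℝ) (x : Vec d) : Vec d := x + (a * max 0 (ρ x)) • n

/-- The derivative of `shift` where the depth is positive, at a point where `∇ρ = g`. -/
def shiftD (n : Vec d) (a : ℝ) (g : Vec d) : Vec d →L[ℝ] Vec d :=
  ContinuousLinearMap.id ℝ (Vec d) + a • (innerSL ℝ g).smulRight n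

/-- The pullback of the field `u`, as a one-form, under `shift`. -/
def pullback (n : Vec d) (ρ : Vec d → ℝ) (G : Vec d → Vec d) (u : Vec d → Vec d) (a : ℝ)
    (x : Vec d) : Vec d := u (shift n ρ a x) + (a * ⟪n, u (shift n ρ a x)⟫_ℝ) • G x

/-- Nitsche's reflection: a combination of two pullbacks that extends `u` from `ρ ≤ 0` across
`ρ = 0` continuously. A pullback of one-forms controls the symmetrized gradient of the extension by
that of `u`, up to terms of order zero.

On `ρ = 0` the pullback with factor `a` is `u + a ⟪n, u⟫ G`, so that the extension is continuous if
the weights of the factors `2` and `3` solve `w₂ + w₃ = 1` and `2 w₂ + 3 w₃ = 0`. -/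
def reflection (n : Vec d) (ρ : Vec d → ℝ) (G : Vec d → Vec d) (u : Vec d → Vec d) (x : Vec d) :
    Vec d := (3 : ℝ) • pullback n ρ G u 2 x - (2 : ℝ) • pullback n ρ G u 3 x

theorem shiftD_apply (n : Vec d) (a : ℝ) (g y : Vec d) :
    shiftD n a g y = y + (a * ⟪g, y⟫_ℝ) • n := by
  simp [shiftD, smul_smul]

theorem adjoint_shiftD_apply (n : Vec d) (a : ℝ) (g y : Vec d) :
    ContinuousLinearMap.adjoint (shiftD n a g) y = y + (a * ⟪n, y⟫_ℝ) • g := by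
  refine ext_inner_right ℝ fun z => ?_
  rw [ContinuousLinearMap.adjoint_inner_left, shiftD_apply, inner_add_left, inner_add_right,
    real_inner_smul_left, real_inner_smul_right, real_inner_comm y n]
  ring

theorem norm_shiftD_le {n : Vec d} (hn : ‖n‖ = 1) {a : ℝ} (ha : 0 ≤ a) (g : Vec d) :
    ‖shiftD n a g‖ ≤ 1 + a * ‖g‖ := by
  refine ContinuousLinearMap.opNorm_le_bound _ (by positivity) fun y => ?_
  rw [shiftD_apply]
  refine (norm_add_le _ _).trans ?_
  rw [norm_smul, hn, mul_one, norm_mul, Real.norm_of_nonneg ha, add_mul, one_mul, mul_assoc]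
  gcongr
  exact norm_inner_le_norm g y

theorem det_shiftD (n : Vec d) (a : ℝ) (g : Vec d) : (shiftD n a g).det = 1 + a * ⟪g, n⟫_ℝ := by
  have h : (shiftD n a g : Vec d →ₗ[ℝ] Vec d)
      = LinearMap.transvection ((a • innerSL ℝ g : Vec d →L[ℝ] ℝ) : Vec d →ₗ[ℝ] ℝ) n := by
    ext1 y
    simp [shiftD_apply, LinearMap.transvection]
  rw [ContinuousLinearMap.det, h, LinearMap.transvection.det]
  simp

namespace IsDepth

variable {n : Vec d} {ρ : Vec d → ℝ} {G : Vec d → Vec d}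

theorem continuous (h : IsDepth n ρ G) : Continuous ρ :=
  continuous_iff_continuousAt.2 fun x => (h.hasFDerivAt x).continuousAt

theorem contDiff (h : IsDepth n ρ G) : ContDiff ℝ 1 ρ := by
  obtain ⟨K, hK⟩ := h.lip
  refine contDiff_one_iff_hasFDerivAt.2 ⟨_, ?_, h.hasFDerivAt⟩
  exact (innerSL ℝ).continuous.comp hK.continuous

theorem inner_eq (h : IsDepth n ρ G) (x : Vec d) : ⟪G x, n⟫_ℝ = -1 := by
  have h1 : HasDerivAt (fun t : ℝ => ρ (x + t • n)) ⟪G x, n⟫_ℝ 0 := by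
    have h2 : HasDerivAt (fun t : ℝ => x + t • n) n 0 := by
      simpa using ((hasDerivAt_id (0 : ℝ)).smul_const n).const_add x
    have h3 : HasFDerivAt ρ (innerSL ℝ (G x)) (x + (0 : ℝ) • n) := by simpa using h.hasFDerivAt x
    exact h3.comp_hasDerivAt (0 : ℝ) h2
  have h4 : HasDerivAt (fun t : ℝ => ρ (x + t • n)) (-1) 0 := by
    simp only [h.add_smul]
    simpa using (hasDerivAt_id (0 : ℝ)).const_sub (ρ x)
  exact h1.unique h4

theorem shift_of_nonpos {a : ℝ} {x : Vec d} (hx : ρ x ≤ 0) : shift n ρ a x = x := by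
  simp [shift, max_eq_left hx]

theorem reflection_of_nonpos (u : Vec d → Vec d) {x : Vec d} (hx : ρ x ≤ 0) :
    reflection n ρ G u x = u x := by
  simp only [reflection, pullback, shift_of_nonpos hx]
  module

theorem locallyLipschitz_reflection (h : IsDepth n ρ G) {u : Vec d → Vec d}
    (hu : ContDiff ℝ 1 u) : LocallyLipschitz (reflection n ρ G u) := by
  obtain ⟨K, hK⟩ := h.lip
  have hS : ∀ a, LocallyLipschitz (shift n ρ a) := by
    intro a
    have h1 : ContDiff ℝ 1 fun p : Vec d × ℝ => p.1 + (a * p.2) • n := by fun_prop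
    have h2 : LocallyLipschitz fun x => (x, max 0 (ρ x)) :=
      LocallyLipschitz.id.prodMk (h.contDiff.locallyLipschitz.const_max 0)
    have h3 := h1.locallyLipschitz
    have h4 := LocallyLipschitz.comp h3 h2
    exact h4
  have h2 : ContDiff ℝ 1 fun p : (Vec d × Vec d) × Vec d =>
      (3 : ℝ) • (u p.1.1 + (2 * ⟪n, u p.1.1⟫_ℝ) • p.2)
        - (2 : ℝ) • (u p.1.2 + (3 * ⟪n, u p.1.2⟫_ℝ) • p.2) := by
    have e1 : ContDiff ℝ 1 fun p : (Vec d × Vec d) × Vec d => u p.1.1 := hu.comp (by fun_prop)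
    have e2 : ContDiff ℝ 1 fun p : (Vec d × Vec d) × Vec d => u p.1.2 := hu.comp (by fun_prop)
    have e3 : ContDiff ℝ 1 fun p : (Vec d × Vec d) × Vec d => ⟪n, u p.1.1⟫_ℝ :=
      contDiff_const.inner ℝ e1
    have e4 : ContDiff ℝ 1 fun p : (Vec d × Vec d) × Vec d => ⟪n, u p.1.2⟫_ℝ :=
      contDiff_const.inner ℝ e2
    fun_prop
  have h3 : LocallyLipschitz fun x => ((shift n ρ 2 x, shift n ρ 3 x), G x) :=
    ((hS 2).prodMk (hS 3)).prodMk hK.locallyLipschitz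
  have h4 := h2.locallyLipschitz
  have h5 := LocallyLipschitz.comp h4 h3
  exact h5

theorem apply_shift (h : IsDepth n ρ G) (a : ℝ) {x : Vec d} (hx : 0 ≤ ρ x) :
    ρ (shift n ρ a x) = (1 - a) * ρ x := by
  rw [shift, max_eq_right hx, h.add_smul]; ring

/-- The preimage of a compact set under `shift` is bounded. -/
theorem exists_isCompact_shift (h : IsDepth n ρ G) {a : ℝ} (ha : 2 ≤ a) {B : Set (Vec d)}
    (hB : IsCompact B) : ∃ B', IsCompact B' ∧ ∀ x, shift n ρ a x ∈ B → x ∈ B' := by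
  have hc : Continuous fun y => y - (a / (a - 1) * max 0 (-ρ y)) • n := by
    have := h.continuous
    fun_prop
  refine ⟨B ∪ (fun y => y - (a / (a - 1) * max 0 (-ρ y)) • n) '' B, hB.union (hB.image hc),
    fun x hx => ?_⟩
  by_cases hx0 : ρ x ≤ 0
  · rw [shift_of_nonpos hx0] at hx
    exact Or.inl hx
  · push Not at hx0
    refine Or.inr ⟨_, hx, ?_⟩
    have h1 : 0 < a - 1 := by linarith
    have h2 : max 0 (-ρ (shift n ρ a x)) = (a - 1) * ρ x := by
      rw [h.apply_shift a hx0.le, max_eq_right]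
      · ring
      · nlinarith
    simp only [h2]
    rw [shift, max_eq_right hx0.le, ← mul_assoc, div_mul_cancel₀ _ h1.ne']
    abel

theorem hasCompactSupport_reflection (h : IsDepth n ρ G) {u : Vec d → Vec d}
    (hu : HasCompactSupport u) : HasCompactSupport (reflection n ρ G u) := by
  obtain ⟨B₂, hB₂, h₂⟩ := h.exists_isCompact_shift (a := 2) le_rfl hu.isCompact
  obtain ⟨B₃, hB₃, h₃⟩ := h.exists_isCompact_shift (a := 3) (by norm_num) hu.isCompact
  refine HasCompactSupport.intro (hB₂.union hB₃) fun x hx => ?_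
  rw [Set.mem_union, not_or] at hx
  have e2 : u (shift n ρ 2 x) = 0 := image_eq_zero_of_notMem_tsupport fun hm => hx.1 (h₂ x hm)
  have e3 : u (shift n ρ 3 x) = 0 := image_eq_zero_of_notMem_tsupport fun hm => hx.2 (h₃ x hm)
  simp [reflection, pullback, e2, e3]

theorem hasFDerivAt_shift (h : IsDepth n ρ G) (a : ℝ) {x : Vec d} (hx : 0 < ρ x) :
    HasFDerivAt (shift n ρ a) (shiftD n a (G x)) x := by
  have h1 : HasFDerivAt (fun y => y + (a * ρ y) • n)
      (ContinuousLinearMap.id ℝ (Vec d) + (a • innerSL ℝ (G x)).smulRight n) x :=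
    (hasFDerivAt_id x).add (((h.hasFDerivAt x).const_mul a).smul_const n)
  have h2 : shift n ρ a =ᶠ[𝓝 x] fun y => y + (a * ρ y) • n := by
    filter_upwards [h.continuous.continuousAt.eventually (lt_mem_nhds hx)] with y hy
    rw [shift, max_eq_right hy.le]
  refine (h1.congr_of_eventuallyEq h2).congr_fderiv ?_
  ext y : 1
  simp [shiftD, smul_smul]

theorem hasFDerivAt_pullback (h : IsDepth n ρ G) {u : Vec d → Vec d} (hu : ContDiff ℝ 1 u)
    (a : ℝ) {x : Vec d} (hx : 0 < ρ x) {G' : Vec d →L[ℝ] Vec d} (hG : HasFDerivAt G G' x) :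
    HasFDerivAt (pullback n ρ G u a)
      ((ContinuousLinearMap.adjoint (shiftD n a (G x))).comp
        ((fderiv ℝ u (shift n ρ a x)).comp (shiftD n a (G x)))
        + (a * ⟪n, u (shift n ρ a x)⟫_ℝ) • G') x := by
  have h1 : HasFDerivAt (fun y => u (shift n ρ a y))
      ((fderiv ℝ u (shift n ρ a x)).comp (shiftD n a (G x))) x :=
    ((hu.differentiable (by simp)) _).hasFDerivAt.comp x (h.hasFDerivAt_shift a hx)
  have h2 : HasFDerivAt (fun y => a * ⟪n, u (shift n ρ a y)⟫_ℝ)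
      (a • (innerSL ℝ n).comp ((fderiv ℝ u (shift n ρ a x)).comp (shiftD n a (G x)))) x :=
    ((innerSL ℝ n).hasFDerivAt.comp x h1).const_mul a
  refine (h1.add (h2.smul hG)).congr_fderiv ?_
  ext y : 1
  simp only [add_apply, ContinuousLinearMap.comp_apply, smul_apply, adjoint_shiftD_apply,
    ContinuousLinearMap.smulRight_apply, innerSL_apply_apply, smul_eq_mul]
  abel

/-- The symmetrized gradient of a pullback is the pullback of the symmetrized gradient, up to a term
with `∇G` and no derivative of `u`. The bound `M` for `G` is needed only where the pullback does not
vanish. -/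
theorem norm_symOp_fderiv_pullback_le (h : IsDepth n ρ G) (hn : ‖n‖ = 1) {u : Vec d → Vec d}
    (hu : ContDiff ℝ 1 u) {a : ℝ} (ha : 0 ≤ a) {x : Vec d} (hx : 0 < ρ x)
    (hG : DifferentiableAt ℝ G x) {K : NNReal} (hK : LipschitzWith K G) {M : ℝ}
    (hM : shift n ρ a x ∈ tsupport u → ‖G x‖ ≤ M) :
    ‖symOp (fderiv ℝ (pullback n ρ G u a) x)‖
      ≤ (1 + a * M) ^ 2 * ‖symOp (fderiv ℝ u (shift n ρ a x))‖
        + 2 * a * K * ‖u (shift n ρ a x)‖ := by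
  rw [(h.hasFDerivAt_pullback hu a hx hG.hasFDerivAt).fderiv, symOp_add, symOp_conj, symOp_smul]
  by_cases hm : shift n ρ a x ∈ tsupport u
  · refine (norm_add_le _ _).trans (add_le_add ?_ ?_)
    · have hA : ‖shiftD n a (G x)‖ ≤ 1 + a * M :=
        (norm_shiftD_le hn ha _).trans (by gcongr; exact hM hm)
      have hA' : ‖ContinuousLinearMap.adjoint (shiftD n a (G x))‖ ≤ 1 + a * M := by
        rwa [LinearIsometryEquiv.norm_map]
      calc _ ≤ ‖ContinuousLinearMap.adjoint (shiftD n a (G x))‖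
            * (‖symOp (fderiv ℝ u (shift n ρ a x))‖ * ‖shiftD n a (G x)‖) :=
            (ContinuousLinearMap.opNorm_comp_le _ _).trans
              (mul_le_mul_of_nonneg_left (ContinuousLinearMap.opNorm_comp_le _ _) (norm_nonneg _))
        _ ≤ (1 + a * M) * (‖symOp (fderiv ℝ u (shift n ρ a x))‖ * (1 + a * M)) := by
            have : 0 ≤ 1 + a * M := (norm_nonneg _).trans hA
            gcongr
        _ = _ := by ring
    · rw [norm_smul, norm_mul, Real.norm_of_nonneg ha]
      have h1 : ‖⟪n, u (shift n ρ a x)⟫_ℝ‖ ≤ ‖u (shift n ρ a x)‖ := by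
        simpa [hn] using norm_inner_le_norm (𝕜 := ℝ) n (u (shift n ρ a x))
      have h2 : ‖symOp (fderiv ℝ G x)‖ ≤ 2 * K :=
        (norm_symOp_le _).trans (by gcongr; exact norm_fderiv_le_of_lipschitz ℝ hK)
      calc _ ≤ a * ‖u (shift n ρ a x)‖ * (2 * K) := by gcongr
        _ = _ := by ring
  · have e1 : u (shift n ρ a x) = 0 := image_eq_zero_of_notMem_tsupport hm
    have e2 : fderiv ℝ u (shift n ρ a x) = 0 := fderiv_of_notMem_tsupport ℝ hm
    simp [e1, e2, symOp_zero]

/-- For `a ≥ 2`, `shift` is injective on `ρ > 0`, with a Jacobian `a - 1 ≥ 1` in absolute value. -/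
theorem lintegral_comp_shift_le (h : IsDepth n ρ G) {a : ℝ} (ha : 2 ≤ a) (F : Vec d → ℝ≥0∞) :
    ∫⁻ x in {x | 0 < ρ x}, F (shift n ρ a x) ≤ ∫⁻ x in {x | ρ x < 0}, F x := by
  have hs : MeasurableSet {x | 0 < ρ x} := (isOpen_lt continuous_const h.continuous).measurableSet
  have hinj : Set.InjOn (shift n ρ a) {x | 0 < ρ x} := by
    intro x hx y hy hxy
    have h1 : ρ x = ρ y := by
      have := congrArg ρ hxy
      rw [h.apply_shift a (le_of_lt hx), h.apply_shift a (le_of_lt hy)] at this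
      exact mul_left_cancel₀ (by linarith) this
    simpa [shift, h1] using hxy
  have h1 := lintegral_image_eq_lintegral_abs_det_fderiv_mul volume hs
    (fun x hx => (h.hasFDerivAt_shift a hx).hasFDerivWithinAt) hinj F
  calc ∫⁻ x in {x | 0 < ρ x}, F (shift n ρ a x)
      ≤ ∫⁻ x in {x | 0 < ρ x}, ENNReal.ofReal |(shiftD n a (G x)).det| * F (shift n ρ a x) := by
        refine lintegral_mono fun x => ?_
        rw [det_shiftD, h.inner_eq, abs_of_nonpos (by linarith)]
        refine le_mul_of_one_le_left zero_le ?_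
        rw [ENNReal.one_le_ofReal]
        linarith
    _ = ∫⁻ x in shift n ρ a '' {x | 0 < ρ x}, F x := h1.symm
    _ ≤ _ := by
        refine lintegral_mono_set ?_
        rintro _ ⟨x, hx, rfl⟩
        have hx' : 0 < ρ x := hx
        show ρ (shift n ρ a x) < 0
        rw [h.apply_shift a hx'.le]
        nlinarith

/-- The translates of `ρ = 0` in direction `n` are disjoint. -/
theorem volume_eq_zero (h : IsDepth n ρ G) : volume {x | ρ x = 0} = 0 := by
  refine Measure.addHaar_eq_zero_of_disjoint_translates volume
    (fun k : ℕ => (1 / ((k : ℝ) + 1)) • n) ?_ ?_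
    (isClosed_eq h.continuous continuous_const).measurableSet
  · refine (isBounded_iff_forall_norm_le).2 ⟨‖n‖, ?_⟩
    rintro _ ⟨k, rfl⟩
    rw [norm_smul]
    refine mul_le_of_le_one_left (norm_nonneg _) ?_
    rw [Real.norm_of_nonneg (by positivity)]
    exact div_le_one_of_le₀ (by linarith [Nat.cast_nonneg (α := ℝ) k]) (by positivity)
  · intro k l hkl
    refine Set.disjoint_left.2 fun x hx hx' => hkl ?_
    simp only [Set.singleton_add, Set.image_add_left, Set.mem_preimage, Set.mem_ofPred_eq] at hx hx'
    rw [add_comm, ← neg_smul, h.add_smul] at hx hx'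
    have h1 : 1 / ((k : ℝ) + 1) = 1 / ((l : ℝ) + 1) := by linarith
    have h2 : (k : ℝ) + 1 = (l : ℝ) + 1 := by
      have := congrArg (1 / ·) h1
      simpa using this
    exact_mod_cast add_right_cancel h2

/-- Fields with support in a fixed compact set extend from `ρ ≤ 0` across `ρ = 0`, with a bound for
the symmetrized gradient that involves no other part of the gradient. -/
theorem exists_extension (h : IsDepth n ρ G) (hn : ‖n‖ = 1) {B : Set (Vec d)} (hB : IsCompact B) :
    ∃ C : ℝ≥0∞, C ≠ ⊤ ∧ ∀ u : Vec d → Vec d, ContDiff ℝ 1 u → tsupport u ⊆ B →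
      ∃ v : Vec d → Vec d, (∃ K, LipschitzWith K v) ∧ HasCompactSupport v ∧
        (∀ x, ρ x ≤ 0 → v x = u x) ∧
        ∫⁻ x, ‖symOp (fderiv ℝ v x)‖ₑ ^ 2
          ≤ C * ∫⁻ x in {x | ρ x < 0}, (‖symOp (fderiv ℝ u x)‖ₑ ^ 2 + ‖u x‖ₑ ^ 2) := by
  obtain ⟨K, hK⟩ := h.lip
  obtain ⟨B₂, hB₂, h₂⟩ := h.exists_isCompact_shift (a := 2) le_rfl hB
  obtain ⟨B₃, hB₃, h₃⟩ := h.exists_isCompact_shift (a := 3) (by norm_num) hB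
  obtain ⟨M, hM⟩ := (hB₂.union hB₃).exists_bound_of_continuousOn hK.continuous.continuousOn
  -- one constant for all the coefficients that occur
  obtain ⟨N, hN0, hN2, hN3, hN4⟩ : ∃ N : ℝ, 0 ≤ N ∧ 3 * (1 + 2 * M) ^ 2 ≤ N ∧
      2 * (1 + 3 * M) ^ 2 ≤ N ∧ 12 * (K : ℝ) ≤ N :=
    ⟨3 * (1 + 2 * M) ^ 2 + 2 * (1 + 3 * M) ^ 2 + 12 * K, by positivity,
      by nlinarith [sq_nonneg (1 + 3 * M), K.2], by nlinarith [sq_nonneg (1 + 2 * M), K.2],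
      by nlinarith [sq_nonneg (1 + 3 * M), sq_nonneg (1 + 2 * M)]⟩
  set N' := ENNReal.ofReal N
  refine ⟨1 + N' ^ 2 * 8, by finiteness, fun u hu hub => ?_⟩
  have huc : HasCompactSupport u := hB.of_isClosed_subset (isClosed_tsupport u) hub
  refine ⟨reflection n ρ G u, exists_lipschitzWith_of_hasCompactSupport
    (h.locallyLipschitz_reflection hu) (h.hasCompactSupport_reflection huc),
    h.hasCompactSupport_reflection huc, fun x hx => reflection_of_nonpos u hx, ?_⟩
  set F : Vec d → ℝ≥0∞ := fun x => ‖symOp (fderiv ℝ u x)‖ₑ ^ 2 + ‖u x‖ₑ ^ 2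
  have hFm : Measurable F := by
    have h1 : Continuous fun x => symOp (fderiv ℝ u x) := by
      have := hu.continuous_fderiv (by simp)
      unfold symOp
      exact this.add
        ((ContinuousLinearMap.adjoint (𝕜 := ℝ) (E := Vec d) (F := Vec d)).continuous.comp this)
    have h2 := hu.continuous
    exact (h1.enorm.measurable.pow_const 2).add (h2.enorm.measurable.pow_const 2)
  have hpos : ∀ᵐ x ∂volume.restrict {x | 0 < ρ x}, ‖symOp (fderiv ℝ (reflection n ρ G u) x)‖ₑ ^ 2
      ≤ N' ^ 2 * 4 * F (shift n ρ 2 x) + N' ^ 2 * 4 * F (shift n ρ 3 x) := by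
    have hs : MeasurableSet {x | 0 < ρ x} := (isOpen_lt continuous_const h.continuous).measurableSet
    rw [ae_restrict_iff' hs]
    filter_upwards [hK.ae_differentiableAt] with x hG hx
    have hx : 0 < ρ x := hx
    have hM2 : shift n ρ 2 x ∈ tsupport u → ‖G x‖ ≤ M := fun hm => hM x (Or.inl (h₂ x (hub hm)))
    have hM3 : shift n ρ 3 x ∈ tsupport u → ‖G x‖ ≤ M := fun hm => hM x (Or.inr (h₃ x (hub hm)))
    have b2 := h.norm_symOp_fderiv_pullback_le hn hu (a := 2) (by norm_num) hx hG hK hM2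
    have b3 := h.norm_symOp_fderiv_pullback_le hn hu (a := 3) (by norm_num) hx hG hK hM3
    have d2 := (h.hasFDerivAt_pullback hu 2 hx hG.hasFDerivAt).differentiableAt
    have d3 := (h.hasFDerivAt_pullback hu 3 hx hG.hasFDerivAt).differentiableAt
    have hD : fderiv ℝ (reflection n ρ G u) x = (3 : ℝ) • fderiv ℝ (pullback n ρ G u 2) x
        - (2 : ℝ) • fderiv ℝ (pullback n ρ G u 3) x :=
      ((d2.hasFDerivAt.const_smul (3 : ℝ)).sub (d3.hasFDerivAt.const_smul (2 : ℝ))).fderiv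
    set s2 := ‖symOp (fderiv ℝ u (shift n ρ 2 x))‖
    set s3 := ‖symOp (fderiv ℝ u (shift n ρ 3 x))‖
    set t2 := ‖u (shift n ρ 2 x)‖
    set t3 := ‖u (shift n ρ 3 x)‖
    have hreal : ‖symOp (fderiv ℝ (reflection n ρ G u) x)‖ ≤ N * (s2 + t2) + N * (s3 + t3) := by
      rw [hD, symOp_sub, symOp_smul, symOp_smul]
      refine (norm_sub_le _ _).trans ?_
      rw [norm_smul, norm_smul, Real.norm_of_nonneg (by norm_num : (0 : ℝ) ≤ 3),
        Real.norm_of_nonneg (by norm_num : (0 : ℝ) ≤ 2)]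
      have p1 : 3 * (1 + 2 * M) ^ 2 * s2 ≤ N * s2 := mul_le_mul_of_nonneg_right hN2 (norm_nonneg _)
      have p2 : 2 * (1 + 3 * M) ^ 2 * s3 ≤ N * s3 := mul_le_mul_of_nonneg_right hN3 (norm_nonneg _)
      have p3 : 12 * K * t2 ≤ N * t2 := mul_le_mul_of_nonneg_right hN4 (norm_nonneg _)
      have p4 : 12 * K * t3 ≤ N * t3 := mul_le_mul_of_nonneg_right hN4 (norm_nonneg _)
      nlinarith
    have henn : ‖symOp (fderiv ℝ (reflection n ρ G u) x)‖ₑ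
        ≤ N' * (‖symOp (fderiv ℝ u (shift n ρ 2 x))‖ₑ + ‖u (shift n ρ 2 x)‖ₑ)
          + N' * (‖symOp (fderiv ℝ u (shift n ρ 3 x))‖ₑ + ‖u (shift n ρ 3 x)‖ₑ) := by
      simp only [← ofReal_norm]
      rw [← ENNReal.ofReal_add (norm_nonneg _) (norm_nonneg _),
        ← ENNReal.ofReal_add (norm_nonneg _) (norm_nonneg _), ← ENNReal.ofReal_mul hN0,
        ← ENNReal.ofReal_mul hN0, ← ENNReal.ofReal_add (by positivity) (by positivity)]
      exact ENNReal.ofReal_le_ofReal hreal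
    refine (pow_le_pow_left' henn 2).trans ((add_sq_le_two_mul_add _ _).trans ?_)
    have q : ∀ a b : ℝ≥0∞, 2 * (N' * (a + b)) ^ 2 ≤ N' ^ 2 * 4 * (a ^ 2 + b ^ 2) := fun a b => by
      calc 2 * (N' * (a + b)) ^ 2 = 2 * N' ^ 2 * (a + b) ^ 2 := by ring
        _ ≤ 2 * N' ^ 2 * (2 * a ^ 2 + 2 * b ^ 2) := mul_le_mul' le_rfl (add_sq_le_two_mul_add _ _)
        _ = _ := by ring
    exact add_le_add (q _ _) (q _ _)
  have hneg : ∫⁻ x in {x | ρ x < 0}, ‖symOp (fderiv ℝ (reflection n ρ G u) x)‖ₑ ^ 2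
      ≤ ∫⁻ x in {x | ρ x < 0}, F x := by
    have ho : IsOpen {x | ρ x < 0} := isOpen_lt h.continuous continuous_const
    refine setLIntegral_mono' ho.measurableSet fun x hx => ?_
    have : reflection n ρ G u =ᶠ[𝓝 x] u := by
      filter_upwards [ho.mem_nhds hx] with y hy using reflection_of_nonpos u (le_of_lt hy)
    rw [this.fderiv_eq]
    exact le_self_add
  have hsplit : ∀ F' : Vec d → ℝ≥0∞, ∫⁻ x, F' x
      ≤ (∫⁻ x in {x | ρ x < 0}, F' x) + ∫⁻ x in {x | 0 < ρ x}, F' x := by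
    intro F'
    rw [← setLIntegral_univ]
    have : (Set.univ : Set (Vec d)) ⊆ ({x | ρ x < 0} ∪ {x | 0 < ρ x}) ∪ {x | ρ x = 0} :=
      fun x _ => by
        rcases lt_trichotomy (ρ x) 0 with h1 | h1 | h1
        · exact Or.inl (Or.inl h1)
        · exact Or.inr h1
        · exact Or.inl (Or.inr h1)
    refine (lintegral_mono_set this).trans ((lintegral_union_le _ _ _).trans ?_)
    rw [setLIntegral_measure_zero _ _ h.volume_eq_zero, add_zero]
    exact lintegral_union_le _ _ _
  have hSm : ∀ a, Measurable fun x => F (shift n ρ a x) := fun a => hFm.comp (by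
    have := h.continuous
    have : Continuous (shift n ρ a) := by unfold shift; fun_prop
    exact this.measurable)
  have hN4' : N' ^ 2 * 4 ≠ ⊤ := by finiteness
  calc _ ≤ _ := hsplit _
    _ ≤ (∫⁻ x in {x | ρ x < 0}, F x) + ∫⁻ x in {x | 0 < ρ x},
          (N' ^ 2 * 4 * F (shift n ρ 2 x) + N' ^ 2 * 4 * F (shift n ρ 3 x)) :=
        add_le_add hneg (lintegral_mono_ae hpos)
    _ = (∫⁻ x in {x | ρ x < 0}, F x) + (N' ^ 2 * 4 * (∫⁻ x in {x | 0 < ρ x}, F (shift n ρ 2 x))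
          + N' ^ 2 * 4 * ∫⁻ x in {x | 0 < ρ x}, F (shift n ρ 3 x)) := by
        rw [lintegral_add_left ((hSm 2).const_mul _), lintegral_const_mul _ (hSm 2),
          lintegral_const_mul _ (hSm 3)]
    _ ≤ (∫⁻ x in {x | ρ x < 0}, F x) + (N' ^ 2 * 4 * (∫⁻ x in {x | ρ x < 0}, F x)
          + N' ^ 2 * 4 * ∫⁻ x in {x | ρ x < 0}, F x) := by
        refine add_le_add le_rfl (add_le_add (mul_le_mul' le_rfl ?_) (mul_le_mul' le_rfl ?_))
        · exact h.lintegral_comp_shift_le le_rfl F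
        · exact h.lintegral_comp_shift_le (by norm_num) F
    _ = _ := by ring

end IsDepth

/-- In a chart, minus the height is a depth. -/
theorem IsChart.exists_isDepth {x₀ n : Vec d} {r : ℝ} {γ : Vec d → ℝ} (h : IsChart Ω x₀ r n γ) :
    ∃ G, IsDepth n (fun x => -height n γ x) G := by
  obtain ⟨K, hK⟩ := h.lip
  let P : Vec d →L[ℝ] Vec d := ContinuousLinearMap.id ℝ (Vec d) - (innerSL ℝ n).smulRight n
  have hP : ∀ x, P x = x - ⟪n, x⟫_ℝ • n := fun x => by simp [P]
  let D : Vec d → (Vec d →L[ℝ] ℝ) := fun x => (fderiv ℝ γ (P x)).comp P - innerSL ℝ n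
  have hD : ∀ x, HasFDerivAt (fun x => -height n γ x) (D x) x := by
    intro x
    have h1 : HasFDerivAt (fun x => γ (P x)) ((fderiv ℝ γ (P x)).comp P) x :=
      (h.diff _).hasFDerivAt.comp x P.hasFDerivAt
    refine (h1.sub (innerSL ℝ n).hasFDerivAt).congr_of_eventuallyEq (.of_forall fun y => ?_)
    simp [height, hP]
  refine ⟨fun x => (InnerProductSpace.toDual ℝ (Vec d)).symm (D x), fun x => ?_, ?_, fun x t => ?_⟩
  · refine (hD x).congr_fderiv ?_
    ext y
    simp
  · refine ⟨K * ‖P‖₊ * ‖P‖₊, LipschitzWith.of_dist_le_mul fun x y => ?_⟩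
    rw [LinearIsometryEquiv.dist_map, dist_eq_norm]
    have h1 : D x - D y = (fderiv ℝ γ (P x) - fderiv ℝ γ (P y)).comp P := by
      ext z
      simp [D]
    rw [h1]
    refine (ContinuousLinearMap.opNorm_comp_le _ _).trans ?_
    have h2 := hK.dist_le_mul (P x) (P y)
    rw [dist_eq_norm, dist_eq_norm, ← map_sub] at h2
    have h3 := P.le_opNorm (x - y)
    calc _ ≤ (K * (‖P‖ * ‖x - y‖)) * ‖P‖ := by
          gcongr
          exact h2.trans (by gcongr)
      _ = _ := by
          rw [dist_eq_norm, NNReal.coe_mul, NNReal.coe_mul, coe_nnnorm]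
          ring
  · simp only [height_add_smul h.norm_eq]
    ring

/-! ### Korn's second inequality -/

/-- The integral in Korn's second inequality, in terms of the operator norm. -/
def kornEnergy (Ω : Set (Vec d)) (u : Vec d → Vec d) : ℝ≥0∞ :=
  ∫⁻ x in Ω, (‖symOp (fderiv ℝ u x)‖ₑ ^ 2 + ‖u x‖ₑ ^ 2)

/-- Fields with support near a given point of `closure Ω` extend from `Ω` to the whole space, with a
bound for the symmetrized gradient. -/
theorem exists_local_extension (hΩo : IsOpen Ω) (hΩ : HasC11Boundary Ω) {x₀ : Vec d}
    (hx₀ : x₀ ∈ closure Ω) : ∃ r > 0, ∃ C : ℝ≥0∞, C ≠ ⊤ ∧ ∀ u : Vec d → Vec d, ContDiff ℝ 1 u →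
      tsupport u ⊆ Metric.closedBall x₀ r → ∃ v : Vec d → Vec d, (∃ K, LipschitzWith K v) ∧
        HasCompactSupport v ∧ (∀ x ∈ Ω ∩ Metric.ball x₀ r, v x = u x) ∧
        ∫⁻ x, ‖symOp (fderiv ℝ v x)‖ₑ ^ 2 ≤ C * kornEnergy Ω u := by
  have hsupp : ∀ {u : Vec d → Vec d} {x}, x ∉ tsupport u →
      ‖symOp (fderiv ℝ u x)‖ₑ ^ 2 + ‖u x‖ₑ ^ 2 = 0 := by
    intro u x hx
    rw [image_eq_zero_of_notMem_tsupport hx, fderiv_of_notMem_tsupport ℝ hx, symOp_zero]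
    simp
  by_cases hx : x₀ ∈ Ω
  · obtain ⟨r, hr, hb⟩ := Metric.isOpen_iff.1 hΩo x₀ hx
    refine ⟨r / 2, by positivity, 1, ENNReal.one_ne_top, fun u hu hus => ?_⟩
    have huc : HasCompactSupport u :=
      (isCompact_closedBall x₀ (r / 2)).of_isClosed_subset (isClosed_tsupport u) hus
    refine ⟨u, hu.lipschitzWith_of_hasCompactSupport huc one_ne_zero, huc, fun _ _ => rfl, ?_⟩
    rw [one_mul, kornEnergy, ← lintegral_indicator hΩo.measurableSet]
    refine lintegral_mono fun x => ?_
    by_cases hx : x ∈ Ω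
    · rw [Set.indicator_of_mem hx]
      exact le_self_add
    · have h1 : x ∉ tsupport u := fun h =>
        hx (hb (Metric.closedBall_subset_ball (by linarith) (hus h)))
      refine (le_self_add (b := ‖u x‖ₑ ^ 2)).trans ?_
      rw [hsupp h1]
      exact zero_le
  · have hf : x₀ ∈ frontier Ω := by rw [hΩo.frontier_eq]; exact ⟨hx₀, hx⟩
    obtain ⟨r, n, γ, h⟩ := hΩ.exists_isChart hf
    obtain ⟨G, hG⟩ := h.exists_isDepth
    obtain ⟨C, hC, hext⟩ := hG.exists_extension h.norm_eq (isCompact_closedBall x₀ (r / 2))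
    have hr := h.pos
    have hbb : Metric.closedBall x₀ (r / 2) ⊆ Metric.ball x₀ r :=
      Metric.closedBall_subset_ball (by linarith)
    refine ⟨r / 2, by positivity, C, hC, fun u hu hus => ?_⟩
    obtain ⟨v, hv, hvc, hvu, hvE⟩ := hext u hu hus
    refine ⟨v, hv, hvc, fun x hx => hvu x ?_, hvE.trans (mul_le_mul' le_rfl ?_)⟩
    · have := (h.mem_iff x (hbb (Metric.ball_subset_closedBall hx.2))).1 hx.1
      linarith
    · have ho : IsOpen {x | -height n γ x < 0} := isOpen_lt hG.continuous continuous_const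
      rw [kornEnergy, ← lintegral_indicator hΩo.measurableSet,
        ← lintegral_indicator ho.measurableSet]
      refine lintegral_mono fun x => ?_
      by_cases hxs : x ∈ tsupport u
      · have hiff := h.mem_iff x (hbb (hus hxs))
        by_cases hx' : x ∈ Ω
        · rw [Set.indicator_of_mem hx']
          exact Set.indicator_le_self _ _ x
        · rw [Set.indicator_of_notMem]
          · exact zero_le
          · intro hm
            exact hx' (hiff.2 (neg_neg_iff_pos.1 hm))
      · refine (Set.indicator_le_self _ _ x).trans ?_
        rw [hsupp hxs]
        exact zero_le

/-- Cutting off preserves the bounds: the commutator with the symmetrized gradient is of order zero.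
-/
theorem exists_kornEnergy_smul_le {χ : Vec d → ℝ} (hχ : ContDiff ℝ ∞ χ)
    (hχc : HasCompactSupport χ) :
    ∃ C : ℝ≥0∞, C ≠ ⊤ ∧ ∀ φ : Vec d → Vec d, ContDiff ℝ ∞ φ →
      kornEnergy Ω (fun x => χ x • φ x) ≤ C * kornEnergy Ω φ := by
  obtain ⟨M, hM⟩ := hχc.exists_bound_of_continuous hχ.continuous
  obtain ⟨M', hM'⟩ := (hχc.fderiv (𝕜 := ℝ)).exists_bound_of_continuous
    (hχ.continuous_fderiv (by simp))
  have hMe : ∀ x, ‖χ x‖ₑ ≤ ENNReal.ofReal M := fun x => by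
    rw [← ofReal_norm]; exact ENNReal.ofReal_le_ofReal (hM x)
  have hMe' : ∀ x, ‖fderiv ℝ χ x‖ₑ ≤ ENNReal.ofReal M' := fun x => by
    rw [← ofReal_norm]; exact ENNReal.ofReal_le_ofReal (hM' x)
  set N := ENNReal.ofReal M
  set N' := ENNReal.ofReal M'
  refine ⟨3 * N ^ 2 + 8 * N' ^ 2, by finiteness, fun φ hφ => ?_⟩
  rw [kornEnergy, kornEnergy, ← lintegral_const_mul' _ _ (by finiteness)]
  refine lintegral_mono fun x => ?_
  have hD : fderiv ℝ (fun x => χ x • φ x) x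
      = χ x • fderiv ℝ φ x + (fderiv ℝ χ x).smulRight (φ x) := by
    exact fderiv_fun_smul (hχ.differentiable (by simp) x) (hφ.differentiable (by simp) x)
  have h1 : ‖symOp (fderiv ℝ (fun x => χ x • φ x) x)‖ₑ
      ≤ N * ‖symOp (fderiv ℝ φ x)‖ₑ + 2 * (N' * ‖φ x‖ₑ) := by
    rw [hD, symOp_add, symOp_smul]
    refine (enorm_add_le _ _).trans (add_le_add ?_ ?_)
    · rw [enorm_smul]
      gcongr
      exact hMe x
    · have h2 := norm_symOp_le ((fderiv ℝ χ x).smulRight (φ x))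
      rw [ContinuousLinearMap.norm_smulRight_apply] at h2
      rw [← ofReal_norm]
      refine (ENNReal.ofReal_le_ofReal h2).trans ?_
      rw [ENNReal.ofReal_mul (by norm_num), ENNReal.ofReal_mul (norm_nonneg _), ofReal_norm,
        ofReal_norm, ENNReal.ofReal_ofNat]
      gcongr
      exact hMe' x
  have h3 : ‖χ x • φ x‖ₑ ≤ N * ‖φ x‖ₑ := by
    rw [enorm_smul]
    gcongr
    exact hMe x
  calc _ ≤ (N * ‖symOp (fderiv ℝ φ x)‖ₑ + 2 * (N' * ‖φ x‖ₑ)) ^ 2 + (N * ‖φ x‖ₑ) ^ 2 := by gcongr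
    _ ≤ (2 * (N * ‖symOp (fderiv ℝ φ x)‖ₑ) ^ 2 + 2 * (2 * (N' * ‖φ x‖ₑ)) ^ 2)
        + (N * ‖φ x‖ₑ) ^ 2 := add_le_add (add_sq_le_two_mul_add _ _) le_rfl
    _ = 2 * N ^ 2 * ‖symOp (fderiv ℝ φ x)‖ₑ ^ 2 + (N ^ 2 + 8 * N' ^ 2) * ‖φ x‖ₑ ^ 2 := by ring
    _ ≤ (3 * N ^ 2 + 8 * N' ^ 2) * ‖symOp (fderiv ℝ φ x)‖ₑ ^ 2
        + (3 * N ^ 2 + 8 * N' ^ 2) * ‖φ x‖ₑ ^ 2 := by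
        gcongr
        · calc 2 * N ^ 2 ≤ 3 * N ^ 2 := by gcongr; norm_num
            _ ≤ _ := le_self_add
        · calc N ^ 2 = 1 * N ^ 2 := (one_mul _).symm
            _ ≤ 3 * N ^ 2 := by gcongr; norm_num
    _ = _ := (mul_add _ _ _).symm

/-- Korn's second inequality near a point of `closure Ω`. -/
theorem exists_local_korn (hΩo : IsOpen Ω) (hΩ : HasC11Boundary Ω) {x₀ : Vec d}
    (hx₀ : x₀ ∈ closure Ω) : ∃ r > 0, ∃ C : ℝ≥0∞, C ≠ ⊤ ∧ ∀ φ : Vec d → Vec d, ContDiff ℝ ∞ φ →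
      ∫⁻ x in Ω ∩ Metric.ball x₀ r, ‖matL d (fderiv ℝ φ x)‖ₑ ^ 2 ≤ C * kornEnergy Ω φ := by
  obtain ⟨r, hr, C, hC, hext⟩ := exists_local_extension hΩo hΩ hx₀
  -- cut off, extend by reflection, and apply the inequality for compactly supported fields
  let χ : ContDiffBump x₀ := ⟨r / 2, r, by positivity, by linarith⟩
  obtain ⟨C', hC', hcut⟩ := exists_kornEnergy_smul_le (Ω := Ω) (χ := χ) χ.contDiff
    χ.hasCompactSupport
  obtain ⟨K, hK, hK1, -⟩ := exists_enorm_matL_le d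
  refine ⟨r / 2, by positivity, K * (C * C'), by finiteness, fun φ hφ => ?_⟩
  have hu : ContDiff ℝ ∞ fun x => χ x • φ x := by
    have h1 : ContDiff ℝ ∞ fun x => χ x := χ.contDiff
    exact h1.smul hφ
  obtain ⟨v, ⟨L, hL⟩, hvc, hvu, hvE⟩ := hext _ (hu.of_le (by simp))
    ((tsupport_smul_subset_left _ _).trans (χ.tsupport_eq.subset))
  have ho : IsOpen (Ω ∩ Metric.ball x₀ (r / 2)) := hΩo.inter Metric.isOpen_ball
  calc ∫⁻ x in Ω ∩ Metric.ball x₀ (r / 2), ‖matL d (fderiv ℝ φ x)‖ₑ ^ 2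
      = ∫⁻ x in Ω ∩ Metric.ball x₀ (r / 2), ‖matL d (fderiv ℝ v x)‖ₑ ^ 2 := by
        refine setLIntegral_congr_fun ho.measurableSet fun x hx => ?_
        have : v =ᶠ[𝓝 x] φ := by
          filter_upwards [ho.mem_nhds hx] with y hy
          rw [hvu y ⟨hy.1, Metric.ball_subset_ball (by linarith) hy.2⟩,
            χ.one_of_mem_closedBall (Metric.ball_subset_closedBall hy.2), one_smul]
        simp only [this.fderiv_eq]
    _ ≤ ∫⁻ x, ‖matL d (fderiv ℝ v x)‖ₑ ^ 2 := setLIntegral_le_lintegral _ _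
    _ ≤ ∫⁻ x, ‖matL d (symOp (fderiv ℝ v x))‖ₑ ^ 2 := lintegral_enorm_fderiv_le hL hvc
    _ ≤ ∫⁻ x, K * ‖symOp (fderiv ℝ v x)‖ₑ ^ 2 := lintegral_mono fun x => hK1 _
    _ = K * ∫⁻ x, ‖symOp (fderiv ℝ v x)‖ₑ ^ 2 := lintegral_const_mul' _ _ hK
    _ ≤ K * (C * (C' * kornEnergy Ω φ)) := by
        gcongr
        exact hvE.trans (mul_le_mul' le_rfl (hcut φ hφ))
    _ = _ := by ring

/-- Korn's second inequality, by a finite cover of the closure of `Ω`. -/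
theorem exists_lintegral_le_kornEnergy (hΩo : IsOpen Ω) (hΩb : Bornology.IsBounded Ω)
    (hΩ : HasC11Boundary Ω) : ∃ C : ℝ≥0∞, C ≠ ⊤ ∧ ∀ φ : Vec d → Vec d, ContDiff ℝ ∞ φ →
      ∫⁻ x in Ω, ‖matL d (fderiv ℝ φ x)‖ₑ ^ 2 ≤ C * kornEnergy Ω φ := by
  have key := hΩb.isCompact_closure.induction_on
    (p := fun S => ∃ C : ℝ≥0∞, C ≠ ⊤ ∧ ∀ φ : Vec d → Vec d, ContDiff ℝ ∞ φ →
      ∫⁻ x in Ω ∩ S, ‖matL d (fderiv ℝ φ x)‖ₑ ^ 2 ≤ C * kornEnergy Ω φ)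
    ⟨0, ENNReal.zero_ne_top, fun φ _ => by simp⟩
    (fun S T hST ⟨C, hC, h⟩ => ⟨C, hC, fun φ hφ =>
      (lintegral_mono_set (Set.inter_subset_inter_right _ hST)).trans (h φ hφ)⟩)
    (fun S T ⟨C, hC, h⟩ ⟨C', hC', h'⟩ => ⟨C + C', by finiteness, fun φ hφ => by
      rw [Set.inter_union_distrib_left, add_mul]
      exact (lintegral_union_le _ _ _).trans (add_le_add (h φ hφ) (h' φ hφ))⟩)
    (fun x hx => by
      obtain ⟨r, hr, h⟩ := exists_local_korn hΩo hΩ hx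
      exact ⟨_, mem_nhdsWithin_of_mem_nhds (Metric.ball_mem_nhds x hr), h⟩)
  obtain ⟨C, hC, h⟩ := key
  refine ⟨C, hC, fun φ hφ => ?_⟩
  have := h φ hφ
  rwa [Set.inter_eq_self_of_subset_left subset_closure] at this

/-- Korn's second inequality for smooth fields. -/
theorem exists_korn_smooth (hΩo : IsOpen Ω) (hΩb : Bornology.IsBounded Ω)
    (hΩ : HasC11Boundary Ω) : ∃ C : ℝ, 0 ≤ C ∧ ∀ (φ : Vec d → Vec d) (hφ : ContDiff ℝ ∞ φ),
      ‖gradL Ω (smoothDisp hΩb hφ)‖ ^ 2 ≤ C * (‖symGradL Ω (smoothDisp hΩb hφ)‖ ^ 2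
        + ‖fieldL Ω (smoothDisp hΩb hφ)‖ ^ 2) := by
  obtain ⟨C, hC, h⟩ := exists_lintegral_le_kornEnergy hΩo hΩb hΩ
  obtain ⟨K, hK, -, hK2⟩ := exists_enorm_matL_le d
  refine ⟨(C * (K + 1)).toReal, ENNReal.toReal_nonneg, fun φ hφ => ?_⟩
  have h1 : ‖gradL Ω (smoothDisp hΩb hφ)‖ₑ ^ 2
      ≤ C * (K + 1) * (‖symGradL Ω (smoothDisp hΩb hφ)‖ₑ ^ 2
        + ‖fieldL Ω (smoothDisp hΩb hφ)‖ₑ ^ 2) := by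
    rw [enorm_gradL_smoothDisp, enorm_symGradL_smoothDisp, enorm_fieldL_smoothDisp]
    refine (h φ hφ).trans ?_
    rw [mul_assoc]
    gcongr
    have hcont : Measurable fun x => ‖φ x‖ₑ ^ 2 := hφ.continuous.enorm.measurable.pow_const 2
    rw [kornEnergy, lintegral_add_right _ hcont]
    calc _ ≤ (∫⁻ x in Ω, K * ‖matL d (symOp (fderiv ℝ φ x))‖ₑ ^ 2) + ∫⁻ x in Ω, ‖φ x‖ₑ ^ 2 := by
          gcongr
          exact hK2 _
      _ = K * (∫⁻ x in Ω, ‖matL d (symOp (fderiv ℝ φ x))‖ₑ ^ 2) + 1 * ∫⁻ x in Ω, ‖φ x‖ₑ ^ 2 := by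
          rw [lintegral_const_mul' _ _ hK, one_mul]
      _ ≤ _ := by
          rw [mul_add]
          gcongr
          · exact le_self_add
          · exact le_add_self
  have h2 := ENNReal.toReal_mono (by finiteness) h1
  rw [ENNReal.toReal_mul, ENNReal.toReal_add (by finiteness) (by finiteness)] at h2
  simpa only [ENNReal.toReal_pow, toReal_enorm] using h2

/-! ### Rellich's theorem -/

theorem eventually_ofReal_sq_mul_le {c ε : ℝ≥0∞} (hc : c ≠ ⊤) (hε : ε ≠ 0) :
    ∀ᶠ t : ℝ in 𝓝[>] 0, ENNReal.ofReal t ^ 2 * c ≤ ε := by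
  have h1 : Tendsto (fun t : ℝ => ENNReal.ofReal t ^ 2 * c) (𝓝[>] 0) (𝓝 (0 ^ 2 * c)) := by
    refine ENNReal.Tendsto.mul_const ?_ (Or.inr hc)
    refine (ENNReal.Tendsto.pow ?_)
    have := (ENNReal.continuous_ofReal.tendsto 0).mono_left (nhdsWithin_le_nhds (s := Set.Ioi 0))
    rwa [ENNReal.ofReal_zero] at this
  rw [zero_pow two_ne_zero, zero_mul] at h1
  exact h1.eventually (Iic_mem_nhds (pos_iff_ne_zero.2 hε))

/-- On `S`, the `L²` norm of smooth fields is controlled by a small multiple of the `H¹(Ω)` norm and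
by finitely many inner products with elements of `L²(Ω)^d`. For `S = Ω` this is a form of the
compactness of the embedding of `H¹` into `L²`. -/
def FinitelyControlled (hΩb : Bornology.IsBounded Ω) (S : Set (Vec d)) : Prop :=
  ∀ ε : ℝ≥0∞, ε ≠ 0 → ∃ (s : Finset (L2Vec Ω)) (C : ℝ≥0∞), C ≠ ⊤ ∧
    ∀ (φ : Vec d → Vec d) (hφ : ContDiff ℝ ∞ φ),
      ∫⁻ x in S, ‖φ x‖ₑ ^ 2 ≤ ε * ‖smoothDisp hΩb hφ‖ₑ ^ 2
        + C * ∑ Ψ ∈ s, ‖⟪Ψ, fieldL Ω (smoothDisp hΩb hφ)⟫_ℝ‖ₑ ^ 2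

theorem lintegral_field_le (hΩb : Bornology.IsBounded Ω) {φ : Vec d → Vec d}
    (hφ : ContDiff ℝ ∞ φ) : ∫⁻ x in Ω, ‖φ x‖ₑ ^ 2 ≤ ‖smoothDisp hΩb hφ‖ₑ ^ 2 := by
  rw [enorm_sq_Disp, enorm_fieldL_smoothDisp]
  exact le_self_add

theorem exists_lintegral_fderiv_le (hΩb : Bornology.IsBounded Ω) : ∃ K : ℝ≥0∞, K ≠ ⊤ ∧
    ∀ (φ : Vec d → Vec d) (hφ : ContDiff ℝ ∞ φ),
      ∫⁻ x in Ω, ‖fderiv ℝ φ x‖ₑ ^ 2 ≤ K * ‖smoothDisp hΩb hφ‖ₑ ^ 2 := by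
  obtain ⟨K, hK, -, hK2⟩ := exists_enorm_matL_le d
  refine ⟨K, hK, fun φ hφ => ?_⟩
  rw [enorm_sq_Disp, enorm_gradL_smoothDisp]
  calc _ ≤ ∫⁻ x in Ω, K * ‖matL d (fderiv ℝ φ x)‖ₑ ^ 2 := lintegral_mono fun x => hK2 _
    _ = K * ∫⁻ x in Ω, ‖matL d (fderiv ℝ φ x)‖ₑ ^ 2 := lintegral_const_mul' _ _ hK
    _ ≤ _ := by gcongr; exact le_add_self

/-- The underlying element of `Lp`. -/
def L2Vec.asLp (u : L2Vec Ω) : Lp (Vec d) 2 (volume.restrict Ω) := u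

theorem enorm_sq_eq_sum (v : Vec d) : ‖v‖ₑ ^ 2 = ∑ i, ‖v i‖ₑ ^ 2 := by
  rw [← ofReal_norm, ← ENNReal.ofReal_pow (norm_nonneg _), EuclideanSpace.norm_sq_eq,
    ENNReal.ofReal_sum_of_nonneg fun i _ => by positivity]
  refine Finset.sum_congr rfl fun i _ => ?_
  rw [ENNReal.ofReal_pow (norm_nonneg _), ofReal_norm]

/-- An average of a smooth field is controlled by finitely many inner products in `L²`, one for each
coordinate. -/
theorem exists_finset_average (hΩb : Bornology.IsBounded Ω) {χ : Vec d → ℝ} (hχ : Continuous χ)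
    (hχc : HasCompactSupport χ) : ∃ s : Finset (L2Vec Ω), ∀ (φ : Vec d → Vec d)
      (hφ : ContDiff ℝ ∞ φ), ‖∫ y in Ω, χ y • φ y‖ₑ ^ 2
        ≤ d * ∑ Ψ ∈ s, ‖⟪Ψ, fieldL Ω (smoothDisp hΩb hφ)⟫_ℝ‖ₑ ^ 2 := by
  classical
  have hex : ∀ i : Fin d, ∃ Ψ : L2Vec Ω, ∀ u : L2Vec Ω,
      ∫ x in Ω, u.asLp x i * χ x = ⟪Ψ, u⟫_ℝ := fun i =>
    exists_inner_eq_integral_coord (Ω := Ω) i hχ hχc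
  choose Ψ hΨ using hex
  refine ⟨Finset.univ.image Ψ, fun φ hφ => ?_⟩
  have hint : Integrable (fun y => χ y • φ y) (volume.restrict Ω) :=
    ((hχ.smul hφ.continuous).integrable_of_hasCompactSupport hχc.smul_right).restrict
  have hcoord : ∀ i, (∫ y in Ω, χ y • φ y) i = ⟪Ψ i, fieldL Ω (smoothDisp hΩb hφ)⟫_ℝ := by
    intro i
    rw [← hΨ]
    refine ((EuclideanSpace.proj (𝕜 := ℝ) i).integral_comp_comm hint).symm.trans ?_
    refine integral_congr_ae ?_
    filter_upwards [fieldOf_smoothDisp hΩb hφ] with x hx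
    have h1 : (fieldL Ω (smoothDisp hΩb hφ)).asLp x = φ x := hx
    rw [h1]
    simp [mul_comm]
  rw [enorm_sq_eq_sum]
  calc _ ≤ ∑ _i : Fin d, ∑ Ψ ∈ Finset.univ.image Ψ, ‖⟪Ψ, fieldL Ω (smoothDisp hΩb hφ)⟫_ℝ‖ₑ ^ 2 := by
        refine Finset.sum_le_sum fun i _ => ?_
        rw [hcoord]
        exact Finset.single_le_sum
          (f := fun Ψ : L2Vec Ω => ‖⟪Ψ, fieldL Ω (smoothDisp hΩb hφ)⟫_ℝ‖ₑ ^ 2)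
          (fun _ _ => zero_le) (Finset.mem_image_of_mem Ψ (Finset.mem_univ i))
    _ = _ := by simp

/-- A field differs little from its averages at a small scale. -/
theorem lintegral_sub_average_le {F : Type*} [NormedAddCommGroup F] [NormedSpace ℝ F]
    [CompleteSpace F] {φ : Vec d → F} (hφ : ContDiff ℝ 1 φ) {K : Set (Vec d)} {χ : Vec d → ℝ}
    (hχ : Continuous χ) (hχ0 : ∀ z, 0 ≤ χ z) (hχ1 : ∫ z, χ z = 1) {t : ℝ}
    (hχt : ∀ z, t ≤ ‖z‖ → χ z = 0) (hK : ∀ x ∈ K, Metric.ball x t ⊆ Ω) :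
    ∫⁻ x in K, ‖φ x - ∫ z, χ z • φ (x + z)‖ₑ ^ 2
      ≤ ENNReal.ofReal t ^ 2 * ∫⁻ x in Ω, ‖fderiv ℝ φ x‖ₑ ^ 2 := by
  have hχc : HasCompactSupport χ := HasCompactSupport.intro (isCompact_closedBall 0 t)
    fun z hz => hχt z (by simpa using (not_le.1 fun h => hz (mem_closedBall_zero_iff.2 h)).le)
  have hχi : Integrable χ := hχ.integrable_of_hasCompactSupport hχc
  have hone : ∫⁻ z, ENNReal.ofReal (χ z) = 1 := by
    rw [← ofReal_integral_eq_lintegral_ofReal hχi (.of_forall hχ0), hχ1, ENNReal.ofReal_one]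
  set w : Vec d → ℝ≥0∞ := fun z => ENNReal.ofReal (χ z)
  have hw : Measurable w := (ENNReal.continuous_ofReal.comp hχ).measurable
  have hpt : ∀ x, ‖φ x - ∫ z, χ z • φ (x + z)‖ₑ ^ 2
      ≤ ∫⁻ z, w z * ‖φ (x + z) - φ x‖ₑ ^ 2 := by
    intro x
    have hc : Continuous fun z => φ (x + z) := hφ.continuous.comp (by fun_prop)
    have hi : Integrable fun z => χ z • φ (x + z) :=
      (hχ.smul hc).integrable_of_hasCompactSupport hχc.smul_right
    have h1 : φ x - ∫ z, χ z • φ (x + z) = ∫ z, χ z • (φ x - φ (x + z)) := by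
      simp only [smul_sub]
      rw [integral_sub (hχi.smul_const _) hi, integral_smul_const, hχ1, one_smul]
    have hdm : Measurable fun z => ‖φ (x + z) - φ x‖ₑ := (hc.sub continuous_const).enorm.measurable
    rw [h1]
    have h2 := sq_lintegral_le (μ := volume.withDensity w) hdm.aemeasurable
    rw [withDensity_apply _ MeasurableSet.univ, setLIntegral_univ, hone, one_mul,
      lintegral_withDensity_eq_lintegral_mul _ hw hdm,
      lintegral_withDensity_eq_lintegral_mul _ hw (hdm.pow_const 2)] at h2
    refine le_trans (pow_le_pow_left' ((enorm_integral_le_lintegral_enorm _).trans_eq ?_) 2) h2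
    refine lintegral_congr fun z => ?_
    rw [enorm_smul, Pi.mul_apply, Real.enorm_eq_ofReal (hχ0 z), ← enorm_neg, neg_sub]
  have hm2 : Measurable fun p : Vec d × Vec d => w p.2 * ‖φ (p.1 + p.2) - φ p.1‖ₑ ^ 2 := by
    have h1 : Continuous fun p : Vec d × Vec d => φ (p.1 + p.2) - φ p.1 :=
      (hφ.continuous.comp (by fun_prop)).sub (hφ.continuous.comp (by fun_prop))
    exact (hw.comp measurable_snd).mul (h1.enorm.measurable.pow_const 2)
  calc _ ≤ ∫⁻ x in K, (∫⁻ z, w z * ‖φ (x + z) - φ x‖ₑ ^ 2) := lintegral_mono fun x => hpt x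
    _ = ∫⁻ z, (∫⁻ x in K, w z * ‖φ (x + z) - φ x‖ₑ ^ 2) :=
        lintegral_lintegral_swap hm2.aemeasurable
    _ ≤ ∫⁻ z, w z * (ENNReal.ofReal t ^ 2 * ∫⁻ x in Ω, ‖fderiv ℝ φ x‖ₑ ^ 2) := by
        refine lintegral_mono fun z => ?_
        simp only
        rw [lintegral_const_mul' _ _ ENNReal.ofReal_ne_top]
        by_cases hz : t ≤ ‖z‖
        · simp [w, hχt z hz]
        push Not at hz
        refine mul_le_mul' le_rfl ((lintegral_translate_sub_sq_le hφ z (Ω := Ω) ?_).trans ?_)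
        · intro x hx s hs
          refine hK x hx ?_
          rw [mem_ball_iff_norm, add_sub_cancel_left, norm_smul, Real.norm_of_nonneg hs.1.le]
          exact (mul_le_of_le_one_left (norm_nonneg _) hs.2).trans_lt hz
        · gcongr
          rw [← ofReal_norm]
          exact ENNReal.ofReal_le_ofReal hz.le
    _ = _ := by rw [lintegral_mul_const _ hw, hone, one_mul]

theorem FinitelyControlled.mono {hΩb : Bornology.IsBounded Ω} {S T : Set (Vec d)}
    (h : FinitelyControlled hΩb T) (hST : S ⊆ T) : FinitelyControlled hΩb S := by
  intro ε hε
  obtain ⟨s, C, hC, hs⟩ := h ε hε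
  exact ⟨s, C, hC, fun φ hφ => (lintegral_mono_set hST).trans (hs φ hφ)⟩

/-- On a compact subset of `Ω`, a field is close to its averages at a small scale, and these
averages are close to finitely many of them. -/
theorem finitelyControlled_of_isCompact (hΩb : Bornology.IsBounded Ω) (hΩo : IsOpen Ω)
    {K : Set (Vec d)} (hK : IsCompact K) (hKΩ : K ⊆ Ω) : FinitelyControlled hΩb K := by
  classical
  intro ε hε
  obtain ⟨D, hD, hgrad⟩ := exists_lintegral_fderiv_le (d := d) hΩb
  obtain ⟨δ, hδ, hδΩ⟩ := hK.exists_thickening_subset_open hΩo hKΩ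
  have hε2 : ε / 2 ≠ 0 := (ENNReal.half_pos hε).ne'
  have hVΩ : volume Ω ≠ ⊤ := hΩb.measure_lt_top.ne
  have hVK : volume K ≠ ⊤ := hK.measure_lt_top.ne
  -- the scale of the averages: the distance of a field to its average is small in `L²`
  obtain ⟨t, ⟨htε, htδ⟩, ht0⟩ := (((eventually_ofReal_sq_mul_le (c := 2 * D) (by finiteness)
    hε2).and (eventually_nhdsWithin_of_eventually_nhds (gt_mem_nhds hδ))).and
      eventually_mem_nhdsWithin).exists
  have ht0 : 0 < t := ht0
  let b : ContDiffBump (0 : Vec d) := ⟨t / 2, t, by positivity, by linarith⟩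
  set χ : Vec d → ℝ := b.normed volume
  have hχd : ContDiff ℝ ∞ χ := b.contDiff_normed
  have hχ := hχd.continuous
  have hχc : HasCompactSupport χ := b.hasCompactSupport_normed
  have hχt : ∀ z, t ≤ ‖z‖ → χ z = 0 := fun z hz => by
    have : z ∉ Function.support χ := by
      rw [b.support_normed_eq]
      simpa using hz
    exact Function.notMem_support.1 this
  have hball : ∀ x ∈ K, Metric.ball x t ⊆ Ω := fun x hx =>
    ((Metric.ball_subset_ball htδ.le).trans (Metric.ball_subset_thickening hx δ)).trans hδΩ
  obtain ⟨L, hL⟩ := hχd.lipschitzWith_of_hasCompactSupport hχc (by simp)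
  -- the mesh of a finite net in `K`: averages about points of `K` are close to averages about
  -- points of the net
  obtain ⟨η, hηε, hη0⟩ := ((eventually_ofReal_sq_mul_le
    (c := 4 * (volume K * (L ^ 2 * volume Ω))) (by finiteness) hε2).and
      eventually_mem_nhdsWithin).exists
  have hη0 : 0 < η := hη0
  obtain ⟨T, -, hTf, hT⟩ := hK.finite_cover_balls hη0
  have hχx : ∀ x : Vec d, Continuous fun y => χ (y - x) := fun x => hχ.comp (by fun_prop)
  have hχxc : ∀ x : Vec d, HasCompactSupport fun y => χ (y - x) := fun x =>
    hχc.comp_homeomorph (Homeomorph.subRight x)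
  choose sf hsf using fun x : Vec d => exists_finset_average hΩb (hχx x) (hχxc x)
  refine ⟨hTf.toFinset.biUnion sf, 4 * volume K * d, by finiteness, fun φ hφ => ?_⟩
  set E := ‖smoothDisp hΩb hφ‖ₑ ^ 2
  set Q := ∑ Ψ ∈ hTf.toFinset.biUnion sf, ‖⟪Ψ, fieldL Ω (smoothDisp hΩb hφ)⟫_ℝ‖ₑ ^ 2
  have hφc := hφ.continuous
  have hconv : ∀ x ∈ K, ∫ z, χ z • φ (x + z) = ∫ y in Ω, χ (y - x) • φ y := by
    intro x hx
    rw [setIntegral_eq_integral_of_forall_compl_eq_zero,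
      ← integral_add_left_eq_self (fun y => χ (y - x) • φ y) x]
    · simp
    · intro y hy
      rw [hχt (y - x), zero_smul]
      by_contra hlt
      exact hy (hball x hx (mem_ball_iff_norm.2 (not_le.1 hlt)))
  have hM : (∫⁻ y in Ω, ‖φ y‖ₑ) ^ 2 ≤ volume Ω * E := by
    have := sq_lintegral_le (μ := volume.restrict Ω) hφc.enorm.measurable.aemeasurable
    rw [Measure.restrict_apply_univ] at this
    exact this.trans (mul_le_mul' le_rfl (lintegral_field_le hΩb hφ))
  have havg : ∀ x ∈ K, ‖∫ z, χ z • φ (x + z)‖ₑ ^ 2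
      ≤ 2 * (d * Q) + 2 * (L ^ 2 * ENNReal.ofReal η ^ 2 * (volume Ω * E)) := by
    intro x hx
    obtain ⟨k, hk, hxk⟩ := Set.mem_iUnion₂.1 (hT hx)
    have hi : ∀ x : Vec d, Integrable (fun y => χ (y - x) • φ y) (volume.restrict Ω) := fun x =>
      (((hχx x).smul hφc).integrable_of_hasCompactSupport (hχxc x).smul_right).restrict
    have hdiff : ‖(∫ y in Ω, χ (y - x) • φ y) - ∫ y in Ω, χ (y - k) • φ y‖ₑ
        ≤ L * ENNReal.ofReal η * ∫⁻ y in Ω, ‖φ y‖ₑ := by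
      rw [← integral_sub (hi x) (hi k), ← lintegral_const_mul' _ _ (by finiteness)]
      refine (enorm_integral_le_lintegral_enorm _).trans (lintegral_mono fun y => ?_)
      rw [← sub_smul, enorm_smul]
      gcongr
      rw [← edist_eq_enorm_sub]
      refine (hL _ _).trans ?_
      gcongr
      rw [edist_dist]
      refine ENNReal.ofReal_le_ofReal ?_
      rw [dist_eq_norm, sub_sub_sub_cancel_left, ← dist_eq_norm, dist_comm]
      exact (Metric.mem_ball.1 hxk).le
    rw [hconv x hx]
    calc _ = ‖(∫ y in Ω, χ (y - k) • φ y)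
          + ((∫ y in Ω, χ (y - x) • φ y) - ∫ y in Ω, χ (y - k) • φ y)‖ₑ ^ 2 := by
          rw [add_sub_cancel]
      _ ≤ (‖∫ y in Ω, χ (y - k) • φ y‖ₑ + L * ENNReal.ofReal η * ∫⁻ y in Ω, ‖φ y‖ₑ) ^ 2 :=
          pow_le_pow_left' ((enorm_add_le _ _).trans (add_le_add le_rfl hdiff)) 2
      _ ≤ 2 * ‖∫ y in Ω, χ (y - k) • φ y‖ₑ ^ 2
          + 2 * (L * ENNReal.ofReal η * ∫⁻ y in Ω, ‖φ y‖ₑ) ^ 2 := add_sq_le_two_mul_add _ _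
      _ ≤ _ := by
          refine add_le_add (mul_le_mul' le_rfl ((hsf k φ hφ).trans (mul_le_mul' le_rfl ?_)))
            (mul_le_mul' le_rfl ?_)
          · exact Finset.sum_le_sum_of_subset
              (Finset.subset_biUnion_of_mem sf (hTf.mem_toFinset.2 hk))
          · rw [mul_pow, mul_pow]
            exact mul_le_mul' le_rfl hM
  have hfirst := lintegral_sub_average_le (hφ.of_le (by simp) : ContDiff ℝ 1 φ) hχ
    b.nonneg_normed b.integral_normed hχt hball
  calc ∫⁻ x in K, ‖φ x‖ₑ ^ 2
      ≤ ∫⁻ x in K, (2 * ‖φ x - ∫ z, χ z • φ (x + z)‖ₑ ^ 2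
          + 2 * (2 * (d * Q) + 2 * (L ^ 2 * ENNReal.ofReal η ^ 2 * (volume Ω * E)))) := by
        refine setLIntegral_mono' hK.measurableSet fun x hx => ?_
        calc ‖φ x‖ₑ ^ 2 = ‖(φ x - ∫ z, χ z • φ (x + z)) + ∫ z, χ z • φ (x + z)‖ₑ ^ 2 := by
              rw [sub_add_cancel]
          _ ≤ (‖φ x - ∫ z, χ z • φ (x + z)‖ₑ + ‖∫ z, χ z • φ (x + z)‖ₑ) ^ 2 :=
              pow_le_pow_left' (enorm_add_le _ _) 2
          _ ≤ _ := (add_sq_le_two_mul_add _ _).trans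
            (add_le_add le_rfl (mul_le_mul' le_rfl (havg x hx)))
    _ = 2 * (∫⁻ x in K, ‖φ x - ∫ z, χ z • φ (x + z)‖ₑ ^ 2)
          + 2 * (2 * (d * Q) + 2 * (L ^ 2 * ENNReal.ofReal η ^ 2 * (volume Ω * E))) * volume K := by
        rw [lintegral_add_right _ measurable_const, lintegral_const_mul' _ _ (by finiteness),
          setLIntegral_const]
    _ ≤ 2 * (ENNReal.ofReal t ^ 2 * (D * E))
          + 2 * (2 * (d * Q) + 2 * (L ^ 2 * ENNReal.ofReal η ^ 2 * (volume Ω * E))) * volume K := by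
        gcongr
        exact hfirst.trans (mul_le_mul' le_rfl (hgrad φ hφ))
    _ = ENNReal.ofReal t ^ 2 * (2 * D) * E
          + ENNReal.ofReal η ^ 2 * (4 * (volume K * (L ^ 2 * volume Ω))) * E
          + 4 * volume K * d * Q := by ring
    _ ≤ ε / 2 * E + ε / 2 * E + 4 * volume K * d * Q := by gcongr
    _ = _ := by rw [← add_mul, ENNReal.add_halves]

/-- `S` is finitely controlled if this holds for arbitrarily small translates of `S` into `Ω`: a
small translation of a field is a small change in `L²`. -/
theorem FinitelyControlled.of_translate (hΩb : Bornology.IsBounded Ω) {S : Set (Vec d)}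
    (hS : ∀ c : ℝ≥0∞, c ≠ ⊤ → ∀ ε : ℝ≥0∞, ε ≠ 0 → ∃ z : Vec d, ‖z‖ₑ ^ 2 * c ≤ ε ∧
      (∀ x ∈ S, ∀ s ∈ Set.Ioc (0 : ℝ) 1, x + s • z ∈ Ω) ∧
      FinitelyControlled hΩb ((fun x => x + z) '' S)) : FinitelyControlled hΩb S := by
  intro ε hε
  obtain ⟨D, hD, hgrad⟩ := exists_lintegral_fderiv_le (d := d) hΩb
  have hε2 : ε / 2 ≠ 0 := (ENNReal.half_pos hε).ne'
  obtain ⟨z, hz, hzS, hz'⟩ := hS (2 * D) (by finiteness) (ε / 2) hε2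
  obtain ⟨s, C, hC, h⟩ := hz' (ε / 2 / 2) (ENNReal.half_pos hε2).ne'
  refine ⟨s, 2 * C, by finiteness, fun φ hφ => ?_⟩
  set E := ‖smoothDisp hΩb hφ‖ₑ ^ 2
  set Q := ∑ Ψ ∈ s, ‖⟪Ψ, fieldL Ω (smoothDisp hΩb hφ)⟫_ℝ‖ₑ ^ 2
  have hφc := hφ.continuous
  have hm : Measurable fun x => 2 * ‖φ (x + z)‖ₑ ^ 2 :=
    ((hφc.comp (continuous_add_const z)).enorm.measurable.pow_const 2).const_mul 2
  have himg : ∫⁻ x in S, ‖φ (x + z)‖ₑ ^ 2 = ∫⁻ x in (fun x => x + z) '' S, ‖φ x‖ₑ ^ 2 :=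
    (measurePreserving_add_right volume z).setLIntegral_comp_emb
      (measurableEmbedding_addRight z) (fun x => ‖φ x‖ₑ ^ 2) S
  calc ∫⁻ x in S, ‖φ x‖ₑ ^ 2
      ≤ ∫⁻ x in S, (2 * ‖φ (x + z) - φ x‖ₑ ^ 2 + 2 * ‖φ (x + z)‖ₑ ^ 2) := by
        refine lintegral_mono fun x => ?_
        calc ‖φ x‖ₑ ^ 2 = ‖-(φ (x + z) - φ x) + φ (x + z)‖ₑ ^ 2 := by congr 2; abel
          _ ≤ (‖φ (x + z) - φ x‖ₑ + ‖φ (x + z)‖ₑ) ^ 2 :=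
              pow_le_pow_left' ((enorm_add_le _ _).trans_eq (by rw [enorm_neg])) 2
          _ ≤ _ := add_sq_le_two_mul_add _ _
    _ = 2 * (∫⁻ x in S, ‖φ (x + z) - φ x‖ₑ ^ 2) + 2 * ∫⁻ x in S, ‖φ (x + z)‖ₑ ^ 2 := by
        rw [lintegral_add_right _ hm, lintegral_const_mul' _ _ (by finiteness),
          lintegral_const_mul' _ _ (by finiteness)]
    _ ≤ 2 * (‖z‖ₑ ^ 2 * (D * E)) + 2 * (ε / 2 / 2 * E + C * Q) := by
        rw [himg]
        gcongr
        · exact (lintegral_translate_sub_sq_le (hφ.of_le (by simp)) z hzS).trans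
            (mul_le_mul' le_rfl (hgrad φ hφ))
        · exact h φ hφ
    _ = ‖z‖ₑ ^ 2 * (2 * D) * E + (ε / 2 / 2 + ε / 2 / 2) * E + 2 * C * Q := by ring
    _ ≤ ε / 2 * E + ε / 2 * E + 2 * C * Q := by
        rw [ENNReal.add_halves]
        gcongr
    _ = _ := by rw [← add_mul, ENNReal.add_halves]

/-- Near the boundary, a translation in the direction `n` of a chart moves the closure of `Ω` into
`Ω`. -/
theorem finitelyControlled_boundary (hΩb : Bornology.IsBounded Ω) (hΩo : IsOpen Ω)
    (hΩ : HasC11Boundary Ω) {x₀ : Vec d} (hx₀ : x₀ ∈ frontier Ω) :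
    ∃ r > 0, FinitelyControlled hΩb (Ω ∩ Metric.ball x₀ r) := by
  obtain ⟨r, n, γ, h⟩ := hΩ.exists_isChart hx₀
  have hr := h.pos
  have hhc : Continuous (height n γ) := continuous_height n h.diff.continuous
  have hcl : ∀ x ∈ closure (Ω ∩ Metric.ball x₀ (r / 4)),
      x ∈ Metric.ball x₀ (r / 2) ∧ 0 ≤ height n γ x := by
    intro x hx
    refine ⟨?_, ?_⟩
    · have h1 := closure_mono (Set.inter_subset_right (s := Ω)) hx
      exact Metric.closedBall_subset_ball (by linarith) (Metric.closure_ball_subset_closedBall h1)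
    · refine closure_minimal ?_ (isClosed_le continuous_const hhc) hx
      intro y hy
      exact ((h.mem_iff y (Metric.ball_subset_ball (by linarith) hy.2)).1 hy.1).le
  refine ⟨r / 4, by positivity, FinitelyControlled.of_translate hΩb fun c hc ε hε => ?_⟩
  obtain ⟨t, ⟨htε, htr⟩, ht0⟩ := (((eventually_ofReal_sq_mul_le hc hε).and
    (eventually_nhdsWithin_of_eventually_nhds (gt_mem_nhds (half_pos hr)))).and
      eventually_mem_nhdsWithin).exists
  have ht0 : 0 < t := ht0
  have hmem : ∀ x ∈ closure (Ω ∩ Metric.ball x₀ (r / 4)), ∀ s ∈ Set.Ioc (0 : ℝ) 1,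
      x + s • t • n ∈ Ω := by
    intro x hx s hs
    rw [smul_smul]
    refine h.add_smul_mem (hcl x hx).1 (hcl x hx).2 (mul_pos hs.1 ht0) ?_
    nlinarith [hs.2]
  refine ⟨t • n, ?_, fun x hx => hmem x (subset_closure hx), ?_⟩
  · rwa [enorm_smul, ← ofReal_norm n, h.norm_eq, ENNReal.ofReal_one, mul_one,
      Real.enorm_eq_ofReal ht0.le]
  · refine FinitelyControlled.mono (T := (fun x => x + t • n) ''
      closure (Ω ∩ Metric.ball x₀ (r / 4))) ?_ (Set.image_mono subset_closure)
    refine finitelyControlled_of_isCompact hΩb hΩo ?_ ?_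
    · have : Bornology.IsBounded (Ω ∩ Metric.ball x₀ (r / 4)) := hΩb.subset Set.inter_subset_left
      exact this.isCompact_closure.image (continuous_add_const _)
    · rintro _ ⟨x, hx, rfl⟩
      simpa using hmem x hx 1 ⟨one_pos, le_rfl⟩

/-- A form of Rellich's compactness theorem, by a finite cover of the closure of `Ω`. -/
theorem finitelyControlled (hΩb : Bornology.IsBounded Ω) (hΩo : IsOpen Ω)
    (hΩ : HasC11Boundary Ω) : FinitelyControlled hΩb Ω := by
  classical
  have key := hΩb.isCompact_closure.induction_on
    (p := fun S => FinitelyControlled hΩb (Ω ∩ S))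
    (fun ε _ => ⟨∅, 0, ENNReal.zero_ne_top, fun φ hφ => by simp⟩)
    (fun S T hST h ε hε => by
      obtain ⟨s, C, hC, hs⟩ := h ε hε
      exact ⟨s, C, hC, fun φ hφ =>
        (lintegral_mono_set (Set.inter_subset_inter_right _ hST)).trans (hs φ hφ)⟩)
    (fun S T h h' ε hε => by
      obtain ⟨s, C, hC, hs⟩ := h (ε / 2) (ENNReal.half_pos hε).ne'
      obtain ⟨s', C', hC', hs'⟩ := h' (ε / 2) (ENNReal.half_pos hε).ne'
      refine ⟨s ∪ s', C + C', by finiteness, fun φ hφ => ?_⟩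
      rw [Set.inter_union_distrib_left]
      refine (lintegral_union_le _ _ _).trans ((add_le_add (hs φ hφ) (hs' φ hφ)).trans ?_)
      rw [add_add_add_comm, ← add_mul, ENNReal.add_halves, add_mul C]
      gcongr
      · exact Finset.subset_union_left
      · exact Finset.subset_union_right)
    (fun x hx => by
      by_cases hx' : x ∈ Ω
      · obtain ⟨r, hr, hb⟩ := Metric.nhds_basis_closedBall.mem_iff.1 (hΩo.mem_nhds hx')
        refine ⟨_, mem_nhdsWithin_of_mem_nhds (Metric.closedBall_mem_nhds x hr), ?_⟩
        rw [Set.inter_eq_self_of_subset_right hb]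
        exact finitelyControlled_of_isCompact hΩb hΩo (isCompact_closedBall x r) hb
      · obtain ⟨r, hr, h⟩ := finitelyControlled_boundary hΩb hΩo hΩ
          (x₀ := x) (by rw [hΩo.frontier_eq]; exact ⟨hx, hx'⟩)
        exact ⟨_, mem_nhdsWithin_of_mem_nhds (Metric.ball_mem_nhds x hr), h⟩)
  rwa [Set.inter_eq_self_of_subset_left subset_closure] at key

/-! ### Fields with vanishing strain -/

open scoped Convolution in
/-- The mollification of a function with vanishing weak gradient has derivative zero away from the
boundary. -/
theorem hasFDerivAt_convolution_zero (hΩo : IsOpen Ω) {f : Vec d → ℝ} (hf : IntegrableOn f Ω)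
    (h : ∀ φ : Vec d → ℝ, ContDiff ℝ ∞ φ → HasCompactSupport φ → tsupport φ ⊆ Ω → ∀ k : Fin d,
      ∫ x in Ω, f x * fderiv ℝ φ x (EuclideanSpace.single k 1) = 0)
    {χ : Vec d → ℝ} (hχ : ContDiff ℝ ∞ χ) (hχc : HasCompactSupport χ) {x : Vec d}
    (hx : ∀ y, x - y ∈ tsupport χ → y ∈ Ω) :
    HasFDerivAt (χ ⋆[ContinuousLinearMap.lsmul ℝ ℝ, volume] (Ω.indicator f))
      (0 : Vec d →L[ℝ] ℝ) x := by
  set F := Ω.indicator f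
  have hF : Integrable F := hf.integrable_indicator hΩo.measurableSet
  have h1 := hχc.hasFDerivAt_convolution_left (ContinuousLinearMap.lsmul ℝ ℝ)
    (hχ.of_le (by simp)) hF.locallyIntegrable (μ := volume) x
  refine h1.congr_fderiv ?_
  have hDc : Continuous (fderiv ℝ χ) := hχ.continuous_fderiv (by simp)
  obtain ⟨C, hC⟩ := (hχc.fderiv (𝕜 := ℝ)).exists_bound_of_continuous hDc
  have hcomp : ∀ t (e : Vec d), ((ContinuousLinearMap.lsmul ℝ ℝ).precompL (Vec d)
      (fderiv ℝ χ (x - t)) (F t)) e = F t * fderiv ℝ χ (x - t) e := fun t e => by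
    rw [ContinuousLinearMap.precompL_apply]
    simp [mul_comm]
  have hint : Integrable fun t => (ContinuousLinearMap.lsmul ℝ ℝ).precompL (Vec d)
      (fderiv ℝ χ (x - t)) (F t) := by
    have heq : (fun t => (ContinuousLinearMap.lsmul ℝ ℝ).precompL (Vec d)
        (fderiv ℝ χ (x - t)) (F t)) = fun t => F t • fderiv ℝ χ (x - t) := by
      ext t e
      rw [hcomp]
      simp
    rw [heq]
    have hm : AEStronglyMeasurable (fun t => fderiv ℝ χ (x - t)) volume :=
      (hDc.comp (by fun_prop)).aestronglyMeasurable
    refine (hF.norm.const_mul C).mono' (hF.aestronglyMeasurable.smul hm)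
      (.of_forall fun t => ?_)
    rw [norm_smul, mul_comm]
    gcongr
    exact hC _
  rw [convolution_eq_swap]
  refine ContinuousLinearMap.coe_injective
    ((EuclideanSpace.basisFun (Fin d) ℝ).toBasis.ext fun k => ?_)
  simp only [OrthonormalBasis.coe_toBasis, EuclideanSpace.basisFun_apply,
    ContinuousLinearMap.coe_coe, ContinuousLinearMap.toLinearMap_zero, LinearMap.zero_apply]
  rw [ContinuousLinearMap.integral_apply hint]
  simp only [hcomp]
  have hψ : ContDiff ℝ ∞ fun y => χ (x - y) := hχ.comp (by fun_prop)
  have hψc : HasCompactSupport fun y => χ (x - y) := hχc.comp_homeomorph (Homeomorph.subLeft x)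
  have hψs : tsupport (fun y => χ (x - y)) ⊆ Ω := fun y hy =>
    hx y ((tsupport_comp_eq_preimage χ (Homeomorph.subLeft x)).subset hy)
  have hψD : ∀ y, fderiv ℝ (fun y => χ (x - y)) y (EuclideanSpace.single k 1)
      = -fderiv ℝ χ (x - y) (EuclideanSpace.single k 1) := fun y => by
    have h2 : HasFDerivAt (fun y => x - y) (-ContinuousLinearMap.id ℝ (Vec d)) y :=
      (hasFDerivAt_id y).const_sub x
    have h3 := (hχ.differentiable (by simp) (x - y)).hasFDerivAt.comp y h2
    have h4 : fderiv ℝ (fun y => χ (x - y)) y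
        = (fderiv ℝ χ (x - y)).comp (-ContinuousLinearMap.id ℝ (Vec d)) := h3.fderiv
    rw [h4]
    simp
  have h5 := h _ hψ hψc hψs k
  simp only [hψD, mul_neg, integral_neg, neg_eq_zero] at h5
  rw [← h5, ← integral_indicator hΩo.measurableSet]
  refine integral_congr_ae (.of_forall fun t => ?_)
  by_cases ht : t ∈ Ω <;> simp [F, ht]

open scoped Convolution in
/-- A function with vanishing weak gradient is locally constant: its mollifications are, and they
converge to it almost everywhere. -/
theorem exists_ae_eq_const_ball (hΩo : IsOpen Ω) {f : Vec d → ℝ} (hf : IntegrableOn f Ω)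
    (h : ∀ φ : Vec d → ℝ, ContDiff ℝ ∞ φ → HasCompactSupport φ → tsupport φ ⊆ Ω → ∀ k : Fin d,
      ∫ x in Ω, f x * fderiv ℝ φ x (EuclideanSpace.single k 1) = 0) {x₀ : Vec d} (hx₀ : x₀ ∈ Ω) :
    ∃ r > 0, ∃ c, ∀ᵐ x, x ∈ Metric.ball x₀ r → f x = c := by
  obtain ⟨R, hR, hb⟩ := Metric.isOpen_iff.1 hΩo x₀ hx₀
  set r := R / 2
  have hr : 0 < r := by positivity
  have hF : Integrable (Ω.indicator f) := hf.integrable_indicator hΩo.measurableSet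
  let b : ℕ → ContDiffBump (0 : Vec d) := fun n =>
    ⟨1 / ((n : ℝ) + 1) / 2, 1 / ((n : ℝ) + 1), by positivity, by
      have : (0 : ℝ) < 1 / ((n : ℝ) + 1) := by positivity
      linarith⟩
  have hb0 : Tendsto (fun n => (b n).rOut) atTop (𝓝 0) := tendsto_one_div_add_atTop_nhds_zero_nat
  have hlim := ContDiffBump.ae_convolution_tendsto_right_of_locallyIntegrable (μ := volume)
    (K := 2) hb0 (.of_forall fun n => by simp only [b]; linarith) hF.locallyIntegrable
  set g : ℕ → Vec d → ℝ := fun n =>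
    (b n).normed volume ⋆[ContinuousLinearMap.lsmul ℝ ℝ, volume] (Ω.indicator f)
  have hconst : ∀ᶠ n in atTop, ∀ x ∈ Metric.ball x₀ r, ∀ y ∈ Metric.ball x₀ r, g n x = g n y := by
    filter_upwards [hb0.eventually (gt_mem_nhds hr)] with n hn x hx y hy
    have hD : ∀ z ∈ Metric.ball x₀ r, HasFDerivAt (g n) (0 : Vec d →L[ℝ] ℝ) z := by
      intro z hz
      refine hasFDerivAt_convolution_zero hΩo hf h (b n).contDiff_normed
        (b n).hasCompactSupport_normed fun w hw => hb ?_
      rw [(b n).tsupport_normed_eq, mem_closedBall_zero_iff, ← dist_eq_norm, dist_comm] at hw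
      rw [Metric.mem_ball] at hz ⊢
      have := dist_triangle w z x₀
      simp only [r] at hn hz
      linarith
    exact Metric.isOpen_ball.is_const_of_fderiv_eq_zero (𝕜 := ℝ)
      (convex_ball x₀ r).isPreconnected
      (fun z hz => (hD z hz).differentiableAt.differentiableWithinAt)
      (fun z hz => (hD z hz).fderiv) hx hy
  obtain ⟨p, hp, hpb⟩ : ∃ p, Tendsto (fun n => g n p) atTop (𝓝 (Ω.indicator f p)) ∧
      p ∈ Metric.ball x₀ r := by
    by_contra! hcon
    have h0 : volume (Metric.ball x₀ r) = 0 := by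
      refine measure_mono_null (fun x hx => ?_) hlim
      exact fun hx' => hcon x hx' hx
    exact (Metric.measure_ball_pos volume x₀ hr).ne' h0
  refine ⟨r, hr, Ω.indicator f p, ?_⟩
  filter_upwards [hlim] with x hx hxb
  have hxΩ : x ∈ Ω := hb (Metric.ball_subset_ball (by simp only [r]; linarith) hxb)
  have h1 : Tendsto (fun n => g n x) atTop (𝓝 (Ω.indicator f p)) := by
    refine hp.congr' ?_
    filter_upwards [hconst] with n hn using hn p hpb x hxb
  have h2 := tendsto_nhds_unique hx h1
  rwa [Set.indicator_of_mem hxΩ] at h2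

/-- A function with vanishing weak gradient on a connected open set is constant. -/
theorem exists_ae_eq_const (hΩo : IsOpen Ω) (hΩc : IsConnected Ω) {f : Vec d → ℝ}
    (hf : IntegrableOn f Ω)
    (h : ∀ φ : Vec d → ℝ, ContDiff ℝ ∞ φ → HasCompactSupport φ → tsupport φ ⊆ Ω → ∀ k : Fin d,
      ∫ x in Ω, f x * fderiv ℝ φ x (EuclideanSpace.single k 1) = 0) :
    ∃ c, ∀ᵐ x ∂volume.restrict Ω, f x = c := by
  obtain ⟨x₁, hx₁⟩ := hΩc.nonempty
  obtain ⟨r₁, hr₁, c, hc⟩ := exists_ae_eq_const_ball hΩo hf h hx₁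
  -- the points near which `f = c` almost everywhere: these sets are open, disjoint and cover `Ω`
  let P : ℝ → Set (Vec d) := fun c => {x | ∃ U, IsOpen U ∧ x ∈ U ∧ ∀ᵐ y, y ∈ U → f y = c}
  have hPo : ∀ c, IsOpen (P c) := fun c => by
    refine isOpen_iff_forall_mem_open.2 fun x ⟨U, hU, hxU, hU'⟩ =>
      ⟨U, fun y hy => ⟨U, hU, hy, hU'⟩, hU, hxU⟩
  have hPd : ∀ c c', c ≠ c' → Disjoint (P c) (P c') := by
    intro c c' hcc'
    refine Set.disjoint_left.2 ?_
    rintro x ⟨U, hU, hxU, hU'⟩ ⟨V, hV, hxV, hV'⟩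
    have h0 : volume (U ∩ V) = 0 := by
      have : ∀ᵐ y, y ∉ U ∩ V := by
        filter_upwards [hU', hV'] with y h1 h2 h3
        exact hcc' ((h1 h3.1).symm.trans (h2 h3.2))
      exact measure_eq_zero_iff_ae_notMem.2 this
    exact ((hU.inter hV).measure_pos volume ⟨x, hxU, hxV⟩).ne' h0
  have hcov : Ω ⊆ P c ∪ ⋃ c' ∈ ({c}ᶜ : Set ℝ), P c' := by
    intro x hx
    obtain ⟨r, hr, c', hc'⟩ := exists_ae_eq_const_ball hΩo hf h hx
    have hx' : x ∈ P c' := ⟨_, Metric.isOpen_ball, Metric.mem_ball_self hr, hc'⟩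
    by_cases hcc' : c' = c
    · exact Or.inl (hcc' ▸ hx')
    · exact Or.inr (Set.mem_iUnion₂.2 ⟨c', hcc', hx'⟩)
  have hsub : Ω ⊆ P c := by
    refine hΩc.isPreconnected.subset_left_of_subset_union (hPo c)
      (isOpen_biUnion fun c' _ => hPo c') ?_ hcov
      ⟨x₁, hx₁, _, Metric.isOpen_ball, Metric.mem_ball_self hr₁, hc⟩
    exact Set.disjoint_iUnion₂_right.2 fun c' hc' => hPd c c' fun h => hc' h.symm
  refine ⟨c, ?_⟩
  rw [ae_restrict_iff' hΩo.measurableSet]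
  have h0 : volume {x | x ∈ Ω ∧ f x ≠ c} = 0 := by
    refine measure_null_of_locally_null _ fun x hx => ?_
    obtain ⟨U, hU, hxU, hU'⟩ := hsub hx.1
    refine ⟨U ∩ {x | x ∈ Ω ∧ f x ≠ c}, ?_, ?_⟩
    · exact inter_mem (mem_nhdsWithin_of_mem_nhds (hU.mem_nhds hxU)) self_mem_nhdsWithin
    · have : ∀ᵐ y, y ∉ U ∩ {x | x ∈ Ω ∧ f x ≠ c} := by
        filter_upwards [hU'] with y h1 h2
        exact h2.2.2 (h1 h2.1)
      exact measure_eq_zero_iff_ae_notMem.2 this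
  rw [ae_iff]
  refine measure_mono_null (fun x hx => ?_) h0
  simpa using hx

/-- If the symmetrized gradient vanishes, then so do the second derivatives:
`∂_k ∂_j u_i = ∂_k e_{ij} + ∂_j e_{ik} - ∂_i e_{jk}`. -/
theorem integral_grad_mul_fderiv_eq_zero {u : Vec d → Vec d} {G : Vec d → Mat d}
    (hG : IsWeakGradient Ω u G)
    (hskew : ∀ᵐ x ∂volume.restrict Ω, ∀ i j, G x (i, j) = -G x (j, i)) {φ : Vec d → ℝ}
    (hφ : ContDiff ℝ ∞ φ) (hφc : HasCompactSupport φ) (hφs : tsupport φ ⊆ Ω) (i j k : Fin d) :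
    ∫ x in Ω, G x (i, j) * fderiv ℝ φ x (EuclideanSpace.single k 1) = 0 := by
  set T : Fin d → Fin d → Fin d → ℝ := fun i j k =>
    ∫ x in Ω, G x (i, j) * fderiv ℝ φ x (EuclideanSpace.single k 1)
  have hsym : ∀ i j k, T i j k = T i k j := by
    have hT : ∀ i j k, T i j k = -∫ x in Ω, u x i * fderiv ℝ
        (fun y => fderiv ℝ φ y (EuclideanSpace.single k 1)) x (EuclideanSpace.single j 1) := by
      intro i j k
      have h1 : ContDiff ℝ ∞ fun y => fderiv ℝ φ y (EuclideanSpace.single k 1) :=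
        (hφ.fderiv_right (m := ∞) (by simp)).clm_apply contDiff_const
      have h2 := hG _ h1 (hφc.fderiv_apply ℝ _)
        ((tsupport_fderiv_apply_subset ℝ _).trans hφs) i j
      rw [h2, neg_neg]
    have hcomm : ∀ x (a b : Vec d), fderiv ℝ (fun y => fderiv ℝ φ y a) x b
        = fderiv ℝ (fun y => fderiv ℝ φ y b) x a := by
      intro x a b
      have hd : DifferentiableAt ℝ (fderiv ℝ φ) x :=
        ((hφ.fderiv_right (m := ∞) (by simp)).differentiable (by simp)) x
      have h3 : ∀ a : Vec d, fderiv ℝ (fun y => fderiv ℝ φ y a) x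
          = (fderiv ℝ (fderiv ℝ φ) x).flip a := fun a => by
        have := hd.hasFDerivAt.clm_apply (hasFDerivAt_const a x)
        rw [this.fderiv]
        ext; simp
      rw [h3, h3]
      exact (hφ.contDiffAt.isSymmSndFDerivAt (by
        rw [minSmoothness_of_isRCLikeNormedField]
        exact (WithTop.coe_le_coe.2 le_top :
          ((2 : ℕ∞) : WithTop ℕ∞) ≤ ((⊤ : ℕ∞) : WithTop ℕ∞)))) b a
    intro i j k
    rw [hT, hT]
    exact congrArg Neg.neg (integral_congr_ae (.of_forall fun x => congrArg _ (hcomm x _ _)))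
  have hanti : ∀ i j k, T i j k = -T j i k := by
    intro i j k
    rw [← integral_neg]
    refine integral_congr_ae ?_
    filter_upwards [hskew] with x hx
    rw [hx i j, neg_mul]
  -- a tensor that is symmetric in the last two and antisymmetric in the first two indices is zero
  have e1 := hsym i j k
  have e2 := hanti i k j
  have e3 := hsym k i j
  have e4 := hanti k j i
  have e5 := hsym j k i
  have e6 := hanti j i k
  show T i j k = 0
  linarith

/-- A displacement with vanishing strain is an infinitesimal rigid motion. -/
theorem exists_rigid (hΩo : IsOpen Ω) (hΩc : IsConnected Ω) (hΩb : Bornology.IsBounded Ω)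
    {v : Disp Ω} (hv : symGradL Ω v = 0) : ∃ (A : Vec d →L[ℝ] Vec d) (b : Vec d)
      (hA : ContDiff ℝ ∞ fun x => A x + b), symOp A = 0 ∧ v = smoothDisp hΩb hA := by
  have hfin : IsFiniteMeasure (volume.restrict Ω) :=
    ⟨by rw [Measure.restrict_apply_univ]; exact hΩb.measure_lt_top⟩
  have hne : (ae (volume.restrict Ω)).NeBot := by
    rw [ae_neBot, Ne, Measure.restrict_eq_zero]
    exact (hΩo.measure_pos volume hΩc.nonempty).ne'
  have hG : IsWeakGradient Ω (fieldOf v) (gradOf v) := v.2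
  have hsym : ∀ᵐ x ∂volume.restrict Ω, symMap d (gradOf v x) = 0 := by
    filter_upwards [coeFn_symGradL v, Lp.coeFn_zero (Mat d) 2 (volume.restrict Ω)] with x h1 h2
    rw [← h1, hv]
    exact h2
  have hskew : ∀ᵐ x ∂volume.restrict Ω, ∀ i j, gradOf v x (i, j) = -gradOf v x (j, i) := by
    filter_upwards [hsym] with x hx i j
    have h1 := symMap_apply (gradOf v x) i j
    rw [hx] at h1
    exact eq_neg_of_add_eq_zero_left h1.symm
  have hGi : ∀ ij, IntegrableOn (fun x => gradOf v x ij) Ω := fun ij =>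
    ((EuclideanSpace.proj (𝕜 := ℝ) ij).comp_memLp' (Lp.memLp (gradOf v))).integrable one_le_two
  have hui : ∀ i, IntegrableOn (fun x => fieldOf v x i) Ω := fun i =>
    ((EuclideanSpace.proj (𝕜 := ℝ) i).comp_memLp' (Lp.memLp (fieldOf v))).integrable one_le_two
  choose c hc using fun ij : Fin d × Fin d => exists_ae_eq_const hΩo hΩc (hGi ij)
    fun φ h1 h2 h3 k => integral_grad_mul_fderiv_eq_zero hG hskew h1 h2 h3 ij.1 ij.2 k
  set M : Mat d := WithLp.toLp 2 c
  have hM : ∀ᵐ x ∂volume.restrict Ω, gradOf v x = M := by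
    filter_upwards [ae_all_iff.2 hc] with x hx
    ext ij
    exact hx ij
  set A : Vec d →L[ℝ] Vec d := (matL d).symm M
  have hAM : matL d A = M := (matL d).apply_symm_apply M
  have hA0 : symOp A = 0 := by
    obtain ⟨x, h1, h2⟩ := (hsym.and hM).exists
    refine (matL d).injective ?_
    rw [map_zero, ← symMap_matL, hAM, ← h2, h1]
  have hAc : ContDiff ℝ ∞ fun x => A x := A.contDiff
  have hAg : ∀ x, classicalGradient (fun x => A x) x = M := fun x => by
    rw [classicalGradient_eq, ← hAM]
    exact congrArg _ A.fderiv
  have hwi : ∀ i, IntegrableOn (fun x => fieldOf v x i - A x i) Ω := fun i => by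
    have h1 : MemLp (fun x => A x) 2 (volume.restrict Ω) := memLp_of_continuous hΩb A.continuous
    exact (hui i).sub (((EuclideanSpace.proj (𝕜 := ℝ) i).comp_memLp' h1).integrable one_le_two)
  choose b hb using fun i : Fin d => exists_ae_eq_const hΩo hΩc (hwi i) fun φ h1 h2 h3 k => by
    have e1 := hG φ h1 h2 h3 i k
    have e2 := isWeakGradient_classicalGradient (Ω := Ω) hAc φ h1 h2 h3 i k
    have hD : Continuous fun x => fderiv ℝ φ x (EuclideanSpace.single k 1) :=
      (h1.continuous_fderiv (by simp)).clm_apply continuous_const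
    have hDc : HasCompactSupport fun x => fderiv ℝ φ x (EuclideanSpace.single k 1) :=
      h2.fderiv_apply ℝ _
    have i1 := integrable_coord_mul (fieldOf v) i hD hDc
    have i2 : Integrable (fun x => A x i * fderiv ℝ φ x (EuclideanSpace.single k 1))
        (volume.restrict Ω) := by
      have hAi : Continuous fun x => A x i := by fun_prop
      exact ((hAi.mul hD).integrable_of_hasCompactSupport hDc.mul_left).restrict
    have e3 : ∫ x in Ω, gradOf v x (i, k) * φ x
        = ∫ x in Ω, classicalGradient (fun x => A x) x (i, k) * φ x := by
      refine integral_congr_ae ?_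
      filter_upwards [hM] with x hx
      rw [hx, hAg]
    simp only [sub_mul]
    rw [integral_sub i1 i2, e1, e2, e3, sub_self]
  have hfield : ∀ᵐ x ∂volume.restrict Ω, fieldOf v x = A x + WithLp.toLp 2 b := by
    filter_upwards [ae_all_iff.2 hb] with x hx
    ext i
    exact sub_eq_iff_eq_add'.1 (hx i)
  have hAb : ContDiff ℝ ∞ fun x => A x + WithLp.toLp 2 b := hAc.add contDiff_const
  refine ⟨A, WithLp.toLp 2 b, hAb, hA0, disp_ext ?_ ?_⟩
  · have : fieldOf v = fieldOf (smoothDisp hΩb hAb) := by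
      refine Lp.ext ?_
      filter_upwards [hfield, fieldOf_smoothDisp hΩb hAb] with x h1 h2
      rw [h1, h2]
    exact this
  · have : gradOf v = gradOf (smoothDisp hΩb hAb) := by
      refine Lp.ext ?_
      filter_upwards [hM, gradOf_smoothDisp hΩb hAb] with x h1 h2
      rw [h1, h2, classicalGradient_eq, fderiv_add_const, ← hAM]
      exact congrArg _ A.fderiv.symm
    exact this

/-! ### Rigid motions that vanish on a part of the boundary -/

namespace IsChart

variable {x₀ n : Vec d} {r : ℝ} {γ : Vec d → ℝ}

theorem mem_frontier_of_height_eq_zero (h : IsChart Ω x₀ r n γ) (hΩo : IsOpen Ω) {y : Vec d}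
    (hy : y ∈ Metric.ball x₀ r) (hy0 : height n γ y = 0) : y ∈ frontier Ω := by
  rw [hΩo.frontier_eq]
  refine ⟨?_, fun hyΩ => ((h.mem_iff y hy).1 hyΩ).ne' hy0⟩
  have hlim : Tendsto (fun t : ℝ => y + t • n) (𝓝[>] 0) (𝓝 y) := by
    have hc : Continuous fun t : ℝ => y + t • n := by fun_prop
    have := (hc.tendsto 0).mono_left (nhdsWithin_le_nhds (s := Set.Ioi 0))
    simpa using this
  refine mem_closure_of_tendsto hlim ?_
  filter_upwards [hlim.eventually (Metric.isOpen_ball.mem_nhds hy), self_mem_nhdsWithin]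
    with t h1 h2
  rw [h.mem_iff _ h1, height_add_smul h.norm_eq, hy0, zero_add]
  exact h2

/-- The boundary near `x₀` contains the graph of `γ`. -/
theorem eventually_graph_mem (h : IsChart Ω x₀ r n γ) (hΩo : IsOpen Ω) (hx₀ : x₀ ∈ frontier Ω)
    {U : Set (Vec d)} (hU : IsOpen U) (hxU : x₀ ∈ U) :
    ∀ᶠ w : Hyper n in 𝓝 ⟨x₀ - ⟪n, x₀⟫_ℝ • n, sub_inner_smul_mem h.norm_eq x₀⟩,
      (w : Vec d) + γ w • n ∈ U ∩ frontier Ω := by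
  have hc : Continuous fun w : Hyper n => (w : Vec d) + γ w • n := by
    have := h.diff.continuous
    fun_prop
  have h0 := h.height_eq_zero hΩo (Metric.mem_ball_self h.pos) hx₀
  rw [height, sub_eq_zero] at h0
  have hval : (x₀ - ⟪n, x₀⟫_ℝ • n) + γ (x₀ - ⟪n, x₀⟫_ℝ • n) • n = x₀ := by
    rw [← h0]; abel
  have hV : U ∩ Metric.ball x₀ r ∈ 𝓝 ((x₀ - ⟪n, x₀⟫_ℝ • n) + γ (x₀ - ⟪n, x₀⟫_ℝ • n) • n) := by
    rw [hval]
    exact (hU.inter Metric.isOpen_ball).mem_nhds ⟨hxU, Metric.mem_ball_self h.pos⟩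
  filter_upwards [hc.continuousAt.eventually hV] with w hw
  refine ⟨hw.1, h.mem_frontier_of_height_eq_zero hΩo hw.2 ?_⟩
  rw [height_add_smul h.norm_eq, height, inner_hyper, zero_smul, sub_zero]
  ring

end IsChart

/-- Non-empty relatively open parts of the boundary have positive surface measure: their projection
onto the tangential hyperplane contains an open set. -/
theorem euclideanHausdorffMeasure_ne_zero (h : IsDomain Ω) {U : Set (Vec d)} (hU : IsOpen U)
    {x₀ : Vec d} (hx₀ : x₀ ∈ U ∩ frontier Ω) :
    (Measure.euclideanHausdorffMeasure (d - 1) : Measure (Vec d)) (U ∩ frontier Ω) ≠ 0 := by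
  intro h0
  obtain ⟨r, n, γ, hc⟩ := h.bdry.exists_isChart hx₀.2
  have hev := hc.eventually_graph_mem h.isOpen hx₀.2 hU hx₀.1
  let P : Vec d →L[ℝ] Hyper n :=
    (ContinuousLinearMap.fst ℝ (Hyper n) ℝ).comp ((hyperEquiv hc.norm_eq).symm : Vec d →L[ℝ] _)
  have hP : ∀ (w : Hyper n) (t : ℝ), P (w + t • n) = w := fun w t =>
    congrArg Prod.fst ((hyperEquiv hc.norm_eq).symm_apply_apply (w, t))
  have hvol : (Measure.euclideanHausdorffMeasure (d - 1) : Measure (Hyper n)) = volume := by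
    rw [← finrank_hyper h.one_le hc.norm_eq]
    exact InnerProductSpace.euclideanHausdorffMeasure_eq_volume
  have h1 := euclideanHausdorffMeasure_image_le (P.lipschitz.lipschitzOnWith (s := U ∩ frontier Ω))
    (d - 1)
  rw [h0, mul_zero, nonpos_iff_eq_zero, hvol] at h1
  refine (Measure.measure_pos_of_mem_nhds volume hev).ne' (measure_mono_null ?_ h1)
  intro w hw
  exact ⟨_, hw, hP w _⟩

/-- An infinitesimal rigid motion that vanishes on a piece of the boundary is zero. -/
theorem rigid_eq_zero (h : IsDomain Ω) {U : Set (Vec d)} (hU : IsOpen U) {x₀ : Vec d}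
    (hx₀ : x₀ ∈ U ∩ frontier Ω) {A : Vec d →L[ℝ] Vec d} {b : Vec d} (hA : symOp A = 0)
    (h0 : ∀ x ∈ U ∩ frontier Ω, A x + b = 0) : A = 0 ∧ b = 0 := by
  have hskew : ∀ x y, ⟪A x, y⟫_ℝ = -⟪x, A y⟫_ℝ := by
    intro x y
    have h1 : symOp A y = 0 := by rw [hA]; rfl
    rw [symOp, add_apply] at h1
    have h2 : ContinuousLinearMap.adjoint A y = -A y := eq_neg_of_add_eq_zero_right h1
    rw [← ContinuousLinearMap.adjoint_inner_right, h2, inner_neg_right]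
  obtain ⟨r, n, γ, hc⟩ := h.bdry.exists_isChart hx₀.2
  have hev := hc.eventually_graph_mem h.isOpen hx₀.2 hU hx₀.1
  set w₀ : Hyper n := ⟨x₀ - ⟪n, x₀⟫_ℝ • n, sub_inner_smul_mem hc.norm_eq x₀⟩
  have hnn : ⟪A n, n⟫_ℝ = 0 := by
    have h1 := hskew n n
    rw [real_inner_comm n (A n)] at h1
    linarith [real_inner_comm n (A n)]
  -- the difference of the points of the graph over `w₀ + ε e` and `w₀` lies in the kernel of `A`
  have key : ∀ e : Hyper n, ∃ ε : ℝ, ε ≠ 0 ∧ ∃ s : ℝ, A (ε • (e : Vec d) + s • n) = 0 := by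
    intro e
    have hc' : Tendsto (fun ε : ℝ => w₀ + ε • e) (𝓝[≠] 0) (𝓝 w₀) := by
      have hcc : Continuous fun ε : ℝ => w₀ + ε • e := by fun_prop
      have := (hcc.tendsto 0).mono_left (nhdsWithin_le_nhds (s := {0}ᶜ))
      simpa using this
    obtain ⟨ε, h1, h2⟩ := ((hc'.eventually hev).and self_mem_nhdsWithin).exists
    refine ⟨ε, h2, γ (w₀ + ε • e : Hyper n) - γ w₀, ?_⟩
    have e1 := h0 _ h1
    have e2 := h0 _ hev.self_of_nhds
    have e3 := sub_eq_zero.2 (e1.trans e2.symm)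
    rw [add_sub_add_right_eq_sub, ← map_sub] at e3
    rw [← e3]
    congr 1
    push_cast
    module
  -- by antisymmetry, `A n` is orthogonal to the kernel of `A` and to `n`
  have hAn : A n = 0 := by
    have h1 : ∀ e : Hyper n, ⟪A n, (e : Vec d)⟫_ℝ = 0 := by
      intro e
      obtain ⟨ε, hε, s, hs⟩ := key e
      have h2 : ⟪A n, ε • (e : Vec d) + s • n⟫_ℝ = 0 := by
        rw [hskew, hs, inner_zero_right, neg_zero]
      rw [inner_add_right, real_inner_smul_right, real_inner_smul_right, hnn, mul_zero,
        add_zero] at h2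
      exact (mul_eq_zero.1 h2).resolve_left hε
    refine ext_inner_right ℝ fun x => ?_
    have h3 := h1 ⟨x - ⟪n, x⟫_ℝ • n, sub_inner_smul_mem hc.norm_eq x⟩
    simp only at h3
    rw [inner_sub_right, real_inner_smul_right, hnn, mul_zero, sub_zero] at h3
    rw [h3, inner_zero_left]
  have hAe : ∀ e : Hyper n, A e = 0 := by
    intro e
    obtain ⟨ε, hε, s, hs⟩ := key e
    rw [map_add, map_smul, map_smul, hAn, smul_zero, add_zero] at hs
    exact (smul_eq_zero.1 hs).resolve_left hε
  have hA' : A = 0 := by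
    ext1 x
    have h3 := hAe ⟨x - ⟪n, x⟫_ℝ • n, sub_inner_smul_mem hc.norm_eq x⟩
    simp only at h3
    rw [map_sub, map_smul, hAn, smul_zero, sub_zero] at h3
    exact h3
  refine ⟨hA', ?_⟩
  have := h0 x₀ hx₀
  rwa [hA', zero_apply, zero_add] at this

/-- A field without strain that vanishes on a non-empty relatively open part of the boundary is
zero: it is a rigid motion, which vanishes almost everywhere on that part and hence, by continuity,
everywhere on it. -/
theorem eq_zero_of_mem_dispVanish (h : IsDomain Ω) (hΩc : IsConnected Ω) {Γ : Set (Vec d)}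
    (hΓ : IsOpenInBoundary Ω Γ) (hΓ0 : Γ.Nonempty) {v : Disp Ω} (hv : v ∈ dispVanish h Γ)
    (hv0 : symGradL Ω v = 0) : v = 0 := by
  obtain ⟨A, b, hAb, hA, rfl⟩ := exists_rigid h.isOpen hΩc h.isBounded hv0
  obtain ⟨t, ht, hvt⟩ := mem_graphPreimage.1 hv
  obtain ⟨C, -, hC⟩ := exists_norm_le_of_mem_traceGraph h
  have hmem : (smoothDisp h.isBounded hAb, smoothBdry (h.memLp_surf hAb)) ∈ traceGraph h :=
    Submodule.le_topologicalClosure _ ⟨_, hAb, rfl⟩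
  obtain rfl := eq_of_mem_graph hC hvt hmem
  have h1 := (mem_vanishOn hΓ _).1 ht
  have h2 : ∀ᵐ x ∂(Measure.euclideanHausdorffMeasure (d - 1) : Measure (Vec d)).restrict Γ,
      (smoothBdry (h.memLp_surf hAb)).asLp x = A x + b := by
    rw [← surf_restrict hΓ]
    exact ae_mono Measure.restrict_le_self (h.memLp_surf hAb).coeFn_toLp
  have h3 : ∀ᵐ x ∂(Measure.euclideanHausdorffMeasure (d - 1) : Measure (Vec d)).restrict Γ,
      A x + b = 0 := by
    filter_upwards [h1, h2] with x e1 e2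
    rw [← e2, e1]
  rw [ae_restrict_iff' hΓ.measurableSet] at h3
  obtain ⟨U, hU, rfl⟩ := hΓ
  have h4 : ∀ x ∈ U ∩ frontier Ω, A x + b = 0 := by
    by_contra! hcon
    obtain ⟨x, hx, hx0⟩ := hcon
    have hW : IsOpen (U ∩ {x | A x + b ≠ 0}) :=
      hU.inter (isOpen_ne_fun (by fun_prop) continuous_const)
    refine euclideanHausdorffMeasure_ne_zero h hW (x₀ := x) ⟨⟨hx.1, hx0⟩, hx.2⟩ ?_
    refine measure_eq_zero_iff_ae_notMem.2 ?_
    filter_upwards [h3] with y hy hy'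
    exact hy'.1.2 (hy ⟨hy'.1.1, hy'.2⟩)
  obtain ⟨x₀, hx₀⟩ := hΓ0
  obtain ⟨rfl, rfl⟩ := rigid_eq_zero h hU hx₀ hA h4
  refine disp_ext ?_ ?_
  · rw [map_zero]
    refine enorm_eq_zero.1 ((pow_eq_zero_iff two_ne_zero).1 ?_)
    rw [enorm_fieldL_smoothDisp]
    simp
  · rw [map_zero]
    refine enorm_eq_zero.1 ((pow_eq_zero_iff two_ne_zero).1 ?_)
    rw [enorm_gradL_smoothDisp]
    simp

/-! ### Korn's inequality and the derivative of the functional -/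

/-- An injective operator that is bounded below up to an operator of finite rank is bounded
below. -/
theorem exists_le_of_injOn {H X W : Type*} [NormedAddCommGroup H] [NormedSpace ℝ H]
    [CompleteSpace H] [NormedAddCommGroup X] [NormedSpace ℝ X] [NormedAddCommGroup W]
    [NormedSpace ℝ W] [ProperSpace W] {S : Submodule ℝ H} (hS : IsClosed (S : Set H))
    (T : H →L[ℝ] X) (Λ : H →L[ℝ] W) {C : ℝ} (hC : 0 ≤ C)
    (hest : ∀ v ∈ S, ‖v‖ ≤ C * (‖T v‖ + ‖Λ v‖)) (hinj : ∀ v ∈ S, T v = 0 → v = 0) :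
    ∃ c > 0, ∀ v ∈ S, c * ‖v‖ ^ 2 ≤ ‖T v‖ ^ 2 := by
  by_contra! hcon
  -- otherwise there are unit vectors with `T w` tending to zero; as `Λ w` may be taken to converge,
  -- they form a Cauchy sequence, and its limit contradicts injectivity
  have hex : ∀ k : ℕ, ∃ w ∈ S, ‖w‖ = 1 ∧ ‖T w‖ ^ 2 ≤ 1 / ((k : ℝ) + 1) := by
    intro k
    obtain ⟨v, hv, hlt⟩ := hcon (1 / ((k : ℝ) + 1)) (by positivity)
    have hv0 : ‖v‖ ≠ 0 := fun h0 => by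
      rw [h0] at hlt
      have := sq_nonneg ‖T v‖
      simp at hlt
      linarith
    refine ⟨‖v‖⁻¹ • v, S.smul_mem _ hv, ?_, ?_⟩
    · rw [norm_smul, norm_inv, norm_norm, inv_mul_cancel₀ hv0]
    · rw [map_smul, norm_smul, norm_inv, norm_norm, mul_pow, inv_pow,
        inv_mul_le_iff₀ (by positivity)]
      linarith
  choose w hwS hw1 hwT using hex
  have hT0 : Tendsto (fun k => ‖T (w k)‖) atTop (𝓝 0) := by
    have h1 : Tendsto (fun k => ‖T (w k)‖ ^ 2) atTop (𝓝 0) :=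
      squeeze_zero (fun k => sq_nonneg _) hwT tendsto_one_div_add_atTop_nhds_zero_nat
    have h2 := h1.sqrt
    simpa [Real.sqrt_sq] using h2
  obtain ⟨y, -, φ, hφ, hy⟩ := tendsto_subseq_of_bounded (x := fun k => Λ (w k))
    (Metric.isBounded_closedBall (x := (0 : W)) (r := ‖Λ‖)) fun k => by
      rw [mem_closedBall_zero_iff]
      simpa [hw1 k] using Λ.le_opNorm (w k)
  have hTφ : Tendsto (fun k => T (w (φ k))) atTop (𝓝 0) :=
    tendsto_zero_iff_norm_tendsto_zero.2 (hT0.comp hφ.tendsto_atTop)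
  have hpair : CauchySeq fun k => (T (w (φ k)), Λ (w (φ k))) := (hTφ.prodMk_nhds hy).cauchySeq
  have hcauchy : CauchySeq fun k => w (φ k) := by
    rw [Metric.cauchySeq_iff] at hpair ⊢
    intro ε hε
    obtain ⟨N, hN⟩ := hpair (ε / (2 * C + 1)) (by positivity)
    refine ⟨N, fun m hm n hn => ?_⟩
    have h1 := hN m hm n hn
    rw [Prod.dist_eq, max_lt_iff, dist_eq_norm, dist_eq_norm, ← map_sub, ← map_sub] at h1
    have h2 := hest _ (S.sub_mem (hwS (φ m)) (hwS (φ n)))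
    rw [dist_eq_norm]
    have h3 : ε / (2 * C + 1) * (2 * C + 1) = ε := div_mul_cancel₀ _ (by positivity)
    have h4 : 0 < ε / (2 * C + 1) := by positivity
    nlinarith [h1.1, h1.2]
  obtain ⟨v, hv⟩ := cauchySeq_tendsto_of_complete hcauchy
  have hvS : v ∈ S := hS.mem_of_tendsto hv (.of_forall fun k => hwS _)
  have hTv : T v = 0 := tendsto_nhds_unique ((T.continuous.tendsto v).comp hv) hTφ
  have hv1 : ‖v‖ = 1 := tendsto_nhds_unique hv.norm (by simp [hw1])
  rw [hinj v hvS hTv, norm_zero] at hv1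
  exact zero_ne_one hv1

/-- `L²` control by finitely many functionals, as an inequality between real numbers. -/
theorem exists_finset_norm_fieldL_le (h : IsDomain Ω) {ε : ℝ} (hε : 0 < ε) :
    ∃ (s : Finset (L2Vec Ω)) (C : ℝ), 0 ≤ C ∧ ∀ (φ : Vec d → Vec d) (hφ : ContDiff ℝ ∞ φ),
      ‖fieldL Ω (smoothDisp h.isBounded hφ)‖ ^ 2 ≤ ε * ‖smoothDisp h.isBounded hφ‖ ^ 2
        + C * ∑ Ψ ∈ s, ‖⟪Ψ, fieldL Ω (smoothDisp h.isBounded hφ)⟫_ℝ‖ ^ 2 := by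
  obtain ⟨s, C, hC, hs⟩ := finitelyControlled h.isBounded h.isOpen h.bdry (ENNReal.ofReal ε)
    (ENNReal.ofReal_pos.2 hε).ne'
  refine ⟨s, C.toReal, ENNReal.toReal_nonneg, fun φ hφ => ?_⟩
  have h1 := hs φ hφ
  rw [← enorm_fieldL_smoothDisp h.isBounded hφ] at h1
  have hsum : ∑ Ψ ∈ s, ‖⟪Ψ, fieldL Ω (smoothDisp h.isBounded hφ)⟫_ℝ‖ₑ ^ 2 ≠ ⊤ :=
    ENNReal.sum_ne_top.2 fun Ψ _ => by finiteness
  have h2 := ENNReal.toReal_mono (by finiteness) h1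
  rw [ENNReal.toReal_add (by finiteness) (by finiteness), ENNReal.toReal_mul, ENNReal.toReal_mul,
    ENNReal.toReal_ofReal hε.le, ENNReal.toReal_sum fun Ψ _ => by finiteness] at h2
  simpa only [ENNReal.toReal_pow, toReal_enorm] using h2

/-- The compactness argument behind Korn's inequality. If `G` is controlled by `E` and `F` (Korn's
second inequality), and `F` is controlled by finitely many functionals up to a small multiple of the
norm (Rellich), then `E` is bounded below on every closed subspace on which it is injective. -/
theorem exists_le_of_korn {H X Y Z : Type*} [NormedAddCommGroup H] [NormedSpace ℝ H]
    [CompleteSpace H] [NormedAddCommGroup X] [NormedSpace ℝ X] [NormedAddCommGroup Y]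
    [InnerProductSpace ℝ Y] [NormedAddCommGroup Z] [NormedSpace ℝ Z]
    {F : H →L[ℝ] Y} {G : H →L[ℝ] Z} {E : H →L[ℝ] X}
    (hFG : ∀ v, ‖v‖ ^ 2 = ‖F v‖ ^ 2 + ‖G v‖ ^ 2) {D : Set H} {C : ℝ} (hC : 0 ≤ C)
    (hkorn : ∀ v ∈ D, ‖G v‖ ^ 2 ≤ C * (‖E v‖ ^ 2 + ‖F v‖ ^ 2))
    (hrellich : ∀ ε : ℝ, 0 < ε → ∃ (s : Finset Y) (C' : ℝ), 0 ≤ C' ∧ ∀ v ∈ D,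
      ‖F v‖ ^ 2 ≤ ε * ‖v‖ ^ 2 + C' * ∑ Ψ ∈ s, ‖⟪Ψ, F v⟫_ℝ‖ ^ 2)
    {S : Submodule ℝ H} (hS : IsClosed (S : Set H)) (hSD : (S : Set H) ⊆ closure D)
    (hinj : ∀ v ∈ S, E v = 0 → v = 0) : ∃ c > 0, ∀ v ∈ S, c * ‖v‖ ^ 2 ≤ ‖E v‖ ^ 2 := by
  -- with this `ε`, the term with `‖v‖ ^ 2` can be absorbed
  obtain ⟨s, C', hC', hs⟩ := hrellich (1 / (2 * (1 + C))) (by positivity)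
  let Λ : H →L[ℝ] (s → ℝ) :=
    ContinuousLinearMap.pi fun Ψ => (innerSL ℝ (Ψ : Y)).comp F
  have hΛ : ∀ v : H, ∑ Ψ ∈ s, ‖⟪Ψ, F v⟫_ℝ‖ ^ 2 ≤ s.card * ‖Λ v‖ ^ 2 := by
    intro v
    rw [← nsmul_eq_mul]
    refine Finset.sum_le_card_nsmul _ _ _ fun Ψ hΨ => ?_
    have : ‖⟪Ψ, F v⟫_ℝ‖ ≤ ‖Λ v‖ := norm_le_pi_norm (Λ v) ⟨Ψ, hΨ⟩
    gcongr
  set K := 2 * C + 2 * (1 + C) * C' * s.card with hKdef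
  have hK : 0 ≤ K := by positivity
  have hsmooth : ∀ v ∈ D, ‖v‖ ≤ √K * (‖E v‖ + ‖Λ v‖) := by
    intro v hv
    have h1 := hkorn v hv
    have h3 := hFG v
    have h5 : (1 + C) * ‖F v‖ ^ 2 ≤ ‖v‖ ^ 2 / 2 + (1 + C) * (C' * (s.card * ‖Λ v‖ ^ 2)) := by
      calc (1 + C) * ‖F v‖ ^ 2 ≤ (1 + C) * (1 / (2 * (1 + C)) * ‖v‖ ^ 2
            + C' * (s.card * ‖Λ v‖ ^ 2)) := by
            refine mul_le_mul_of_nonneg_left ((hs v hv).trans ?_) (by positivity)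
            gcongr
            exact hΛ v
        _ = _ := by
            field_simp
    have h6 : ‖v‖ ^ 2 ≤ K * (‖E v‖ ^ 2 + ‖Λ v‖ ^ 2) := by
      have p1 : 0 ≤ 2 * (1 + C) * C' * s.card * ‖E v‖ ^ 2 := by positivity
      have p2 : 0 ≤ 2 * C * ‖Λ v‖ ^ 2 := by positivity
      rw [hKdef]
      linarith
    refine (abs_le_of_sq_le_sq' ?_ (by positivity)).2
    rw [mul_pow, Real.sq_sqrt hK]
    refine h6.trans (mul_le_mul_of_nonneg_left ?_ hK)
    nlinarith [norm_nonneg (E v), norm_nonneg (Λ v)]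
  have hcl : IsClosed {v : H | ‖v‖ ≤ √K * (‖E v‖ + ‖Λ v‖)} :=
    isClosed_le (by fun_prop) (by fun_prop)
  exact exists_le_of_injOn hS E Λ (Real.sqrt_nonneg K)
    (fun v hv => closure_minimal hsmooth hcl (hSD hv)) hinj

/-- Korn's inequality for fields that vanish on a part of the boundary. -/
theorem exists_korn (h : IsDomain Ω) (hΩc : IsConnected Ω) {Γ : Set (Vec d)}
    (hΓ : IsOpenInBoundary Ω Γ) (hΓ0 : Γ.Nonempty) :
    ∃ c > 0, ∀ v ∈ dispVanish h Γ, c * ‖v‖ ^ 2 ≤ ‖symGradL Ω v‖ ^ 2 := by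
  obtain ⟨C, hC, hkorn⟩ := exists_korn_smooth h.isOpen h.isBounded h.bdry
  let D : Set (Disp Ω) := {v | ∃ (φ : Vec d → Vec d) (hφ : ContDiff ℝ ∞ φ),
    v = smoothDisp h.isBounded hφ}
  refine exists_le_of_korn (F := fieldL Ω) (G := gradL Ω) (E := symGradL Ω) norm_sq_Disp (D := D)
    hC ?_ ?_ (isClosed_dispVanish h Γ) ?_
    (fun v hv hv0 => eq_zero_of_mem_dispVanish h hΩc hΓ hΓ0 hv hv0)
  · rintro _ ⟨φ, hφ, rfl⟩
    exact hkorn φ hφ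
  · intro ε hε
    obtain ⟨s, C', hC', hs⟩ := exists_finset_norm_fieldL_le h hε
    refine ⟨s, C', hC', ?_⟩
    rintro _ ⟨φ, hφ, rfl⟩
    exact hs φ hφ
  · intro v hv
    obtain ⟨t, -, hvt⟩ := mem_graphPreimage.1 hv
    have hcl : IsClosed {p : Disp Ω × L2Bdry Ω | p.1 ∈ closure D} :=
      isClosed_closure.preimage continuous_fst
    refine closure_minimal ?_ hcl hvt
    rintro _ ⟨φ, hφ, rfl⟩
    exact subset_closure ⟨φ, hφ, rfl⟩

/-- The derivative of the Kohn–Vogelius functional, for an abstract pair of variational problems: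
`u_N` minimizes over `V` an energy with load `L`, and `u_D` minimizes the energy without load over
`u₀ + V₀`. As `L` vanishes on `V₀`, the mixed term `B(u_N, u_D) = L(u_D)` does not depend on the
parameter. -/
theorem hasFDerivAt_gap {P H : Type*} [NormedAddCommGroup P] [NormedSpace ℝ P]
    [NormedAddCommGroup H] [InnerProductSpace ℝ H] (B : P →L[ℝ] H →L[ℝ] H →L[ℝ] ℝ)
    (hBs : ∀ p u v, B p u v = B p v u) {V V₀ : Submodule ℝ H} (hV : V₀ ≤ V) {L : V →L[ℝ] ℝ}
    (hL : ∀ v (hv : v ∈ V), v ∈ V₀ → L ⟨v, hv⟩ = 0) {u₀ : H} (hu₀ : u₀ ∈ V) {U : Set P}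
    (hU : IsOpen U) {uN uD : P → H} (hN : ∀ q ∈ U, uN q ∈ V)
    (hN' : ∀ q ∈ U, ∀ v (hv : v ∈ V), B q (uN q) v = L ⟨v, hv⟩)
    (hD : ∀ q ∈ U, uD q - u₀ ∈ V₀) (hD' : ∀ q ∈ U, ∀ v ∈ V₀, B q (uD q) v = 0) {p : P}
    (hp : p ∈ U) {c : ℝ} (hc : 0 < c) (hcoer : ∀ v ∈ V, c * ‖v‖ ^ 2 ≤ B p v v) :
    HasFDerivAt (fun q => B q (uN q - uD q) (uN q - uD q))
      ((B.flip (uD p)).flip (uD p) - (B.flip (uN p)).flip (uN p)) p := by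
  have hev : ∀ᶠ q in 𝓝 p, q ∈ U := hU.mem_nhds hp
  -- the Neumann energy
  have h1 : HasFDerivAt (fun q => -B q (uN q) (uN q)) ((B.flip (uN p)).flip (uN p)) p := by
    refine hasFDerivAt_energy B hc hcoer (u := uN) ?_ ?_ ?_
    · filter_upwards [hev] with q hq using V.sub_mem (hN q hq) (hN p hp)
    · filter_upwards [hev] with q hq v hv
      rw [hN' q hq v hv, hN' p hp v hv]
    · filter_upwards [hev] with q hq
      have e1 := (hN' q hq _ (hN p hp)).trans (hN' p hp _ (hN p hp)).symm
      have e2 := (hN' q hq _ (hN q hq)).trans (hN' p hp _ (hN q hq)).symm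
      have e3 := hBs p (uN p) (uN q)
      simp only [map_sub, sub_apply]
      linarith
  -- the Dirichlet energy
  have hsub : ∀ q ∈ U, uD q - uD p ∈ V₀ := fun q hq => by
    have := V₀.sub_mem (hD q hq) (hD p hp)
    rwa [sub_sub_sub_cancel_right] at this
  have h2 : HasFDerivAt (fun q => B q (uD q) (uD q)) ((B.flip (uD p)).flip (uD p)) p := by
    refine hasFDerivAt_energy B hc (fun v hv => hcoer v (hV hv)) (u := uD) ?_ ?_ ?_
    · filter_upwards [hev] with q hq using hsub q hq
    · filter_upwards [hev] with q hq v hv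
      rw [hD' q hq v hv, hD' p hp v hv]
    · filter_upwards [hev] with q hq
      have e1 := hD' q hq _ (hsub q hq)
      have e2 := hD' p hp _ (hsub q hq)
      have e3 := hBs p (uD p) (uD q)
      simp only [map_sub, sub_apply] at e1 e2 ⊢
      linarith
  refine ((h2.sub h1).add_const (-2 * L ⟨u₀, hu₀⟩)).congr_of_eventuallyEq ?_
  filter_upwards [hev] with q hq
  have hDV : uD q ∈ V := by
    have := V.add_mem (hV (hD q hq)) hu₀
    rwa [sub_add_cancel] at this
  have e1 : B q (uN q) (uD q) = L ⟨u₀, hu₀⟩ := by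
    rw [hN' q hq _ hDV]
    have e2 := hL _ (hV (hD q hq)) (hD q hq)
    have e3 : (⟨uD q - u₀, hV (hD q hq)⟩ : V) = ⟨uD q, hDV⟩ - ⟨u₀, hu₀⟩ := rfl
    rw [e3, map_sub] at e2
    exact sub_eq_zero.1 e2
  have e4 := hBs q (uN q) (uD q)
  simp only [map_sub, sub_apply, Pi.sub_apply]
  linarith

theorem traceEqOn_iff (h : IsDomain Ω) {Γ : Set (Vec d)} {f : Vec d → Vec d} (u : Disp Ω) :
    TraceEqOn (u : H1 Ω) Γ f ↔ ∃ t : L2Bdry Ω, (u, t) ∈ traceGraph h ∧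
      ∀ᵐ x ∂(Measure.euclideanHausdorffMeasure (d - 1) : Measure (Vec d)).restrict Γ,
        t.asLp x = f x := by
  constructor
  · rintro ⟨t, h1, h2⟩
    exact ⟨t, (isTrace_iff_mem h u t).1 h1, h2⟩
  · rintro ⟨t, h1, h2⟩
    exact ⟨t, (isTrace_iff_mem h u t).2 h1, h2⟩

/-- Fields with the same trace on `Γ` differ by a field that vanishes there. -/
theorem traceEqOn_iff_sub_mem (h : IsDomain Ω) {Γ : Set (Vec d)} (hΓ : IsOpenInBoundary Ω Γ)
    {f : Vec d → Vec d} {u₀ : Disp Ω} (hu₀ : TraceEqOn (u₀ : H1 Ω) Γ f) (u : Disp Ω) :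
    TraceEqOn (u : H1 Ω) Γ f ↔ u - u₀ ∈ dispVanish h Γ := by
  obtain ⟨t₀, hm₀, hf₀⟩ := (traceEqOn_iff h u₀).1 hu₀
  refine (traceEqOn_iff h u).trans (Iff.trans ?_ mem_graphPreimage.symm)
  constructor
  · rintro ⟨t, hm, hf⟩
    refine ⟨t - t₀, ?_, (traceGraph h).sub_mem hm hm₀⟩
    rw [mem_vanishOn hΓ]
    have hs : ∀ᵐ x ∂(Measure.euclideanHausdorffMeasure (d - 1) : Measure (Vec d)).restrict Γ,
        (t - t₀).asLp x = t.asLp x - t₀.asLp x := by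
      rw [← surf_restrict hΓ]
      exact ae_mono Measure.restrict_le_self (Lp.coeFn_sub t.asLp t₀.asLp)
    filter_upwards [hf, hf₀, hs] with x h1 h2 h3
    rw [h3, h1, h2, sub_self]
  · rintro ⟨y, hy, hm⟩
    have hmem := (traceGraph h).add_mem hm hm₀
    rw [Prod.mk_add_mk, sub_add_cancel] at hmem
    refine ⟨y + t₀, hmem, ?_⟩
    have hs : ∀ᵐ x ∂(Measure.euclideanHausdorffMeasure (d - 1) : Measure (Vec d)).restrict Γ,
        (y + t₀).asLp x = y.asLp x + t₀.asLp x := by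
      rw [← surf_restrict hΓ]
      exact ae_mono Measure.restrict_le_self (Lp.coeFn_add y.asLp t₀.asLp)
    filter_upwards [(mem_vanishOn hΓ y).1 hy, hf₀, hs] with x h1 h2 h3
    rw [h3, h1, h2, zero_add]

/-- The energy is coercive on the fields that vanish on a part of the boundary. -/
theorem exists_coercive (h : IsDomain Ω) (hΩc : IsConnected Ω) {Γ : Set (Vec d)}
    (hΓ : IsOpenInBoundary Ω Γ) (hΓ0 : Γ.Nonempty) {p : LInf Ω × LInf Ω}
    (hp : p ∈ LInfPos Ω ×ˢ LInfPos Ω) :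
    ∃ c > 0, ∀ v ∈ dispVanish h Γ, c * ‖v‖ ^ 2 ≤ elasticL Ω p v v := by
  obtain ⟨c, hc, h1⟩ := exists_korn h hΩc hΓ hΓ0
  obtain ⟨c', hc', h2⟩ := exists_le_elasticL hp
  refine ⟨c' * c, by positivity, fun v hv => ?_⟩
  calc c' * c * ‖v‖ ^ 2 = c' * (c * ‖v‖ ^ 2) := mul_assoc _ _ _
    _ ≤ c' * ‖symGradL Ω v‖ ^ 2 := mul_le_mul_of_nonneg_left (h1 v hv) hc'.le
    _ ≤ _ := h2 v

/-- The weak formulation of the Neumann problem, in terms of bounded forms. -/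
theorem isNeumannSolution_iff (h : IsDomain Ω) {ΓD ΓN : Set (Vec d)}
    (hΓD : IsOpenInBoundary Ω ΓD) {g : L2Surface ΓN} {L : dispVanish h ΓD →L[ℝ] ℝ}
    (hL : ∀ (v : Disp Ω) (hv : v ∈ dispVanish h ΓD) (t : L2Surface (frontier Ω)),
      IsTrace (v : H1 Ω) t → L ⟨v, hv⟩ = ∫ x in ΓN, ⟪g x, t x⟫_ℝ
        ∂(Measure.euclideanHausdorffMeasure (d - 1) : Measure (Vec d)))
    (p : LInf Ω × LInf Ω) (u : Disp Ω) : IsNeumannSolution ΓD ΓN g p u ↔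
      u ∈ dispVanish h ΓD ∧ ∀ v (hv : v ∈ dispVanish h ΓD), elasticL Ω p u v = L ⟨v, hv⟩ := by
  refine and_congr (mem_dispVanish_iff h hΓD u).symm ?_
  constructor
  · intro hu v hv
    have hv' := (mem_dispVanish_iff h hΓD v).1 hv
    obtain ⟨t, ht, -⟩ := id hv'
    exact (elasticForm_eq p u v).symm.trans ((hu v hv' t ht).trans (hL v hv t ht).symm)
  · intro hu v hv t ht
    have hv' := (mem_dispVanish_iff h hΓD v).2 hv
    exact (elasticForm_eq p u v).trans ((hu v hv').trans (hL v hv' t ht))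

/-- The weak formulation of the Dirichlet problem, in terms of bounded forms. -/
theorem isDirichletSolution_iff (h : IsDomain Ω) {ΓD ΓN : Set (Vec d)}
    (hΓD : IsOpenInBoundary Ω ΓD) (hΓN : IsOpenInBoundary Ω ΓN) {f : L2Surface ΓN} {u₀ : Disp Ω}
    (hu₀ : u₀ ∈ dispVanish h ΓD) (hf : TraceEqOn (u₀ : H1 Ω) ΓN f)
    (p : LInf Ω × LInf Ω) (u : Disp Ω) : IsDirichletSolution ΓD ΓN f p u ↔
      u - u₀ ∈ dispVanish h ΓN ⊓ dispVanish h ΓD ∧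
        ∀ v ∈ dispVanish h ΓN ⊓ dispVanish h ΓD, elasticL Ω p u v = 0 := by
  have hD : TraceEqOn (u : H1 Ω) ΓD 0 ↔ u - u₀ ∈ dispVanish h ΓD := by
    rw [← mem_dispVanish_iff h hΓD u]
    exact (Submodule.sub_mem_iff_left _ hu₀).symm
  rw [Submodule.mem_inf, and_assoc]
  refine and_congr (traceEqOn_iff_sub_mem h hΓN hf u) (and_congr hD ?_)
  constructor
  · intro hu v hv
    exact (elasticForm_eq p u v).symm.trans
      (hu v ((mem_dispVanish_iff h hΓN v).1 hv.1) ((mem_dispVanish_iff h hΓD v).1 hv.2))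
  · intro hu v hv hv'
    exact (elasticForm_eq p u v).trans
      (hu v ⟨(mem_dispVanish_iff h hΓN v).2 hv, (mem_dispVanish_iff h hΓD v).2 hv'⟩)

/-! ### Solutions of the boundary value problems -/

theorem existsUnique_neumannSolution (h : IsDomain Ω) (hΩc : IsConnected Ω) {ΓD ΓN : Set (Vec d)}
    (hΓD : IsOpenInBoundary Ω ΓD) (hΓD0 : ΓD.Nonempty) (hΓN : IsOpenInBoundary Ω ΓN)
    (g : L2Surface ΓN) {p : LInf Ω × LInf Ω} (hp : p ∈ LInfPos Ω ×ˢ LInfPos Ω) :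
    ∃! u : H1 Ω, IsNeumannSolution ΓD ΓN g p u := by
  obtain ⟨L, hL⟩ := exists_load h ΓD hΓN g
  obtain ⟨c, hc, hcoer⟩ := exists_coercive h hΩc hΓD hΓD0 hp
  obtain ⟨u, hu, hu'⟩ := exists_solution_of_coercive (isClosed_dispVanish h ΓD)
    (elasticL Ω p) hc hcoer L
  refine ⟨u, (isNeumannSolution_iff h hΓD hL p u).2 ⟨hu, hu'⟩, fun u' h' => ?_⟩
  obtain ⟨h1, h2⟩ := (isNeumannSolution_iff h hΓD hL p u').1 h'
  exact eq_of_coercive (S := dispVanish h ΓD) (elasticL Ω p) hc hcoer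
    ((dispVanish h ΓD).sub_mem h1 hu) fun v hv => (h2 v hv).trans (hu' v hv).symm

theorem existsUnique_dirichletSolution (h : IsDomain Ω) (hΩc : IsConnected Ω)
    {ΓD ΓN : Set (Vec d)} (hΓD : IsOpenInBoundary Ω ΓD) (hΓD0 : ΓD.Nonempty)
    (hΓN : IsOpenInBoundary Ω ΓN) {f : L2Surface ΓN} (hf : f ∈ HHalf Ω ΓD ΓN)
    {p : LInf Ω × LInf Ω} (hp : p ∈ LInfPos Ω ×ˢ LInfPos Ω) :
    ∃! u : H1 Ω, IsDirichletSolution ΓD ΓN f p u := by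
  obtain ⟨u₀, hu₀, hf₀⟩ : ∃ u₀ : Disp Ω, u₀ ∈ dispVanish h ΓD ∧ TraceEqOn (u₀ : H1 Ω) ΓN f :=
    let ⟨u, hu, hf⟩ := hf
    ⟨u, (mem_dispVanish_iff h hΓD u).2 hu, hf⟩
  obtain ⟨c, hc, hcoer⟩ := exists_coercive h hΩc hΓD hΓD0 hp
  set V₀ := dispVanish h ΓN ⊓ dispVanish h ΓD
  have hV₀ : IsClosed (V₀ : Set (Disp Ω)) :=
    (isClosed_dispVanish h ΓN).inter (isClosed_dispVanish h ΓD)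
  have hcoer₀ : ∀ v ∈ V₀, c * ‖v‖ ^ 2 ≤ elasticL Ω p v v := fun v hv => hcoer v hv.2
  obtain ⟨w, hw, hw'⟩ := exists_solution_of_coercive hV₀ (elasticL Ω p) hc hcoer₀
    (-(elasticL Ω p u₀).comp V₀.subtypeL)
  have hsol : ∀ v ∈ V₀, elasticL Ω p (w + u₀) v = 0 := fun v hv => by
    rw [map_add, add_apply, hw' v hv]
    exact neg_add_cancel _
  have huniq : ∀ u : Disp Ω, u - u₀ ∈ V₀ → (∀ v ∈ V₀, elasticL Ω p u v = 0) → u = w + u₀ := by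
    intro u h1 h2
    refine eq_of_coercive (S := V₀) (elasticL Ω p) hc hcoer₀ ?_
      fun v hv => (h2 v hv).trans (hsol v hv).symm
    have := V₀.sub_mem h1 hw
    rwa [sub_sub, add_comm] at this
  refine ⟨(w + u₀ : Disp Ω), (isDirichletSolution_iff h hΓD hΓN hu₀ hf₀ p (w + u₀ : Disp Ω)).2
    ⟨by rw [add_sub_cancel_right]; exact hw, hsol⟩, fun u' h' => ?_⟩
  obtain ⟨h1, h2⟩ := (isDirichletSolution_iff h hΓD hΓN hu₀ hf₀ p u').1 h'
  exact huniq u' h1 h2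

/-- The load does not act on the fields that vanish on `Γ_N`. -/
theorem load_eq_zero (h : IsDomain Ω) {ΓD ΓN : Set (Vec d)} (hΓN : IsOpenInBoundary Ω ΓN)
    {g : L2Surface ΓN} {L : dispVanish h ΓD →L[ℝ] ℝ}
    (hL : ∀ (v : Disp Ω) (hv : v ∈ dispVanish h ΓD) (t : L2Surface (frontier Ω)),
      IsTrace (v : H1 Ω) t → L ⟨v, hv⟩ = ∫ x in ΓN, ⟪g x, t x⟫_ℝ
        ∂(Measure.euclideanHausdorffMeasure (d - 1) : Measure (Vec d)))
    (v : Disp Ω) (hv : v ∈ dispVanish h ΓD) (hvN : v ∈ dispVanish h ΓN) : L ⟨v, hv⟩ = 0 := by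
  obtain ⟨t, ht, ht0⟩ := (mem_dispVanish_iff h hΓN v).1 hvN
  rw [hL v hv t ht]
  refine integral_eq_zero_of_ae ?_
  filter_upwards [ht0] with x hx
  rw [hx]
  exact inner_zero_right _

theorem isNeumannSolution_neumannSolution {ΓD ΓN : Set (Vec d)} {g : L2Surface ΓN}
    {p : LInf Ω × LInf Ω} (h : ∃ u : H1 Ω, IsNeumannSolution ΓD ΓN g p u) :
    IsNeumannSolution ΓD ΓN g p (neumannSolution ΓD ΓN g p) := by
  rw [neumannSolution, dif_pos h]
  exact h.choose_spec

theorem isDirichletSolution_dirichletSolution {ΓD ΓN : Set (Vec d)} {f : L2Surface ΓN}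
    {p : LInf Ω × LInf Ω} (h : ∃ u : H1 Ω, IsDirichletSolution ΓD ΓN f p u) :
    IsDirichletSolution ΓD ΓN f p (dirichletSolution ΓD ΓN f p) := by
  rw [dirichletSolution, dif_pos h]
  exact h.choose_spec

theorem hasFDerivAt_kohnVogelius (h : IsDomain Ω) (hΩc : IsConnected Ω) {ΓD ΓN : Set (Vec d)}
    (hΓD : IsOpenInBoundary Ω ΓD) (hΓD0 : ΓD.Nonempty) (hΓN : IsOpenInBoundary Ω ΓN)
    (g : L2Surface ΓN) {f : L2Surface ΓN} (hf : f ∈ HHalf Ω ΓD ΓN) {p : LInf Ω × LInf Ω}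
    (hp : p ∈ LInfPos Ω ×ˢ LInfPos Ω) : ∃ J' : LInf Ω × LInf Ω →L[ℝ] ℝ,
      HasFDerivAt (kohnVogelius ΓD ΓN f g) J' p ∧ ∀ q : LInf Ω × LInf Ω, J' q =
        elasticForm q (dirichletSolution ΓD ΓN f p) (dirichletSolution ΓD ΓN f p)
          - elasticForm q (neumannSolution ΓD ΓN g p) (neumannSolution ΓD ΓN g p) := by
  obtain ⟨L, hL⟩ := exists_load h ΓD hΓN g
  obtain ⟨c, hc, hcoer⟩ := exists_coercive h hΩc hΓD hΓD0 hp
  have hN : ∀ q ∈ LInfPos Ω ×ˢ LInfPos Ω, _ := fun q hq =>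
    (isNeumannSolution_iff h hΓD hL q (neumannSolution ΓD ΓN g q)).1
      (isNeumannSolution_neumannSolution
        (existsUnique_neumannSolution h hΩc hΓD hΓD0 hΓN g hq).exists)
  have hDex : ∀ q ∈ LInfPos Ω ×ˢ LInfPos Ω, ∃ u : H1 Ω, IsDirichletSolution ΓD ΓN f q u :=
    fun q hq => (existsUnique_dirichletSolution h hΩc hΓD hΓD0 hΓN hf hq).exists
  obtain ⟨u₀, hu₀, hf₀⟩ := hf
  have hu₀ := (mem_dispVanish_iff h hΓD u₀).2 hu₀
  have hD : ∀ q ∈ LInfPos Ω ×ˢ LInfPos Ω, _ := fun q hq =>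
    (isDirichletSolution_iff h hΓD hΓN hu₀ hf₀ q (dirichletSolution ΓD ΓN f q)).1
      (isDirichletSolution_dirichletSolution (hDex q hq))
  have hU : IsOpen (X := Lame Ω) (LInfPos Ω ×ˢ LInfPos Ω) := isOpen_LInfPos.prod isOpen_LInfPos
  have key := hasFDerivAt_gap (P := Lame Ω) (H := Disp Ω) (elasticL Ω) elasticL_symm
    (V := dispVanish h ΓD) (V₀ := dispVanish h ΓN ⊓ dispVanish h ΓD) inf_le_right (L := L)
    (fun v hv hv0 => load_eq_zero h hΓN hL v hv hv0.1) hu₀ hU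
    (uN := fun q => neumannSolution ΓD ΓN g q) (uD := fun q => dirichletSolution ΓD ΓN f q)
    (fun q hq => (hN q hq).1) (fun q hq => (hN q hq).2) (fun q hq => (hD q hq).1)
    (fun q hq => (hD q hq).2) hp hc hcoer
  have hJ : kohnVogelius ΓD ΓN f g = fun q : Lame Ω => elasticL Ω q
      (neumannSolution ΓD ΓN g q - dirichletSolution ΓD ΓN f q : H1 Ω)
      (neumannSolution ΓD ΓN g q - dirichletSolution ΓD ΓN f q : H1 Ω) :=
    funext fun q => elasticForm_eq q _ _
  rw [hJ]
  refine ⟨_, key, fun q => ?_⟩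
  exact (congrArg₂ (· - ·) (elasticForm_eq q _ _) (elasticForm_eq q _ _)).symm

end

end Elasticity

open Elasticity in
theorem theorem4p1 {d : ℕ} (hd : 2 ≤ d) {Ω : Set (Vec d)} (hΩo : IsOpen Ω) (hΩc : IsConnected Ω)
    (hΩb : Bornology.IsBounded Ω) (hΩ : HasC11Boundary Ω)
    {ΓD ΓN : Set (Vec d)} (hΓD : IsOpenInBoundary Ω ΓD) (hΓN : IsOpenInBoundary Ω ΓN)
    (hΓD0 : ΓD.Nonempty) (hΓN0 : ΓN.Nonempty) (hdisj : Disjoint ΓN ΓD)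
    (hcover : frontier Ω = closure ΓN ∪ closure ΓD)
    (g : L2Surface ΓN) (f : L2Surface ΓN) (hf : f ∈ HHalf Ω ΓD ΓN) :
    (∀ p ∈ LInfPos Ω ×ˢ LInfPos Ω,
      (∃! u : H1 Ω, IsNeumannSolution ΓD ΓN g p u) ∧
      (∃! u : H1 Ω, IsDirichletSolution ΓD ΓN f p u)) ∧
    ∀ p ∈ LInfPos Ω ×ˢ LInfPos Ω, ∃ J' : LInf Ω × LInf Ω →L[ℝ] ℝ,
      HasFDerivAt (kohnVogelius ΓD ΓN f g) J' p ∧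
      ∀ q : LInf Ω × LInf Ω, J' q =
        elasticForm q (dirichletSolution ΓD ΓN f p) (dirichletSolution ΓD ΓN f p)
          - elasticForm q (neumannSolution ΓD ΓN g p) (neumannSolution ΓD ΓN g p) := by
  have h : IsDomain Ω := ⟨by omega, hΩo, hΩb, hΩ⟩
  exact ⟨fun p hp => ⟨existsUnique_neumannSolution h hΩc hΓD hΓD0 hΓN g hp,
    existsUnique_dirichletSolution h hΩc hΓD hΓD0 hΓN hf hp⟩,
    fun p hp => hasFDerivAt_kohnVogelius h hΩc hΓD hΓD0 hΓN g hf hp⟩
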